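/- **Model.** Let $a\ge 2$, and let $X_{ik}=\mu_i+\varepsilon_{ik}\in\mathbb R^d$ ($1\le i\le a$, $k\ge1$) with independent errors $\varepsilon_{ik}$ such that, for fixed $i,j$, the components $\varepsilon_{ikj}$, $k\ge 1$, are identically distributed with mean $0$ and finite variance, and $\operatorname{Var}(\varepsilon_{ik})=\Sigma_i$ for all $k$. From group $i$ one observes $X_{i1},\dots,X_{in_i}$; put $N=\sum_i n_i$, and let $N\to\infty$ with $n_i/N\to\kappa_i\in(0,1]$. Let $\mu=(\mu_1^\top,\dots,\mu_a^\top)^\top$, $\Sigma=\bigoplus_i\kappa_i^{-1}\Sigma_i$, let $\overline X\in\mathbb R^{ad}$ be the stacked vector of the group means $\overline X_i$, and let $\widetilde\Sigma$ be an estimator with $\widetilde\Sigma\to\Sigma$ in probability. **Test statistics.** Let $C=(C_1^\top,\dots,C_L^\top)^\top$ with $L\ge1$, $C_\ell\in\mathbb R^{r_\ell\times ad}$, and $\beta=(\beta_1^\top,\dots,\beta_L^\top)^\top$ with $\beta_\ell\in\mathbb R^{r_\ell}$. The local hypotheses are $\mathcal H_0^{(\ell)}:C_\ell\mu=\beta_\ell$,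 the global hypothesis is $\mathcal H_0: C\mu=\beta$. For $y\in\mathbb R^{r_\ell}$ and an $ad\times ad$ matrix $S$ put $$q_\ell(y,S)=N\,\frac{y^\top M(C_\ell,S)\,y}{\sqrt{2\operatorname{tr}([C_\ell^\top M(C_\ell,S)C_\ell S]^2)}}\;\mathbf 1\{\operatorname{tr}([C_\ell^\top M(C_\ell,S)C_\ell S]^2)>0\},\qquad Q_{N\ell}=q_\ell(C_\ell\overline X-\beta_\ell,\widetilde\Sigma).$$ **Wild bootstrap.** Let $W^{b}_{ik}$ ($b,k\ge1$, $1\le i\le a$) be i.i.d. real random variables with mean $0$ and variance $1$, independent of the data. For each $b$ form the sample $X^{\dagger,b}_{ik}=W^b_{ik}(X_{ik}-\overline X_i)$, $k\le n_i$, its stacked vector of group means $\overline X^{\dagger,b}$, and $\widehat\Sigma^{\dagger,b}=N\bigoplus_i n_i^{-1}\widehat\Sigma_i^{\dagger,b}$, where $\widehat\Sigma_i^{\dagger,b}$ is its empirical covariance matrix in group $i$. Put $Q^{\dagger,b}_{N\ell}=q_\ell(C_\ell\overline X^{\dagger,b},\widehat\Sigma^{\dagger,b})$. **Assumptions on $M$.**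 The matrix-valued function $M$ is Borel measurable in its second argument; $M(C_\ell,S)$ is symmetric and positive semidefinite for $S=\widetilde\Sigma$ and for all symmetric positive semidefinite $S$; and for the estimators $S_N=\widetilde\Sigma$ and $S_N=\widehat\Sigma^{\dagger,b}$, convergence $S_N\to\Sigma$ in probability implies $M(C_\ell,S_N)\to M(C_\ell,\Sigma)$ in probability. Moreover, for each $\ell$ the matrix $C_\ell^\top M(C_\ell,\Sigma)C_\ell\Sigma$ has a nonzero eigenvalue. **Critical values.** Let $\alpha\in(0,1)$. For $B\ge1$ and $p\in(0,1]$ let $\widehat q_{\ell}(p)=\inf\{t:\#\{b\le B:Q^{\dagger,b}_{N\ell}\le t\}\ge pB\}$ be the empirical $p$-quantile of $Q^{\dagger,1}_{N\ell},\dots,Q^{\dagger,B}_{N\ell}$, and let $$\gamma_B=\max\Big\{\gamma\in\{0,\tfrac1B,\dots,\tfrac{B-1}B\}:\ \tfrac1B\,\#\{b\le B:\exists\,\ell\ \ Q^{\dagger,b}_{N\ell}>\widehat q_{\ell}(1-\gamma)\}\le\alpha\Big\},\qquad q^\dagger_{\ell,B}=\widehat q_{\ell}(1-\gamma_B).$$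 **Claim.** Let $B_N\to\infty$ as $N\to\infty$. With the conventions $0/0=1$ and $x/0=\infty$ for $x>0$: 1. if $C\mu=\beta$, then $\displaystyle\lim_{N\to\infty}\mathbb E\Big[\mathbf 1\Big\{\max_{1\le\ell\le L} \frac{Q_{N\ell}}{q^\dagger_{\ell,B_N}}>1\Big\}\Big]=\alpha$; 2. for every $\mathcal T\subset\{1,\dots,L\}$ such that $C_\ell\mu=\beta_\ell$ for all $\ell\in\mathcal T$ (the other local hypotheses may be false), the limit $\displaystyle\lim_{N\to\infty}\mathbb E\Big[\max_{\ell\in\mathcal T}\mathbf 1\Big\{\frac{Q_{N\ell}}{q^\dagger_{\ell,B_N}}>1\Big\}\Big]$ exists and is at most $\alpha$ (the maximum over the empty set being $0$). -/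

import Mathlib

open MeasureTheory ProbabilityTheory Filter Topology
open scoped ENNReal Matrix

namespace QFMCT

noncomputable section

/-- The mean `n⁻¹ ∑_{k < n} x_k` of the first `n` vectors of `x`. -/
def sampleMean {d : ℕ} (n : ℕ) (x : ℕ → Fin d → ℝ) : Fin d → ℝ :=
  (n : ℝ)⁻¹ • ∑ k ∈ Finset.range n, x k

/-- The empirical covariance matrix of the first `n` vectors of `x`. -/
def sampleCov {d : ℕ} (n : ℕ) (x : ℕ → Fin d → ℝ) : Matrix (Fin d) (Fin d) ℝ :=
  ((n : ℝ) - 1)⁻¹ • ∑ k ∈ Finset.range n,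
    Matrix.vecMulVec (x k - sampleMean n x) (x k - sampleMean n x)

/-- The total sample size. -/
def totalSize {a : ℕ} (n : Fin a → ℕ) : ℕ := ∑ i, n i

/-- The stacked vector of the `a` group means. The coordinate `(j, i)` belongs to component `j`
of group `i`. -/
def pooledMean {a d : ℕ} (n : Fin a → ℕ) (x : Fin a → ℕ → Fin d → ℝ) : Fin d × Fin a → ℝ :=
  fun p => sampleMean (n p.2) (x p.2) p.1

/-- The pooled empirical covariance matrix: `N` times the direct sum of the matrices
`n_i⁻¹ Σ̂_i`, with `Σ̂_i` the empirical covariance matrix of group `i`. -/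
def pooledCov {a d : ℕ} (n : Fin a → ℕ) (x : Fin a → ℕ → Fin d → ℝ) :
    Matrix (Fin d × Fin a) (Fin d × Fin a) ℝ :=
  (totalSize n : ℝ) • Matrix.blockDiagonal fun i => (n i : ℝ)⁻¹ • sampleCov (n i) (x i)

/-- The limiting covariance matrix: the direct sum of the matrices `κ_i⁻¹ Σ_i`. -/
def limitCov {a d : ℕ} (κ : Fin a → ℝ) (S : Fin a → Matrix (Fin d) (Fin d) ℝ) :
    Matrix (Fin d × Fin a) (Fin d × Fin a) ℝ :=
  Matrix.blockDiagonal fun i => (κ i)⁻¹ • S i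

/-- The standardized quadratic form
`N · yᵀ M y / √(2 tr([Cᵀ M C S]²)) · 1(tr([Cᵀ M C S]²) > 0)`. -/
def quadForm {ρ ι : Type*} [Fintype ρ] [Fintype ι] [DecidableEq ι] (N : ℕ) (C : Matrix ρ ι ℝ)
    (M : Matrix ρ ρ ℝ) (S : Matrix ι ι ℝ) (y : ρ → ℝ) : ℝ :=
  if 0 < ((Cᵀ * M * C * S) ^ 2).trace then
    (N : ℝ) * (y ⬝ᵥ M *ᵥ y) / Real.sqrt (2 * ((Cᵀ * M * C * S) ^ 2).trace)
  else 0

/-- The wild bootstrap sample `W_{ik} (X_{ik} - X̄_i)`. -/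
def wildSample {a d : ℕ} (n : Fin a → ℕ) (w : Fin a → ℕ → ℝ) (x : Fin a → ℕ → Fin d → ℝ) :
    Fin a → ℕ → Fin d → ℝ :=
  fun i k => w i k • (x i k - sampleMean (n i) (x i))

/-- The `ℓ`-th block of rows of a hypothesis matrix whose rows are grouped into `L` blocks. -/
def block {L : ℕ} {r : Fin L → ℕ} {ι : Type*} (C : Matrix (Σ ℓ, Fin (r ℓ)) ι ℝ) (ℓ : Fin L) :
    Matrix (Fin (r ℓ)) ι ℝ :=
  fun s p => C ⟨ℓ, s⟩ p

/-- The `ℓ`-th block of the right-hand side. -/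
def blockVec {L : ℕ} {r : Fin L → ℕ} (β : (Σ ℓ, Fin (r ℓ)) → ℝ) (ℓ : Fin L) : Fin (r ℓ) → ℝ :=
  fun s => β ⟨ℓ, s⟩

/-- A function `M(C, S)` that turns a matrix `C` with `r` rows (for any `r`) and a square matrix
`S` into an `r × r` matrix. -/
abbrev WeightFunction (a d : ℕ) : Type :=
  (r : ℕ) → Matrix (Fin r) (Fin d × Fin a) ℝ →
    Matrix (Fin d × Fin a) (Fin d × Fin a) ℝ → Matrix (Fin r) (Fin r) ℝ

/-- The `ℓ`-th test statistic, computed from the data `x` with the covariance estimate `S`. -/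
def testStat {a d L : ℕ} {r : Fin L → ℕ} (M : WeightFunction a d)
    (C : Matrix (Σ ℓ, Fin (r ℓ)) (Fin d × Fin a) ℝ) (β : (Σ ℓ, Fin (r ℓ)) → ℝ)
    (n : Fin a → ℕ) (x : Fin a → ℕ → Fin d → ℝ)
    (S : Matrix (Fin d × Fin a) (Fin d × Fin a) ℝ) (ℓ : Fin L) : ℝ :=
  quadForm (totalSize n) (block C ℓ) (M (r ℓ) (block C ℓ) S) S
    (block C ℓ *ᵥ pooledMean n x - blockVec β ℓ)

/-- The `ℓ`-th wild bootstrap quadratic form, computed from the data `x` and the multipliers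
`w`; mean and covariance estimator are those of the wild bootstrap sample. -/
def wildStat {a d L : ℕ} {r : Fin L → ℕ} (M : WeightFunction a d)
    (C : Matrix (Σ ℓ, Fin (r ℓ)) (Fin d × Fin a) ℝ)
    (n : Fin a → ℕ) (x : Fin a → ℕ → Fin d → ℝ) (w : Fin a → ℕ → ℝ) (ℓ : Fin L) : ℝ :=
  quadForm (totalSize n) (block C ℓ)
    (M (r ℓ) (block C ℓ) (pooledCov n (wildSample n w x))) (pooledCov n (wildSample n w x))
    (block C ℓ *ᵥ pooledMean n (wildSample n w x))

/-- The `p`-quantile `inf {t : F̂(t) ≥ p}` of the empirical distribution `F̂` of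
`z 0, …, z (B - 1)`. -/
def empQuantile (B : ℕ) (z : ℕ → ℝ) (p : ℝ) : ℝ :=
  sInf {t : ℝ | p ≤ (B : ℝ)⁻¹ * ((Finset.range B).filter fun b => z b ≤ t).card}

/-- The estimated family-wise error rate at the local level `γ`: the proportion of the replicates
`z b`, `b < B`, that have a component above its empirical `(1 - γ)`-quantile. -/
def empFWER {L : ℕ} (B : ℕ) (z : ℕ → Fin L → ℝ) (γ : ℝ) : ℝ :=
  open Classical in
  (B : ℝ)⁻¹ * ((Finset.range B).filter fun b =>
    ∃ ℓ, empQuantile B (fun c => z c ℓ) (1 - γ) < z b ℓ).card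

/-- The largest local level in `{0, 1/B, …, (B-1)/B}` at which the estimated family-wise error
rate is at most `α`. -/
def localLevel {L : ℕ} (α : ℝ) (B : ℕ) (z : ℕ → Fin L → ℝ) : ℝ :=
  sSup {γ : ℝ | (∃ k < B, γ = (k : ℝ) / B) ∧ empFWER B z γ ≤ α}

/-- The critical value for the `ℓ`-th component: its empirical quantile at the common
balanced local level. -/
def critValue {L : ℕ} (α : ℝ) (B : ℕ) (z : ℕ → Fin L → ℝ) (ℓ : Fin L) : ℝ :=
  empQuantile B (fun c => z c ℓ) (1 - localLevel α B z)

/-- The ratio `x / q` of two nonnegative numbers with `0 / 0 = 1` and `x / 0 = ∞` for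
`x > 0`. -/
def ratio (x q : ℝ) : ℝ≥0∞ :=
  if x = 0 ∧ q = 0 then 1 else ENNReal.ofReal x / ENNReal.ofReal q

/-- Entrywise convergence in probability of random matrices to a constant matrix. -/
def ConvInProb {Ω ρ τ : Type*} [MeasurableSpace Ω] (P : Measure Ω) (S : ℕ → Ω → Matrix ρ τ ℝ)
    (T : Matrix ρ τ ℝ) : Prop :=
  ∀ p q, TendstoInMeasure P (fun m ω => S m ω p q) atTop (fun _ => T p q)

/-- If the estimators `S m` are consistent for `T`, then so are `f (S m)` for `f T`. -/
def PlugInConsistent {Ω ρ ι : Type*} [MeasurableSpace Ω] (P : Measure Ω)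
    (f : Matrix ι ι ℝ → Matrix ρ ρ ℝ) (S : ℕ → Ω → Matrix ι ι ℝ) (T : Matrix ι ι ℝ) : Prop :=
  ConvInProb P S T → ConvInProb P (fun m ω => f (S m ω)) (f T)

/-- The observations `X_{ik} = μ_i + ε_{ik}` at the outcome `ω`. -/
def obs {Ω : Type*} {a d : ℕ} (mu : Fin a → Fin d → ℝ) (ε : Fin a → ℕ → Ω → Fin d → ℝ) (ω : Ω) :
    Fin a → ℕ → Fin d → ℝ :=
  fun i k => mu i + ε i k ω

/-- The ratio of the `ℓ`-th test statistic to its wild bootstrap critical value, computed at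
level `α` from `B` bootstrap replicates with the multipliers `w 0, …, w (B - 1)`. -/
def testRatio {a d L : ℕ} {r : Fin L → ℕ} (α : ℝ) (M : WeightFunction a d)
    (C : Matrix (Σ ℓ, Fin (r ℓ)) (Fin d × Fin a) ℝ) (β : (Σ ℓ, Fin (r ℓ)) → ℝ)
    (n : Fin a → ℕ) (B : ℕ) (x : Fin a → ℕ → Fin d → ℝ)
    (S : Matrix (Fin d × Fin a) (Fin d × Fin a) ℝ) (w : ℕ → Fin a → ℕ → ℝ) (ℓ : Fin L) : ℝ≥0∞ :=
  ratio (testStat M C β n x S ℓ) (critValue α B (fun b => wildStat M C n x (w b)) ℓ)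

end

end QFMCT

/-! Fix a square root `R * Rᵀ = Σ` of the limiting covariance and a standard Gaussian vector `g`.
The statistics, centred at the true means, are quadratic forms in `√N (X̄ - μ)`. Their coefficient
matrices converge in probability: the nonzero eigenvalue makes the trace in the denominator positive
at the limit, so the standardization is continuous there. The central limit theorem for group means
therefore gives a joint limit law `μ` on `ℝ^L`, that of a vector of nonzero positive semidefinite
Gaussian quadratic forms (`ErrorModel.tendsto_exceedSet`). For the true hypotheses these are the
actual test statistics.

The bootstrap is handled without conditioning on the data. Two different replicates converge jointly
to `μ ⊗ μ` (`Multipliers.tendsto_wildStat`), because `W^b ε` and `W^c ε` are uncorrelated and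
centring at the group mean is negligible. All pairs of replicates have the same joint law, so a
second moment computation (`tendstoInMeasure_empFreq`) shows that the empirical frequencies of
exceedance events converge in probability to their `μ`-probabilities, whatever the rate of `B_N →
∞`.

The errors of a group share only their componentwise laws, so a linear combination of components
need not be identically distributed in `k`. It is still uniformly square integrable, which is what
the Lindeberg argument (`tendsto_prod_charFun`) and the laws of large numbers use.

For the calibration let `x γ` be the vector of upper `γ`-quantiles of `μ`. The coordinates of `μ`
have no atoms, which makes the family-wise error `γ ↦ μ(∃ ℓ, z_ℓ > x_ℓ(γ))` continuous. Moving along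
a ray shows that `μ` charges the region between two nested boxes, which makes it strictly
increasing. Some `γ` thus attains exactly `α`, and strictness traps the random critical values
between `x (γ + 4δ)` and `x (γ - 4δ)` with probability tending to one
(`EmpiricallyConsistent.whp_critValue`). The rejection probability over `T` tends to `μ(∃ ℓ ∈ T, z_ℓ
> x_ℓ(γ))`, which is `α` for the full index set and at most `α` for a subset. -/

namespace QFMCT

noncomputable section

/-! ### Empirical frequencies and quantiles -/

/-- The proportion of the indices `b < B` that satisfy `s`. -/
def empFreq (B : ℕ) (s : ℕ → Prop) : ℝ :=
  open Classical in (B : ℝ)⁻¹ * ((Finset.range B).filter s).card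

lemma empFreq_mono {B : ℕ} {s t : ℕ → Prop} (h : ∀ b, s b → t b) : empFreq B s ≤ empFreq B t := by
  classical
  unfold empFreq
  gcongr with b
  exact h b

lemma empFreq_compl {B : ℕ} (hB : 0 < B) (s : ℕ → Prop) :
    empFreq B (fun b => ¬ s b) = 1 - empFreq B s := by
  classical
  have h := Finset.card_filter_add_card_filter_not (s := Finset.range B) s
  rw [Finset.card_range] at h
  have hB' : (B : ℝ) ≠ 0 := by positivity
  have h' : (((Finset.range B).filter s).card : ℝ)
      + ((Finset.range B).filter fun b => ¬ s b).card = B := by exact_mod_cast h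
  have hs : empFreq B s = (B : ℝ)⁻¹ * ((Finset.range B).filter s).card := by
    unfold empFreq; congr!
  have hs' : empFreq B (fun b => ¬ s b)
      = (B : ℝ)⁻¹ * ((Finset.range B).filter fun b => ¬ s b).card := by
    unfold empFreq; congr!
  rw [hs, hs', ← mul_inv_cancel₀ hB']
  linear_combination (B : ℝ)⁻¹ * h'

lemma empFreq_eq_sum (B : ℕ) (s : ℕ → Prop) [DecidablePred s] :
    empFreq B s = (B : ℝ)⁻¹ * ∑ b ∈ Finset.range B, if s b then (1 : ℝ) else 0 := by
  unfold empFreq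
  rw [Finset.sum_boole]
  congr!

lemma empQuantile_eq (B : ℕ) (z : ℕ → ℝ) (p : ℝ) :
    empQuantile B z p = sInf {t : ℝ | p ≤ empFreq B fun b => z b ≤ t} := by
  unfold empQuantile empFreq
  congr!

lemma empFWER_eq {L : ℕ} (B : ℕ) (z : ℕ → Fin L → ℝ) (γ : ℝ) :
    empFWER B z γ = empFreq B fun b => ∃ ℓ, empQuantile B (fun c => z c ℓ) (1 - γ) < z b ℓ := by
  unfold empFWER empFreq
  congr!

lemma empFreq_eq_zero {B : ℕ} {s : ℕ → Prop} (h : ∀ b < B, ¬ s b) : empFreq B s = 0 := by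
  classical
  unfold empFreq
  rw [Finset.filter_eq_empty_iff.2 fun b hb => h b (Finset.mem_range.1 hb)]
  simp

lemma empFreq_eq_one {B : ℕ} (hB : 0 < B) {s : ℕ → Prop} (h : ∀ b < B, s b) :
    empFreq B s = 1 := by
  have h0 : empFreq B (fun b => ¬ s b) = 0 := empFreq_eq_zero fun b hb => not_not.2 (h b hb)
  rw [empFreq_compl hB] at h0
  linarith

/-- Positivity of `p` bounds the defining set from below: left of all observations the frequency is
`0 < p`. Without it the infimum would be the default value `0`. -/
lemma empQuantile_le {B : ℕ} {z : ℕ → ℝ} {p t : ℝ} (hp : 0 < p)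
    (h : p ≤ empFreq B fun b => z b ≤ t) : empQuantile B z p ≤ t := by
  rw [empQuantile_eq]
  refine csInf_le ?_ h
  obtain ⟨m, hm⟩ := ((Finset.range B).image z).bddBelow
  refine ⟨m, fun t ht => ?_⟩
  by_contra! hlt
  have : empFreq B (fun b => z b ≤ t) = 0 := empFreq_eq_zero fun b hb hz =>
    absurd (hm (Finset.mem_coe.2 (Finset.mem_image_of_mem z (Finset.mem_range.2 hb))))
      (not_le.2 (hz.trans_lt hlt))
  have ht' : p ≤ empFreq B fun b => z b ≤ t := ht
  linarith

/-- Here `B > 0` and `p ≤ 1` make the defining set nonempty, since the largest observation has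
frequency one. -/
lemma le_empQuantile {B : ℕ} (hB : 0 < B) {z : ℕ → ℝ} {p v : ℝ} (hp : p ≤ 1)
    (h : (empFreq B fun b => z b ≤ v) < p) : v ≤ empQuantile B z p := by
  rw [empQuantile_eq]
  refine le_csInf ?_ fun t ht => ?_
  · obtain ⟨m, hm⟩ := ((Finset.range B).image z).bddAbove
    refine ⟨m, hp.trans (empFreq_eq_one hB fun b hb => ?_).ge⟩
    exact hm (Finset.mem_coe.2 (Finset.mem_image_of_mem z (Finset.mem_range.2 hb)))
  · by_contra! hlt
    have ht' : p ≤ empFreq B fun b => z b ≤ t := ht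
    have := empFreq_mono (B := B) (s := fun b => z b ≤ t) (t := fun b => z b ≤ v)
      fun b hb => hb.trans hlt.le
    linarith

lemma empQuantile_nonneg {B : ℕ} {z : ℕ → ℝ} {p : ℝ} (hp : 0 < p) (hz : ∀ b, 0 ≤ z b) :
    0 ≤ empQuantile B z p := by
  rw [empQuantile_eq]
  refine Real.sInf_nonneg fun t ht => ?_
  by_contra! hlt
  have h0 : empFreq B (fun b => z b ≤ t) = 0 :=
    empFreq_eq_zero fun b _ => not_le.2 (hlt.trans_le (hz b))
  have ht' : p ≤ empFreq B fun b => z b ≤ t := ht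
  linarith

/-! ### Deterministic bounds for the calibrated critical values -/

section LocalLevel

variable {L : ℕ} {α : ℝ} {B : ℕ} {z : ℕ → Fin L → ℝ}

lemma grid_le {k : ℕ} (hk : k < B) : (k : ℝ) / B ≤ ((B : ℝ) - 1) / B := by
  have : (k : ℝ) + 1 ≤ B := by exact_mod_cast hk
  gcongr
  linarith

lemma localLevel_nonneg : 0 ≤ localLevel α B z := by
  refine Real.sSup_nonneg ?_
  rintro _ ⟨⟨k, _, rfl⟩, _⟩
  positivity

/-- Strictness keeps the order `1 - localLevel α B z` of the critical quantile positive, as the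
quantile lemmas require. For `B = 0` the supremum is over the empty set and equals `0`. -/
lemma localLevel_lt_one : localLevel α B z < 1 := by
  rcases Nat.eq_zero_or_pos B with rfl | hB
  · simp [localLevel]
  have hB' : (1 : ℝ) ≤ B := by exact_mod_cast hB
  have : localLevel α B z ≤ ((B : ℝ) - 1) / B := by
    refine Real.sSup_le ?_ (by apply div_nonneg <;> linarith)
    rintro _ ⟨⟨k, hk, rfl⟩, _⟩
    exact grid_le hk
  refine this.trans_lt ?_
  rw [div_lt_one (by linarith)]
  linarith

lemma le_localLevel {γ : ℝ} (hγ : ∃ k < B, γ = (k : ℝ) / B) (h : empFWER B z γ ≤ α) :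
    γ ≤ localLevel α B z := by
  refine le_csSup ⟨((B : ℝ) - 1) / B, ?_⟩ ⟨hγ, h⟩
  rintro _ ⟨⟨k, hk, rfl⟩, _⟩
  exact grid_le hk

lemma critValue_nonneg (hz : ∀ b ℓ, 0 ≤ z b ℓ) (ℓ : Fin L) : 0 ≤ critValue α B z ℓ :=
  empQuantile_nonneg (sub_pos.2 localLevel_lt_one) fun b => hz b ℓ

/-- The thresholds `u` lie below the empirical quantiles of order `1 - k/B`, so the estimated error
rate at level `k/B` is at most the frequency of exceeding `u`, hence at most `α`. The grid level
`k/B` is therefore admissible, the selected level is at least `γ`, and the critical quantile has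
order at most `1 - γ`. A grid point between `γ` and `γ'` is needed because only grid levels compete.
-/
lemma critValue_le {γ γ' : ℝ} {u v : Fin L → ℝ} {k : ℕ} (hk : k < B)
    (hkγ : γ ≤ k / B) (hkγ' : (k : ℝ) / B ≤ γ')
    (hu : ∀ ℓ, (empFreq B fun b => z b ℓ ≤ u ℓ) < 1 - γ')
    (hα : (empFreq B fun b => ∃ ℓ, u ℓ < z b ℓ) ≤ α)
    {ℓ : Fin L} (hv : 1 - γ ≤ empFreq B fun b => z b ℓ ≤ v ℓ) :
    critValue α B z ℓ ≤ v ℓ := by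
  have hB : 0 < B := (Nat.zero_le k).trans_lt hk
  have hlevel : (k : ℝ) / B ≤ localLevel α B z := by
    refine le_localLevel ⟨k, hk, rfl⟩ (le_trans ?_ hα)
    rw [empFWER_eq]
    refine empFreq_mono fun b ⟨ℓ, hℓ⟩ => ⟨ℓ, lt_of_le_of_lt ?_ hℓ⟩
    refine le_empQuantile hB ?_ ((hu ℓ).trans_le (by linarith))
    have : 0 ≤ (k : ℝ) / B := by positivity
    linarith
  refine empQuantile_le (sub_pos.2 localLevel_lt_one) (le_trans ?_ hv)
  linarith

/-- A grid level above `γ` has quantiles below `u`, so its estimated error rate is at least the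
frequency of exceeding `u` and violates the bound `α`. The selected level is thus at most `γ`; `0 ≤
γ` covers the case that no grid level is admissible and the supremum defaults to `0`. -/
lemma le_critValue (hB : 0 < B) {γ : ℝ} {u v : Fin L → ℝ} (hγ : 0 ≤ γ)
    (hu : ∀ ℓ, 1 - γ ≤ empFreq B fun b => z b ℓ ≤ u ℓ)
    (hα : α < empFreq B fun b => ∃ ℓ, u ℓ < z b ℓ)
    {ℓ : Fin L} (hv : (empFreq B fun b => z b ℓ ≤ v ℓ) < 1 - γ) :
    v ℓ ≤ critValue α B z ℓ := by
  have hlevel : localLevel α B z ≤ γ := by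
    refine Real.sSup_le ?_ hγ
    rintro _ ⟨⟨k, hk, rfl⟩, hle⟩
    by_contra! hlt
    refine absurd (hα.trans_le ?_) (not_lt.2 hle)
    rw [empFWER_eq]
    refine empFreq_mono fun b ⟨ℓ, hℓ⟩ => ⟨ℓ, lt_of_le_of_lt ?_ hℓ⟩
    refine empQuantile_le ?_ (le_trans (by linarith) (hu ℓ))
    have : (k : ℝ) / B < 1 := by
      rw [div_lt_one (by positivity)]
      exact_mod_cast hk
    linarith
  refine le_empQuantile hB ?_ (hv.trans_le (by linarith))
  have := localLevel_nonneg (α := α) (B := B) (z := z)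
  linarith

end LocalLevel

/-- The conventions for division by zero are exactly those that keep this equivalence valid at `q =
0`. -/
lemma one_lt_ratio {x q : ℝ} (hx : 0 ≤ x) (hq : 0 ≤ q) : 1 < ratio x q ↔ q < x := by
  unfold ratio
  split_ifs with h
  · simp [h.1, h.2]
  · rcases hq.eq_or_lt with rfl | hq
    · have hx' : 0 < x := hx.lt_of_ne' fun h0 => h ⟨h0, rfl⟩
      simp [ENNReal.div_zero, hx']
    · rw [ENNReal.lt_div_iff_mul_lt (by simp [hq]) (by simp), one_mul,
        ENNReal.ofReal_lt_ofReal_iff']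
      exact ⟨fun h => h.1, fun h => ⟨h, hq.trans h⟩⟩

/-! ### Events of probability tending to one, and a law of large numbers for exchangeable events -/

section HighProbability

variable {Ω : Type*} [MeasurableSpace Ω] {P : Measure Ω} [IsProbabilityMeasure P]

/-- The events `E m` hold with probability tending to one. -/
def Whp (P : Measure Ω) (E : ℕ → Ω → Prop) : Prop :=
  Tendsto (fun m => P.real {ω | ¬ E m ω}) atTop (𝓝 0)

/-- Only monotonicity and subadditivity of the outer measure enter this calculus, so events about
the critical values need no measurability proof. -/
lemma Whp.mono {E F : ℕ → Ω → Prop} (hE : Whp P E) (h : ∀ᶠ m in atTop, ∀ ω, E m ω → F m ω) :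
    Whp P F := by
  refine squeeze_zero' (Eventually.of_forall fun m => measureReal_nonneg) ?_ hE
  filter_upwards [h] with m hm
  exact measureReal_mono fun ω hω hE => hω (hm ω hE)

lemma Whp.and {E F : ℕ → Ω → Prop} (hE : Whp P E) (hF : Whp P F) :
    Whp P fun m ω => E m ω ∧ F m ω := by
  have h := Tendsto.add hE hF
  rw [add_zero] at h
  refine squeeze_zero (fun m => measureReal_nonneg) (fun m => ?_) h
  refine (measureReal_mono ?_).trans (measureReal_union_le _ _)
  intro ω hω
  simpa [or_iff_not_imp_left] using hω

lemma Whp.forall_fintype {ι : Type*} [Fintype ι] {E : ι → ℕ → Ω → Prop}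
    (hE : ∀ i, Whp P (E i)) : Whp P fun m ω => ∀ i, E i m ω := by
  have h := tendsto_finsetSum Finset.univ fun i _ => hE i
  rw [Finset.sum_const_zero] at h
  refine squeeze_zero (fun m => measureReal_nonneg) (fun m => ?_) h
  refine (measureReal_mono ?_).trans (measureReal_iUnion_fintype_le _)
  intro ω hω
  simpa using hω

lemma whp_abs_sub_lt {X : ℕ → Ω → ℝ} {p : ℝ}
    (hX : TendstoInMeasure P X atTop fun _ => p) {ε : ℝ} (hε : 0 < ε) :
    Whp P fun m ω => |X m ω - p| < ε := by
  have := tendstoInMeasure_iff_measureReal_norm.1 hX ε hε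
  simpa [Whp, Real.norm_eq_abs] using this

lemma whp_lt {X : ℕ → Ω → ℝ} {p c : ℝ}
    (hX : TendstoInMeasure P X atTop fun _ => p) (hc : p < c) : Whp P fun m ω => X m ω < c :=
  (whp_abs_sub_lt hX (sub_pos.2 hc)).mono <| Eventually.of_forall fun m ω h => by
    have := (abs_lt.1 h).2
    linarith

lemma whp_gt {X : ℕ → Ω → ℝ} {p c : ℝ}
    (hX : TendstoInMeasure P X atTop fun _ => p) (hc : c < p) : Whp P fun m ω => c < X m ω :=
  (whp_abs_sub_lt hX (sub_pos.2 hc)).mono <| Eventually.of_forall fun m ω h => by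
    have := (abs_lt.1 h).1
    linarith

lemma tendstoInMeasure_of_integral_pow {X : ℕ → Ω → ℝ} {c : ℝ} (k : ℕ) (hk : k ≠ 0)
    (hint : ∀ m, Integrable (fun ω => |X m ω - c| ^ k) P)
    (h : Tendsto (fun m => ∫ ω, |X m ω - c| ^ k ∂P) atTop (𝓝 0)) :
    TendstoInMeasure P X atTop fun _ => c := by
  rw [tendstoInMeasure_iff_measureReal_norm]
  intro ε hε
  have h' := h.const_mul (ε ^ k)⁻¹
  rw [mul_zero] at h'
  refine squeeze_zero (fun m => measureReal_nonneg) (fun m => ?_) h'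
  have := mul_meas_ge_le_integral_of_nonneg
    (Eventually.of_forall fun ω => by positivity) (hint m) (ε ^ k)
  rw [inv_mul_eq_div, le_div_iff₀' (by positivity)]
  refine le_trans (le_of_eq ?_) this
  congr 2
  ext ω
  simp only [Set.mem_ofPred_eq, Real.norm_eq_abs]
  rw [pow_le_pow_iff_left₀ hε.le (abs_nonneg _) hk]

/-- With `p₁` and `p₁₂` the probabilities of one event and of two events jointly, `E (F - p)² = B⁻¹
p₁ + (1 - B⁻¹) p₁₂ - 2 p p₁ + p²`, which tends to `p² - 2p² + p² = 0`. Asymptotic pairwise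
independence suffices; this replaces any conditional argument given the data. -/
lemma tendstoInMeasure_empFreq {A : ℕ → ℕ → Set Ω} (hA : ∀ m b, MeasurableSet (A m b))
    {B : ℕ → ℕ} (hB : Tendsto B atTop atTop) {p : ℝ}
    (h1 : ∀ m b, P.real (A m b) = P.real (A m 0))
    (h2 : ∀ m b c, b ≠ c → P.real (A m b ∩ A m c) = P.real (A m 0 ∩ A m 1))
    (t1 : Tendsto (fun m => P.real (A m 0)) atTop (𝓝 p))
    (t2 : Tendsto (fun m => P.real (A m 0 ∩ A m 1)) atTop (𝓝 (p ^ 2))) :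
    TendstoInMeasure P (fun m ω => empFreq (B m) fun b => ω ∈ A m b) atTop fun _ => p := by
  classical
  have hint : ∀ m b, Integrable (fun ω => if ω ∈ A m b then (1 : ℝ) else 0) P := fun m b =>
    ((integrable_const (1 : ℝ)).indicator (hA m b)).congr
      (Eventually.of_forall fun ω => by simp [Set.indicator_apply])
  have hval : ∀ s : Set Ω, MeasurableSet s → ∫ ω, (if ω ∈ s then (1 : ℝ) else 0) ∂P = P.real s := by
    intro s hs
    rw [← integral_indicator_one hs]
    simp [Set.indicator_apply]
  have hint2 : ∀ m b c, Integrable (fun ω => (if ω ∈ A m b then (1 : ℝ) else 0) *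
      (if ω ∈ A m c then (1 : ℝ) else 0)) P := fun m b c =>
    ((integrable_const (1 : ℝ)).indicator ((hA m b).inter (hA m c))).congr
      (Eventually.of_forall fun ω => by
        by_cases hb : ω ∈ A m b <;> by_cases hc : ω ∈ A m c <;> simp [hb, hc])
  have hval2 : ∀ m b c, ∫ ω, (if ω ∈ A m b then (1 : ℝ) else 0) *
      (if ω ∈ A m c then (1 : ℝ) else 0) ∂P = P.real (A m b ∩ A m c) := by
    intro m b c
    rw [← hval _ ((hA m b).inter (hA m c))]
    congr with ω
    by_cases hb : ω ∈ A m b <;> by_cases hc : ω ∈ A m c <;> simp [hb, hc]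
  have hexp : ∀ m ω, |(empFreq (B m) fun b => ω ∈ A m b) - p| ^ 2 =
      ((B m : ℝ)⁻¹) ^ 2 * ∑ b ∈ Finset.range (B m), ∑ c ∈ Finset.range (B m),
        (if ω ∈ A m b then (1 : ℝ) else 0) * (if ω ∈ A m c then (1 : ℝ) else 0)
      - 2 * p * (B m : ℝ)⁻¹ * ∑ b ∈ Finset.range (B m), (if ω ∈ A m b then (1 : ℝ) else 0)
      + p ^ 2 := by
    intro m ω
    rw [sq_abs, empFreq_eq_sum, ← Finset.sum_mul_sum]
    ring
  have i1 : ∀ m, Integrable (fun ω => ((B m : ℝ)⁻¹) ^ 2 * ∑ b ∈ Finset.range (B m),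
      ∑ c ∈ Finset.range (B m), (if ω ∈ A m b then (1 : ℝ) else 0) *
        (if ω ∈ A m c then (1 : ℝ) else 0)) P := fun m =>
    (integrable_finsetSum _ fun b _ => integrable_finsetSum _ fun c _ => hint2 m b c).const_mul _
  have i2 : ∀ m, Integrable (fun ω => 2 * p * (B m : ℝ)⁻¹ *
      ∑ b ∈ Finset.range (B m), (if ω ∈ A m b then (1 : ℝ) else 0)) P := fun m =>
    (integrable_finsetSum _ fun b _ => hint m b).const_mul _
  refine tendstoInMeasure_of_integral_pow 2 two_ne_zero (fun m => ?_) ?_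
  · simp_rw [hexp]
    exact ((i1 m).sub (i2 m)).add (integrable_const _)
  · have hI : ∀ m, 0 < B m → ∫ ω, |(empFreq (B m) fun b => ω ∈ A m b) - p| ^ 2 ∂P =
        (B m : ℝ)⁻¹ * P.real (A m 0) + (1 - (B m : ℝ)⁻¹) * P.real (A m 0 ∩ A m 1)
          - 2 * p * P.real (A m 0) + p ^ 2 := by
      intro m hm
      have hm' : (B m : ℝ) ≠ 0 := by positivity
      simp_rw [hexp]
      rw [integral_add (by exact (i1 m).sub (i2 m)) (integrable_const _), integral_sub (i1 m) (i2 m),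
        integral_const_mul, integral_const_mul, integral_finsetSum _ fun b _ =>
          integrable_finsetSum _ fun c _ => hint2 m b c, integral_finsetSum _ fun b _ => hint m b]
      simp_rw [integral_finsetSum _ fun c _ => hint2 m _ c, hval2, hval _ (hA m _), h1 m]
      -- Each row of the double sum has one diagonal term, of probability `p₁`, and `B - 1`
      -- off-diagonal ones, of probability `p₁₂`.
      have hrow : ∀ b ∈ Finset.range (B m), ∑ c ∈ Finset.range (B m), P.real (A m b ∩ A m c) =
          P.real (A m 0) + ((B m : ℝ) - 1) * P.real (A m 0 ∩ A m 1) := by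
        intro b hb
        rw [← Finset.add_sum_erase _ _ hb, Set.inter_self, h1 m b, Finset.sum_congr rfl fun c hc =>
          h2 m b c (Finset.ne_of_mem_erase hc).symm, Finset.sum_const, Finset.card_erase_of_mem hb,
          Finset.card_range, nsmul_eq_mul, Nat.cast_sub hm, Nat.cast_one]
      rw [Finset.sum_congr rfl hrow]
      simp only [Finset.sum_const, Finset.card_range, nsmul_eq_mul, integral_const,
        probReal_univ, smul_eq_mul, one_mul]
      field_simp
    have hBinv : Tendsto (fun m => (B m : ℝ)⁻¹) atTop (𝓝 0) :=
      tendsto_inv_atTop_zero.comp (tendsto_natCast_atTop_atTop.comp hB)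
    have hlim := (((hBinv.mul t1).add ((hBinv.const_sub 1).mul t2)).sub
      (t1.const_mul (2 * p))).add_const (p ^ 2)
    refine (hlim.congr' ?_).trans_eq ?_
    · filter_upwards [hB.eventually_gt_atTop 0] with m hm using (hI m hm).symm
    · congr 1
      ring

end HighProbability

/-! ### Exceedance sets and regular limit laws -/

/-- The vectors that exceed the threshold `x` in some component from `T`. -/
def exceedSet {L : ℕ} (T : Finset (Fin L)) (x : Fin L → ℝ) : Set (Fin L → ℝ) :=
  {z | ∃ ℓ ∈ T, x ℓ < z ℓ}

lemma isOpen_exceedSet {L : ℕ} (T : Finset (Fin L)) (x : Fin L → ℝ) :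
    IsOpen (exceedSet T x) := by
  have : exceedSet T x = ⋃ ℓ ∈ T, {z | x ℓ < z ℓ} := by
    ext z; simp [exceedSet]
  rw [this]
  exact isOpen_biUnion fun ℓ _ => isOpen_lt continuous_const (continuous_apply ℓ)

lemma exceedSet_anti {L : ℕ} (T : Finset (Fin L)) {x y : Fin L → ℝ} (h : ∀ ℓ ∈ T, x ℓ ≤ y ℓ) :
    exceedSet T y ⊆ exceedSet T x :=
  fun _ ⟨ℓ, hT, hℓ⟩ => ⟨ℓ, hT, (h ℓ hT).trans_lt hℓ⟩

/-- A law on `ℝ^L` whose coordinates are positive and atomless, and which charges each box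
complement between two positive thresholds. -/
structure RegularLaw {L : ℕ} (μ : Measure (Fin L → ℝ)) : Prop where
  atomless : ∀ ℓ c, μ {z | z ℓ = c} = 0
  nonneg : ∀ ℓ, μ {z | z ℓ < 0} = 0
  strict : ∀ x y : Fin L → ℝ, (∀ ℓ, 0 < x ℓ) → (∀ ℓ, x ℓ < y ℓ) →
    0 < μ {z | (∃ ℓ, x ℓ < z ℓ) ∧ ∀ ℓ, z ℓ < y ℓ}

section RegularLaw

variable {L : ℕ} {μ : Measure (Fin L → ℝ)} [IsProbabilityMeasure μ]

/-- Without atoms the distribution function is continuous, and the intermediate value theorem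
applies. -/
lemma exists_real_lt_eq {ν : Measure ℝ} [IsProbabilityMeasure ν] (hν : ∀ c, ν {c} = 0)
    {p : ℝ} (hp : p ∈ Set.Ioo (0 : ℝ) 1) : ∃ x, ν.real (Set.Iic x) = p := by
  have hcont : Continuous (cdf ν) := by
    rw [continuous_iff_continuousAt]
    intro x
    rw [(monotone_cdf ν).continuousAt_iff_leftLim_eq_rightLim, StieltjesFunction.rightLim_eq]
    have h := (cdf ν).measure_singleton x
    rw [measure_cdf, hν x, eq_comm, ENNReal.ofReal_eq_zero] at h
    exact le_antisymm ((monotone_cdf ν).leftLim_le le_rfl) (by linarith)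
  obtain ⟨x, hx⟩ := mem_range_of_exists_le_of_exists_ge hcont
    ((tendsto_cdf_atBot ν).eventually_le_const hp.1).exists
    ((tendsto_cdf_atTop ν).eventually_const_le hp.2).exists
  exact ⟨x, by rw [← cdf_eq_real, hx]⟩

lemma RegularLaw.exists_quantile (hμ : RegularLaw μ) (ℓ : Fin L) {γ : ℝ}
    (hγ : γ ∈ Set.Ioo (0 : ℝ) 1) : ∃ x, 0 < x ∧ μ.real {z | x < z ℓ} = γ := by
  have hm : Measurable fun z : Fin L → ℝ => z ℓ := measurable_pi_apply ℓ
  have : IsProbabilityMeasure (μ.map fun z => z ℓ) :=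
    Measure.isProbabilityMeasure_map hm.aemeasurable
  have hle : ∀ c, μ.real {z | z ℓ ≤ c} = (μ.map fun z => z ℓ).real (Set.Iic c) := fun c => by
    rw [map_measureReal_apply hm measurableSet_Iic]; rfl
  obtain ⟨x, hx⟩ := exists_real_lt_eq (ν := μ.map fun z => z ℓ) (fun c => by
    rw [Measure.map_apply hm (measurableSet_singleton c)]; exact hμ.atomless ℓ c)
    (p := 1 - γ) ⟨by linarith [hγ.2], by linarith [hγ.1]⟩
  rw [← hle] at hx
  refine ⟨x, ?_, ?_⟩
  · by_contra! h0
    have : μ {z | z ℓ ≤ x} = 0 := by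
      refine measure_mono_null (fun z (hz : z ℓ ≤ x) => ?_)
        (measure_union_null (hμ.atomless ℓ 0) (hμ.nonneg ℓ))
      rcases (hz.trans h0).eq_or_lt with h | h
      exacts [Or.inl h, Or.inr h]
    rw [measureReal_def, this] at hx
    simp at hx
    linarith [hγ.2]
  · have hc : {z : Fin L → ℝ | x < z ℓ} = {z | z ℓ ≤ x}ᶜ := by ext z; simp
    rw [hc, probReal_compl_eq_one_sub (measurableSet_le hm measurable_const), hx]
    ring

end RegularLaw

/-! ### The calibrated level and the sandwich for the critical values -/

section Calibration

variable {L : ℕ} {μ : Measure (Fin L → ℝ)} [IsProbabilityMeasure μ]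

/-- `x γ` is, for every `γ ∈ (0, 1)`, the vector of the `(1 - γ)`-quantiles of `μ`. -/
def IsUpperQuantile (μ : Measure (Fin L → ℝ)) (x : ℝ → Fin L → ℝ) : Prop :=
  ∀ γ ∈ Set.Ioo (0 : ℝ) 1, ∀ ℓ, 0 < x γ ℓ ∧ μ.real {z | x γ ℓ < z ℓ} = γ

/-- Any choice of quantiles will do: exact tail probabilities already force `x γ` to decrease
strictly in `γ`. -/
lemma RegularLaw.exists_isUpperQuantile (hμ : RegularLaw μ) : ∃ x, IsUpperQuantile μ x := by
  choose f hf using fun (γ : Set.Ioo (0 : ℝ) 1) ℓ => hμ.exists_quantile ℓ γ.2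
  classical
  refine ⟨fun γ ℓ => if h : γ ∈ Set.Ioo (0 : ℝ) 1 then f ⟨γ, h⟩ ℓ else 0, fun γ hγ ℓ => ?_⟩
  simp only [dif_pos hγ]
  exact hf ⟨γ, hγ⟩ ℓ

namespace IsUpperQuantile

variable {x : ℝ → Fin L → ℝ}

lemma lt (hx : IsUpperQuantile μ x) {γ γ' : ℝ} (hγ : γ ∈ Set.Ioo (0 : ℝ) 1)
    (hγ' : γ' ∈ Set.Ioo (0 : ℝ) 1) (h : γ < γ') (ℓ : Fin L) : x γ' ℓ < x γ ℓ := by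
  by_contra! hle
  have := measureReal_mono (μ := μ) (s₁ := {z | x γ' ℓ < z ℓ}) (s₂ := {z | x γ ℓ < z ℓ})
    fun z (hz : x γ' ℓ < z ℓ) => hle.trans_lt hz
  rw [(hx γ hγ ℓ).2, (hx γ' hγ' ℓ).2] at this
  linarith

lemma le (hx : IsUpperQuantile μ x) {γ γ' : ℝ} (hγ : γ ∈ Set.Ioo (0 : ℝ) 1)
    (hγ' : γ' ∈ Set.Ioo (0 : ℝ) 1) (h : γ ≤ γ') (ℓ : Fin L) : x γ' ℓ ≤ x γ ℓ := by
  rcases h.eq_or_lt with rfl | h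
  exacts [le_rfl, (hx.lt hγ hγ' h ℓ).le]

/-- The additional points lie in one of the `L` strips `x γ' ℓ < z ℓ ≤ x γ ℓ`, each of mass `γ' -
γ`. The exceedance probability is thus Lipschitz in `γ` with constant `L`. -/
lemma real_exceedSet_le (hx : IsUpperQuantile μ x) (T : Finset (Fin L)) {γ γ' : ℝ}
    (hγ : γ ∈ Set.Ioo (0 : ℝ) 1) (hγ' : γ' ∈ Set.Ioo (0 : ℝ) 1) (h : γ ≤ γ') :
    μ.real (exceedSet T (x γ')) ≤ μ.real (exceedSet T (x γ)) + L * (γ' - γ) := by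
  have hsub : exceedSet T (x γ') ⊆ exceedSet T (x γ) ∪
      ⋃ ℓ, ({z | x γ' ℓ < z ℓ} \ {z | x γ ℓ < z ℓ}) := by
    rintro z ⟨ℓ, hT, hℓ⟩
    by_cases h : x γ ℓ < z ℓ
    · exact Or.inl ⟨ℓ, hT, h⟩
    · exact Or.inr (Set.mem_iUnion.2 ⟨ℓ, hℓ, h⟩)
  have hone : ∀ ℓ, μ.real ({z : Fin L → ℝ | x γ' ℓ < z ℓ} \ {z | x γ ℓ < z ℓ}) = γ' - γ := by
    intro ℓ
    have hs : {z : Fin L → ℝ | x γ ℓ < z ℓ} ⊆ {z | x γ' ℓ < z ℓ} := fun z hz =>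
      (hx.le hγ hγ' h ℓ).trans_lt hz
    rw [measureReal_sdiff hs
      (measurableSet_lt measurable_const (measurable_pi_apply ℓ)), (hx γ hγ ℓ).2, (hx γ' hγ' ℓ).2]
  calc μ.real (exceedSet T (x γ')) ≤ _ := measureReal_mono hsub
    _ ≤ _ := measureReal_union_le _ _
    _ ≤ μ.real (exceedSet T (x γ)) +
        ∑ ℓ, μ.real ({z : Fin L → ℝ | x γ' ℓ < z ℓ} \ {z | x γ ℓ < z ℓ}) := by
      gcongr
      exact measureReal_iUnion_fintype_le _
    _ = _ := by simp [hone, mul_sub]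

lemma real_exceedSet_mono (hx : IsUpperQuantile μ x) (T : Finset (Fin L)) {γ γ' : ℝ}
    (hγ : γ ∈ Set.Ioo (0 : ℝ) 1) (hγ' : γ' ∈ Set.Ioo (0 : ℝ) 1) (h : γ ≤ γ') :
    μ.real (exceedSet T (x γ)) ≤ μ.real (exceedSet T (x γ')) :=
  measureReal_mono (exceedSet_anti T fun ℓ _ => hx.le hγ hγ' h ℓ)

/-- Strictness comes from the positive mass of the points that leave the smaller box but stay inside
the larger one. -/
lemma real_exceedSet_univ_lt (hμ : RegularLaw μ) (hx : IsUpperQuantile μ x) {γ γ' : ℝ}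
    (hγ : γ ∈ Set.Ioo (0 : ℝ) 1) (hγ' : γ' ∈ Set.Ioo (0 : ℝ) 1) (h : γ < γ') :
    μ.real (exceedSet Finset.univ (x γ)) < μ.real (exceedSet Finset.univ (x γ')) := by
  set D : Set (Fin L → ℝ) := {z | (∃ ℓ, x γ' ℓ < z ℓ) ∧ ∀ ℓ, z ℓ < x γ ℓ}
  have hpos : 0 < μ.real D := ENNReal.toReal_pos
    (hμ.strict (x γ') (x γ) (fun ℓ => (hx γ' hγ' ℓ).1) fun ℓ => hx.lt hγ hγ' h ℓ).ne'
    (measure_ne_top _ _)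
  have hdisj : Disjoint D (exceedSet Finset.univ (x γ)) := by
    rw [Set.disjoint_left]
    rintro z ⟨_, hz⟩ ⟨ℓ, _, hℓ⟩
    exact lt_asymm hℓ (hz ℓ)
  have hsub : D ∪ exceedSet Finset.univ (x γ) ⊆ exceedSet Finset.univ (x γ') := by
    rintro z (⟨⟨ℓ, hℓ⟩, _⟩ | hz)
    · exact ⟨ℓ, Finset.mem_univ _, hℓ⟩
    · exact exceedSet_anti _ (fun ℓ _ => hx.le hγ hγ' h.le ℓ) hz
  have := measureReal_mono (μ := μ) hsub
  rw [measureReal_union hdisj (isOpen_exceedSet _ _).measurableSet] at this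
  linarith

/-- Intermediate value theorem on `[α / (2L), α]`: at the left end the Bonferroni bound gives at
most `α / 2`, at the right end a single coordinate already contributes `α`. -/
lemma exists_level (hx : IsUpperQuantile μ x) (hL : 1 ≤ L) {α : ℝ} (hα : 0 < α ∧ α < 1) :
    ∃ γ ∈ Set.Ioo (0 : ℝ) 1, μ.real (exceedSet Finset.univ (x γ)) = α := by
  have hL' : (1 : ℝ) ≤ L := by exact_mod_cast hL
  have hsub : Set.Icc (α / (2 * L)) α ⊆ Set.Ioo (0 : ℝ) 1 := fun γ hγ =>
    ⟨lt_of_lt_of_le (by have := hα.1; positivity) hγ.1, hγ.2.trans_lt hα.2⟩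
  have hle : α / (2 * L) ≤ α := div_le_self hα.1.le (by linarith)
  have hcont : ContinuousOn (fun γ => μ.real (exceedSet Finset.univ (x γ)))
      (Set.Icc (α / (2 * L)) α) := by
    refine LipschitzOnWith.continuousOn (K := L) (LipschitzOnWith.of_dist_le_mul ?_)
    intro γ hγ γ' hγ'
    wlog h : γ ≤ γ' generalizing γ γ'
    · rw [dist_comm, dist_comm γ]
      exact this γ' hγ' γ hγ (le_of_not_ge h)
    have h1 := hx.real_exceedSet_le Finset.univ (hsub hγ) (hsub hγ') h
    have h2 := hx.real_exceedSet_mono Finset.univ (hsub hγ) (hsub hγ') h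
    rw [dist_comm, dist_comm γ, Real.dist_eq, Real.dist_eq, abs_of_nonneg (sub_nonneg.2 h2),
      abs_of_nonneg (sub_nonneg.2 h)]
    simp only [NNReal.coe_natCast]
    linarith
  have hlow : μ.real (exceedSet Finset.univ (x (α / (2 * L)))) ≤ α := by
    have hγ := hsub (Set.left_mem_Icc.2 hle)
    have : exceedSet Finset.univ (x (α / (2 * L))) = ⋃ ℓ, {z | x (α / (2 * L)) ℓ < z ℓ} := by
      ext z; simp [exceedSet]
    rw [this]
    refine (measureReal_iUnion_fintype_le _).trans ?_
    simp only [(hx _ hγ _).2, Finset.sum_const, Finset.card_univ, Fintype.card_fin, nsmul_eq_mul]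
    have := hα.1
    field_simp
    linarith
  have hhigh : α ≤ μ.real (exceedSet Finset.univ (x α)) := by
    conv_lhs => rw [← (hx α (hsub (Set.right_mem_Icc.2 hle)) ⟨0, hL⟩).2]
    exact measureReal_mono fun z hz => ⟨_, Finset.mem_univ _, hz⟩
  obtain ⟨γ, hγ, h⟩ := intermediate_value_Icc hle hcont ⟨hlow, hhigh⟩
  exact ⟨γ, hsub hγ, h⟩

end IsUpperQuantile

variable {Ω : Type*} [MeasurableSpace Ω] {P : Measure Ω} [IsProbabilityMeasure P]

lemma empFreq_le_eq {B : ℕ} (hB : 0 < B) (z : ℕ → Fin L → ℝ) (x : Fin L → ℝ) (ℓ : Fin L) :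
    (empFreq B fun b => z b ℓ ≤ x ℓ) = 1 - empFreq B fun b => z b ∈ exceedSet {ℓ} x := by
  rw [← empFreq_compl hB]
  simp [exceedSet]

/-- The empirical frequencies of the sets `exceedSet T x` converge to their `μ`-probabilities. -/
def EmpiricallyConsistent (P : Measure Ω) (z : ℕ → ℕ → Ω → Fin L → ℝ) (B : ℕ → ℕ)
    (μ : Measure (Fin L → ℝ)) : Prop :=
  ∀ T x, TendstoInMeasure P (fun m ω => empFreq (B m) fun b => z m b ω ∈ exceedSet T x) atTop
    fun _ => μ.real (exceedSet T x)

variable {z : ℕ → ℕ → Ω → Fin L → ℝ} {B : ℕ → ℕ} {x : ℝ → Fin L → ℝ} {α : ℝ}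

lemma EmpiricallyConsistent.whp_lt (hz : EmpiricallyConsistent P z B μ)
    (hB : Tendsto B atTop atTop) (hx : IsUpperQuantile μ x) {γ γ' : ℝ}
    (hγ : γ ∈ Set.Ioo (0 : ℝ) 1) (h : γ' < γ) :
    Whp P fun m ω => ∀ ℓ, (empFreq (B m) fun b => z m b ω ℓ ≤ x γ ℓ) < 1 - γ' := by
  refine Whp.forall_fintype fun ℓ => ?_
  have h1 : μ.real (exceedSet {ℓ} (x γ)) = γ := by
    rw [← (hx γ hγ ℓ).2]
    congr
    ext; simp [exceedSet, (hx γ hγ ℓ).2]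
  refine (whp_gt (hz {ℓ} (x γ)) (h1.symm ▸ h)).mono ?_
  filter_upwards [hB.eventually_gt_atTop 0] with m hm ω hω
  rw [empFreq_le_eq hm fun b => z m b ω]
  linarith

lemma EmpiricallyConsistent.whp_le (hz : EmpiricallyConsistent P z B μ)
    (hB : Tendsto B atTop atTop) (hx : IsUpperQuantile μ x) {γ γ' : ℝ}
    (hγ : γ ∈ Set.Ioo (0 : ℝ) 1) (h : γ < γ') :
    Whp P fun m ω => ∀ ℓ, 1 - γ' ≤ empFreq (B m) fun b => z m b ω ℓ ≤ x γ ℓ := by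
  refine Whp.forall_fintype fun ℓ => ?_
  have h1 : μ.real (exceedSet {ℓ} (x γ)) = γ := by
    rw [← (hx γ hγ ℓ).2]
    congr
    ext; simp [exceedSet, (hx γ hγ ℓ).2]
  refine (QFMCT.whp_lt (hz {ℓ} (x γ)) (h1.symm ▸ h)).mono ?_
  filter_upwards [hB.eventually_gt_atTop 0] with m hm ω hω
  rw [empFreq_le_eq hm fun b => z m b ω]
  linarith

/-- Once the mesh `1/B` is at most `γ' - γ`, the index `⌈γ B⌉` works. -/
lemma exists_grid_point {B : ℕ → ℕ} (hB : Tendsto B atTop atTop) {γ γ' : ℝ} (h0 : 0 ≤ γ)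
    (h : γ < γ') (h1 : γ' < 1) :
    ∀ᶠ m in atTop, ∃ k < B m, γ ≤ (k : ℝ) / B m ∧ (k : ℝ) / B m ≤ γ' := by
  have hBr : Tendsto (fun m => (B m : ℝ)) atTop atTop := tendsto_natCast_atTop_atTop.comp hB
  filter_upwards [hBr.eventually_ge_atTop (γ' - γ)⁻¹, hB.eventually_gt_atTop 0] with m hm hm0
  have hm0' : (0 : ℝ) < B m := by exact_mod_cast hm0
  have hlt : (⌈γ * B m⌉₊ : ℝ) ≤ γ' * B m := by
    have h2 := (Nat.ceil_lt_add_one (show 0 ≤ γ * B m by positivity)).le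
    have h3 : 1 ≤ (γ' - γ) * B m := by
      rw [inv_eq_one_div, div_le_iff₀ (sub_pos.2 h)] at hm
      linarith
    linarith
  refine ⟨⌈γ * B m⌉₊, ?_, ?_, ?_⟩
  · have : (⌈γ * B m⌉₊ : ℝ) < B m := hlt.trans_lt (by nlinarith)
    exact_mod_cast this
  · rw [le_div_iff₀ hm0']
    exact Nat.le_ceil _
  · rwa [div_le_iff₀ hm0']

/-- Each unit `δ` separates two levels so that a strict limiting inequality survives estimation. For
the upper bound, `critValue_le` is used with `u = x (γ - δ)`, whose limiting error rate is below
`α`, a grid level in `[γ - 3δ, γ - 2δ]`, and `v = x (γ - 4δ)`. For the lower bound, `le_critValue`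
is used with `u = x (γ + δ)`, whose limiting error rate is above `α`, the level `γ + 2δ`, and `v = x
(γ + 4δ)`. -/
lemma EmpiricallyConsistent.whp_critValue (hz : EmpiricallyConsistent P z B μ)
    (hB : Tendsto B atTop atTop) (hμ : RegularLaw μ) (hx : IsUpperQuantile μ x)
    {γ δ : ℝ} (hδ : 0 < δ) (hγ0 : 4 * δ < γ) (hγ1 : γ + 4 * δ < 1)
    (hγ : μ.real (exceedSet Finset.univ (x γ)) = α) :
    Whp P fun m ω => ∀ ℓ, x (γ + 4 * δ) ℓ ≤ critValue α (B m) (fun b => z m b ω) ℓ ∧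
      critValue α (B m) (fun b => z m b ω) ℓ ≤ x (γ - 4 * δ) ℓ := by
  have hmem : ∀ s : ℝ, -4 ≤ s → s ≤ 4 → γ + s * δ ∈ Set.Ioo (0 : ℝ) 1 := fun s h1 h2 =>
    ⟨by nlinarith, by nlinarith⟩
  have hmγ : γ ∈ Set.Ioo (0 : ℝ) 1 := ⟨by linarith, by linarith⟩
  have m1 : γ + 1 * δ ∈ Set.Ioo (0 : ℝ) 1 := hmem 1 (by norm_num) (by norm_num)
  have m4 : γ + 4 * δ ∈ Set.Ioo (0 : ℝ) 1 := hmem 4 (by norm_num) (by norm_num)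
  have n1 : γ + (-1) * δ ∈ Set.Ioo (0 : ℝ) 1 := hmem (-1) (by norm_num) (by norm_num)
  have n4 : γ - 4 * δ ∈ Set.Ioo (0 : ℝ) 1 := ⟨by linarith, by linarith⟩
  have a1 := hz.whp_lt hB hx n1 (show γ - 2 * δ < γ + (-1) * δ by linarith)
  have a2 := QFMCT.whp_lt (hz Finset.univ (x (γ + (-1) * δ))) (c := α) (by
    rw [← hγ]; exact hx.real_exceedSet_univ_lt hμ n1 hmγ (by linarith))
  have a3 := hz.whp_le hB hx n4 (show γ - 4 * δ < γ - 3 * δ by linarith)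
  have b1 := hz.whp_le hB hx m1 (show γ + 1 * δ < γ + 2 * δ by linarith)
  have b2 := whp_gt (hz Finset.univ (x (γ + 1 * δ))) (c := α) (by
    rw [← hγ]; exact hx.real_exceedSet_univ_lt hμ hmγ m1 (by linarith))
  have b3 := hz.whp_lt hB hx m4 (show γ + 2 * δ < γ + 4 * δ by linarith)
  refine (((a1.and a2).and a3).and ((b1.and b2).and b3)).mono ?_
  filter_upwards [hB.eventually_gt_atTop 0, exists_grid_point hB
    (show 0 ≤ γ - 3 * δ by linarith) (show γ - 3 * δ < γ - 2 * δ by linarith) (by linarith)]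
    with m hm ⟨k, hk, hk1, hk2⟩ ω ⟨⟨⟨h1, h2⟩, h3⟩, ⟨⟨g1, g2⟩, g3⟩⟩ ℓ
  have hset : ∀ y : Fin L → ℝ, (fun b => z m b ω ∈ exceedSet Finset.univ y) =
      fun b => ∃ ℓ, y ℓ < z m b ω ℓ := fun y => by simp [exceedSet]
  rw [hset] at h2 g2
  exact ⟨le_critValue hm (by linarith) g1 g2 (g3 ℓ), critValue_le hk hk1 hk2 h1 h2.le (h3 ℓ)⟩

/-- Statistics `Q` whose exceedance probabilities converge exceed the calibrated critical values
with the probability that the limit law gives to exceeding its own quantiles. -/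
lemma EmpiricallyConsistent.tendsto_exceed (hz : EmpiricallyConsistent P z B μ)
    (hB : Tendsto B atTop atTop) (hμ : RegularLaw μ) (hx : IsUpperQuantile μ x)
    {γ : ℝ} (hγ : γ ∈ Set.Ioo (0 : ℝ) 1) (hγα : μ.real (exceedSet Finset.univ (x γ)) = α)
    {Q : ℕ → Ω → Fin L → ℝ} {T : Finset (Fin L)}
    (hQ : ∀ y, Tendsto (fun m => P.real {ω | Q m ω ∈ exceedSet T y}) atTop
      (𝓝 (μ.real (exceedSet T y)))) :
    Tendsto (fun m => P.real {ω | ∃ ℓ ∈ T, critValue α (B m) (fun b => z m b ω) ℓ < Q m ω ℓ})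
      atTop (𝓝 (μ.real (exceedSet T (x γ)))) := by
  rw [Metric.tendsto_nhds]
  intro ε hε
  -- By the Lipschitz bound, replacing `x γ` by `x (γ ± 4δ)` costs less than `ε / 2`. The sandwich
  -- failing and the convergence of `Q` at these thresholds cost `ε / 4` each.
  obtain ⟨δ, hδ, hδ0, hδ1, hδε⟩ : ∃ δ : ℝ, 0 < δ ∧ 4 * δ < γ ∧ γ + 4 * δ < 1 ∧
      L * (4 * δ) < ε / 2 := by
    have e1 : ∀ᶠ δ : ℝ in 𝓝[>] 0, 4 * δ < γ := by
      refine nhdsWithin_le_nhds (ContinuousAt.eventually_lt (by fun_prop) continuousAt_const ?_)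
      simpa using hγ.1
    have e2 : ∀ᶠ δ : ℝ in 𝓝[>] 0, γ + 4 * δ < 1 := by
      refine nhdsWithin_le_nhds (ContinuousAt.eventually_lt (by fun_prop) continuousAt_const ?_)
      simpa using hγ.2
    have e3 : ∀ᶠ δ : ℝ in 𝓝[>] 0, L * (4 * δ) < ε / 2 := by
      refine nhdsWithin_le_nhds (ContinuousAt.eventually_lt (by fun_prop) continuousAt_const ?_)
      simpa using half_pos hε
    obtain ⟨δ, ⟨⟨h1, h2⟩, h3⟩, h0⟩ := ((e1.and e2).and e3).and self_mem_nhdsWithin |>.exists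
    exact ⟨δ, h0, h1, h2, h3⟩
  have hw := hz.whp_critValue hB hμ hx hδ hδ0 hδ1 hγα
  have n4 : γ - 4 * δ ∈ Set.Ioo (0 : ℝ) 1 := ⟨by linarith, by linarith⟩
  have m4 : γ + 4 * δ ∈ Set.Ioo (0 : ℝ) 1 := ⟨by linarith, by linarith⟩
  have hup := hx.real_exceedSet_le T hγ m4 (by linarith)
  have hlo := hx.real_exceedSet_le T n4 hγ (by linarith)
  have hwe := Metric.tendsto_nhds.1 hw (ε / 4) (by positivity)
  have hq1 := Metric.tendsto_nhds.1 (hQ (x (γ + 4 * δ))) (ε / 4) (by positivity)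
  have hq2 := Metric.tendsto_nhds.1 (hQ (x (γ - 4 * δ))) (ε / 4) (by positivity)
  filter_upwards [hwe, hq1, hq2] with m hwm h1 h2
  set bad : Set Ω := {ω | ¬ ∀ ℓ, x (γ + 4 * δ) ℓ ≤ critValue α (B m) (fun b => z m b ω) ℓ ∧
      critValue α (B m) (fun b => z m b ω) ℓ ≤ x (γ - 4 * δ) ℓ}
  rw [Real.dist_eq, abs_lt] at h1 h2
  rw [Real.dist_eq, sub_zero, abs_of_nonneg measureReal_nonneg] at hwm
  have hle : P.real {ω | ∃ ℓ ∈ T, critValue α (B m) (fun b => z m b ω) ℓ < Q m ω ℓ} ≤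
      P.real {ω | Q m ω ∈ exceedSet T (x (γ + 4 * δ))} + P.real bad := by
    refine (measureReal_mono ?_).trans (measureReal_union_le _ _)
    rintro ω ⟨ℓ, hT, hℓ⟩
    by_cases hb : ω ∈ bad
    · exact Or.inr hb
    · exact Or.inl ⟨ℓ, hT, ((not_not.1 hb ℓ).1).trans_lt hℓ⟩
  have hge : P.real {ω | Q m ω ∈ exceedSet T (x (γ - 4 * δ))} ≤
      P.real {ω | ∃ ℓ ∈ T, critValue α (B m) (fun b => z m b ω) ℓ < Q m ω ℓ} + P.real bad := by
    refine (measureReal_mono ?_).trans (measureReal_union_le _ _)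
    rintro ω ⟨ℓ, hT, hℓ⟩
    by_cases hb : ω ∈ bad
    · exact Or.inr hb
    · exact Or.inl ⟨ℓ, hT, ((not_not.1 hb ℓ).2).trans_lt hℓ⟩
  rw [Real.dist_eq, abs_lt]
  constructor <;> linarith

end Calibration

/-! ### Continuous mapping, Lévy's theorem and the portmanteau theorem -/

section ConvergenceTools

variable {Ω : Type*} [MeasurableSpace Ω] {P : Measure Ω} [IsProbabilityMeasure P]

lemma tendstoInMeasure_pi {ι : Type*} [Fintype ι] {E : ι → Type*} [∀ i, PseudoMetricSpace (E i)]
    {X : ℕ → Ω → ∀ i, E i} {c : ∀ i, E i}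
    (h : ∀ i, TendstoInMeasure P (fun m ω => X m ω i) atTop fun _ => c i) :
    TendstoInMeasure P X atTop fun _ => c := by
  rw [tendstoInMeasure_iff_measureReal_dist]
  intro ε hε
  have h' := tendsto_finsetSum Finset.univ
    fun i _ => (tendstoInMeasure_iff_measureReal_dist.1 (h i)) ε hε
  rw [Finset.sum_const_zero] at h'
  refine squeeze_zero (fun m => measureReal_nonneg) (fun m => ?_) h'
  refine (measureReal_mono ?_).trans (measureReal_iUnion_fintype_le _)
  intro ω (hω : ε ≤ dist (X m ω) c)
  by_contra hn
  simp only [Set.mem_iUnion, Set.mem_ofPred_eq, not_exists, not_le] at hn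
  exact absurd ((dist_pi_lt_iff hε).2 hn) (not_lt.2 hω)

/-- Continuity is asked for at the limit point only, since the standardization of the quadratic
forms need not be continuous where the trace vanishes. -/
lemma tendstoInMeasure_comp {E F : Type*} [PseudoMetricSpace E] [PseudoMetricSpace F]
    {X : ℕ → Ω → E} {c : E} (h : TendstoInMeasure P X atTop fun _ => c) {f : E → F}
    (hf : ContinuousAt f c) : TendstoInMeasure P (fun m ω => f (X m ω)) atTop fun _ => f c := by
  rw [tendstoInMeasure_iff_measureReal_dist] at h ⊢
  intro ε hε
  obtain ⟨δ, hδ, hδε⟩ := Metric.continuousAt_iff.1 hf ε hε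
  refine squeeze_zero (fun m => measureReal_nonneg) (fun m => measureReal_mono ?_) (h δ hδ)
  intro ω (hω : ε ≤ dist (f (X m ω)) (f c))
  by_contra! hn
  exact absurd (hδε (not_le.1 hn)) (not_lt.2 hω)

lemma tendstoInMeasure_const_of_tendsto {x : ℕ → ℝ} {c : ℝ} (h : Tendsto x atTop (𝓝 c)) :
    TendstoInMeasure P (fun m _ => x m) atTop fun _ => c := by
  rw [tendstoInMeasure_iff_measureReal_dist]
  intro ε hε
  refine tendsto_const_nhds.congr' ?_
  filter_upwards [Metric.tendsto_nhds.1 h ε hε] with m hm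
  simp [not_le.2 hm]

lemma tendstoInMeasure_comp₂ {X Y : ℕ → Ω → ℝ} {c d : ℝ}
    (hX : TendstoInMeasure P X atTop fun _ => c) (hY : TendstoInMeasure P Y atTop fun _ => d)
    {f : ℝ → ℝ → ℝ} (hf : Continuous fun p : ℝ × ℝ => f p.1 p.2) :
    TendstoInMeasure P (fun m ω => f (X m ω) (Y m ω)) atTop fun _ => f c d := by
  have h : TendstoInMeasure P (fun m ω => ![X m ω, Y m ω]) atTop fun _ => ![c, d] :=
    tendstoInMeasure_pi fun i => by fin_cases i <;> simpa
  have hf' : Continuous fun v : Fin 2 → ℝ => f (v 0) (v 1) :=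
    hf.comp (g := fun p : ℝ × ℝ => f p.1 p.2) (f := fun v : Fin 2 → ℝ => (v 0, v 1)) (by fun_prop)
  simpa using tendstoInMeasure_comp h hf'.continuousAt

variable {Ω' : Type*} [MeasurableSpace Ω'] {P' : Measure Ω'} [IsProbabilityMeasure P']

lemma charFun_map_toLp {K : Type*} [Fintype K] {X : Ω → K → ℝ} (hX : Measurable X)
    (t : EuclideanSpace ℝ K) :
    charFun (P.map fun ω => WithLp.toLp 2 (X ω)) t =
      charFun (P.map fun ω => t.ofLp ⬝ᵥ X ω) 1 := by
  have hm : Measurable fun ω => t.ofLp ⬝ᵥ X ω := by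
    simp only [dotProduct]
    exact Finset.measurable_sum _ fun i _ => ((measurable_pi_apply i).comp hX).const_mul _
  rw [charFun_apply, charFun_apply_real, integral_map (by fun_prop) (by fun_prop),
    integral_map hm.aemeasurable (by fun_prop)]
  congr with ω
  simp [PiLp.inner_apply, dotProduct]

/-- Lévy's continuity theorem in Cramér–Wold form. It is applied in `EuclideanSpace`, where linear
functionals are inner products, and carried back along the continuous identification. -/
lemma tendstoInDistribution_of_charFun {K : Type*} [Fintype K] {X : ℕ → Ω → K → ℝ}
    (hX : ∀ m, Measurable (X m)) {Z : Ω' → K → ℝ} (hZ : Measurable Z)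
    (h : ∀ t : K → ℝ, Tendsto (fun m => charFun (P.map fun ω => t ⬝ᵥ X m ω) 1) atTop
      (𝓝 (charFun (P'.map fun ω => t ⬝ᵥ Z ω) 1))) :
    TendstoInDistribution X atTop Z (fun _ => P) P' := by
  have h' : TendstoInDistribution (fun m ω => WithLp.toLp 2 (X m ω)) atTop
      (fun ω => WithLp.toLp 2 (Z ω)) (fun _ => P) P' :=
    { forall_aemeasurable := fun m => by have := hX m; fun_prop
      aemeasurable_limit := by fun_prop
      tendsto := by
        refine ProbabilityMeasure.tendsto_iff_tendsto_charFun.2 fun t => ?_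
        have := h t.ofLp
        simp_rw [← charFun_map_toLp (hX _), ← charFun_map_toLp hZ] at this
        exact this }
  exact h'.continuous_comp (g := WithLp.ofLp) (PiLp.continuous_ofLp 2 _)

lemma tendsto_real_of_null_frontier {E : Type*} [MeasurableSpace E] [PseudoMetricSpace E]
    [BorelSpace E] {X : ℕ → Ω → E} {Z : Ω' → E}
    (h : TendstoInDistribution X atTop Z (fun _ => P) P') {s : Set E} (hs : MeasurableSet s)
    (h0 : P'.map Z (frontier s) = 0) :
    Tendsto (fun m => P.real {ω | X m ω ∈ s}) atTop (𝓝 ((P'.map Z).real s)) := by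
  have hlim := ProbabilityMeasure.tendsto_measure_of_null_frontier_of_tendsto' h.tendsto
    (E := s) h0
  have : IsProbabilityMeasure (P'.map Z) :=
    Measure.isProbabilityMeasure_map h.aemeasurable_limit
  have h2 := (ENNReal.tendsto_toReal (measure_ne_top (P'.map Z) s)).comp hlim
  refine h2.congr fun m => ?_
  simp only [Function.comp_apply, ProbabilityMeasure.coe_mk, measureReal_def]
  rw [Measure.map_apply_of_aemeasurable (h.forall_aemeasurable m) hs]
  rfl

/-- The frontier lies in the finitely many hyperplanes `z ℓ = x ℓ`, which are null because the
coordinates have no atoms. -/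
lemma RegularLaw.frontier_exceedSet {L : ℕ} {μ : Measure (Fin L → ℝ)} (hμ : RegularLaw μ)
    (T : Finset (Fin L)) (x : Fin L → ℝ) : μ (frontier (exceedSet T x)) = 0 := by
  refine measure_mono_null (t := ⋃ ℓ, {z | z ℓ = x ℓ}) ?_
    (measure_iUnion_null fun ℓ => hμ.atomless ℓ _)
  rw [(isOpen_exceedSet T x).frontier_eq]
  rintro z ⟨hcl, hn⟩
  have hcl' : z ∈ ⋃ ℓ ∈ T, {z : Fin L → ℝ | x ℓ ≤ z ℓ} := by
    refine closure_minimal ?_ (T.finite_toSet.isClosed_biUnion fun ℓ _ =>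
      isClosed_le continuous_const (continuous_apply ℓ)) hcl
    rintro y ⟨ℓ, hT, hℓ⟩
    exact Set.mem_biUnion (Finset.mem_coe.2 hT) hℓ.le
  simp only [Set.mem_iUnion, Set.mem_ofPred_eq, exists_prop] at hcl'
  obtain ⟨ℓ, hT, hℓ⟩ := hcl'
  refine Set.mem_iUnion.2 ⟨ℓ, le_antisymm ?_ hℓ⟩
  by_contra! hlt
  exact hn ⟨ℓ, hT, hlt⟩

end ConvergenceTools

/-! ### Uniform square integrability -/

section UniformIntegrability

variable {Ω : Type*} [MeasurableSpace Ω] {P : Measure Ω} [IsProbabilityMeasure P]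

lemma UniformIntegrable.add_two {ι : Type*} {f g : ι → Ω → ℝ} (hf : UniformIntegrable f 2 P)
    (hg : UniformIntegrable g 2 P) : UniformIntegrable (f + g) 2 P := by
  obtain ⟨C, hC⟩ := hf.2.2
  obtain ⟨D, hD⟩ := hg.2.2
  refine ⟨fun i => (hf.1 i).add (hg.1 i), hf.2.1.add hg.2.1 (by norm_num) hf.1 hg.1, C + D,
    fun i => ?_⟩
  refine (eLpNorm_add_le (hf.1 i) (hg.1 i) (by norm_num)).trans ?_
  push_cast
  exact add_le_add (hC i) (hD i)

lemma uniformIntegrable_of_ident {f : ℕ → Ω → ℝ} (h0 : MemLp (f 0) 2 P)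
    (hf : ∀ k, IdentDistrib (f k) (f 0) P P) : UniformIntegrable f 2 P :=
  MemLp.uniformIntegrable_of_identDistrib (by norm_num) (by norm_num) h0 hf

/-- Identical marginals do not make the linear combinations identically distributed in `k`, since
the joint law of the components may vary. Each summand is uniformly integrable on its own, and this
property is preserved by sums. -/
lemma uniformIntegrable_lincomb {K : Type*} {f : K → ℕ → Ω → ℝ} (s : Finset K)
    (h0 : ∀ κ, MemLp (f κ 0) 2 P) (hf : ∀ κ k, IdentDistrib (f κ k) (f κ 0) P P) (t : K → ℝ) :
    UniformIntegrable (fun k ω => ∑ κ ∈ s, t κ * f κ k ω) 2 P := by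
  classical
  induction s using Finset.induction_on with
  | empty =>
    simpa using uniformIntegrable_const (ι := ℕ) (p := 2) (g := fun _ : Ω => (0 : ℝ))
      (by norm_num) (by norm_num) (memLp_const 0)
  | insert κ s hκ ih =>
    have h1 : UniformIntegrable (fun k ω => t κ * f κ k ω) 2 P :=
      uniformIntegrable_of_ident ((h0 κ).const_mul _) fun k => (hf κ k).const_mul _
    simp_rw [Finset.sum_insert hκ]
    exact UniformIntegrable.add_two h1 ih

lemma UniformIntegrable.exists_tail {f : ℕ → Ω → ℝ} (hf : UniformIntegrable f 2 P) {ε : ℝ}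
    (hε : 0 < ε) : ∃ C : ℝ, 0 ≤ C ∧
      ∀ k, ∫ ω, {ω | C ≤ |f k ω|}.indicator (fun ω => f k ω ^ 2) ω ∂P ≤ ε := by
  obtain ⟨C, hC⟩ := hf.spec (by norm_num) (by norm_num) (Real.sqrt_pos.2 hε)
  refine ⟨C, C.2, fun k => ?_⟩
  have hset : {ω | C ≤ ‖f k ω‖₊} = {ω | (C : ℝ) ≤ |f k ω|} := by
    ext ω
    simp [← NNReal.coe_le_coe]
  have hm : MemLp ({ω | (C : ℝ) ≤ |f k ω|}.indicator (f k)) 2 P := by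
    rw [← hset]
    refine ⟨?_, (hC k).trans_lt ENNReal.ofReal_lt_top⟩
    exact (hf.1 k).indicator₀ (nullMeasurableSet_le aemeasurable_const (hf.1 k).nnnorm.aemeasurable)
  have h2 := hC k
  rw [hset, hm.eLpNorm_eq_integral_rpow_norm (by norm_num) (by norm_num),
    ENNReal.ofReal_le_ofReal_iff (Real.sqrt_nonneg _)] at h2
  simp only [ENNReal.toReal_ofNat, Real.rpow_two, Real.norm_eq_abs, sq_abs] at h2
  rw [show (2 : ℝ)⁻¹ = 1 / 2 by norm_num, ← Real.sqrt_eq_rpow] at h2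
  have h3 := (Real.sqrt_le_sqrt_iff hε.le).1 h2
  refine le_trans (le_of_eq ?_) h3
  congr with ω
  by_cases hω : (C : ℝ) ≤ |f k ω| <;> simp [hω]

end UniformIntegrability

/-! ### Estimates for characteristic functions -/

section TaylorBounds

/-- For `|x| ≤ 1` this is the Taylor remainder. For `|x| ≥ 1` the triangle inequality gives `2 + |x|
+ x²/2 ≤ 4x²`. -/
lemma norm_exp_mul_I_sub_le (x : ℝ) :
    ‖Complex.exp (x * Complex.I) - (1 + x * Complex.I - x ^ 2 / 2)‖ ≤ 4 * min (x ^ 2) (|x| ^ 3) := by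
  have hn : ‖(x * Complex.I : ℂ)‖ = |x| := by simp
  rcases le_total |x| 1 with h | h
  · have hb := Complex.exp_bound (x := x * Complex.I) (by rwa [hn]) (n := 3) (by norm_num)
    rw [hn] at hb
    have hs : ∑ m ∈ Finset.range 3, (x * Complex.I : ℂ) ^ m / m.factorial =
        1 + x * Complex.I - x ^ 2 / 2 := by
      simp [Finset.sum_range_succ, mul_pow]
      ring
    rw [hs] at hb
    have h3 : |x| ^ 3 ≤ x ^ 2 := by
      rw [← sq_abs x]
      exact pow_le_pow_of_le_one (abs_nonneg x) h (by norm_num)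
    rw [min_eq_right h3]
    refine hb.trans ?_
    have : 0 ≤ |x| ^ 3 := by positivity
    norm_num [Nat.factorial]
    linarith
  · have h3 : x ^ 2 ≤ |x| ^ 3 := by
      rw [← sq_abs x]
      exact pow_le_pow_right₀ h (by norm_num)
    rw [min_eq_left h3]
    have h1 : ‖Complex.exp (x * Complex.I)‖ = 1 := Complex.norm_exp_ofReal_mul_I x
    have h2 : ‖(x ^ 2 / 2 : ℂ)‖ = x ^ 2 / 2 := by
      rw [norm_div, norm_pow, Complex.norm_real, Real.norm_eq_abs, sq_abs]
      simp
    have hx2 : |x| ≤ x ^ 2 := by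
      rw [← sq_abs x]
      nlinarith
    have hx1 : 1 ≤ x ^ 2 := h.trans hx2
    calc _ ≤ ‖Complex.exp (x * Complex.I)‖ + (‖(1 : ℂ)‖ + ‖(x * Complex.I : ℂ)‖ +
          ‖(x ^ 2 / 2 : ℂ)‖) := by
          refine (norm_sub_le _ _).trans ?_
          gcongr
          refine (norm_sub_le _ _).trans ?_
          gcongr
          exact norm_add_le _ _
      _ ≤ 4 * x ^ 2 := by
          rw [h1, h2, hn, norm_one]
          linarith

/-- Use the quadratic bound on the tail `|y| ≥ C` and the cubic one, with a factor `|y|` replaced by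
`C`, elsewhere. This is Lindeberg's splitting. -/
lemma four_mul_min_le {c y C : ℝ} (hC : 0 ≤ C) :
    4 * min ((c * y) ^ 2) (|c * y| ^ 3) ≤
      4 * c ^ 2 * ({y : ℝ | C ≤ |y|}.indicator (fun y => y ^ 2) y + |c| * C * y ^ 2) := by
  by_cases h : C ≤ |y|
  · rw [Set.indicator_of_mem (show y ∈ {y : ℝ | C ≤ |y|} from h)]
    have h1 := min_le_left ((c * y) ^ 2) (|c * y| ^ 3)
    have h2 : 0 ≤ |c| * C * y ^ 2 := by positivity
    nlinarith [mul_nonneg (sq_nonneg c) h2]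
  · rw [Set.indicator_of_notMem (show y ∉ {y : ℝ | C ≤ |y|} from h), zero_add]
    have h1 := min_le_right ((c * y) ^ 2) (|c * y| ^ 3)
    have h2 : |c * y| ^ 3 = c ^ 2 * (|c| * |y| * y ^ 2) := by
      rw [abs_mul, mul_pow, ← sq_abs c, ← sq_abs y]
      ring
    have h3 : |c| * |y| * y ^ 2 ≤ |c| * C * y ^ 2 := by
      gcongr
      exact (not_le.1 h).le
    nlinarith [mul_le_mul_of_nonneg_left h3 (sq_nonneg c)]

/-- Exchange the factors one at a time; those not being exchanged have norm at most one. -/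
lemma norm_prod_sub_prod_le {ι : Type*} (s : Finset ι) (f g : ι → ℂ)
    (hf : ∀ i ∈ s, ‖f i‖ ≤ 1) (hg : ∀ i ∈ s, ‖g i‖ ≤ 1) :
    ‖∏ i ∈ s, f i - ∏ i ∈ s, g i‖ ≤ ∑ i ∈ s, ‖f i - g i‖ := by
  classical
  induction s using Finset.induction_on with
  | empty => simp
  | insert a s ha ih =>
    have ih' := ih (fun i hi => hf i (Finset.mem_insert_of_mem hi))
      fun i hi => hg i (Finset.mem_insert_of_mem hi)
    rw [Finset.prod_insert ha, Finset.prod_insert ha, Finset.sum_insert ha,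
      show f a * ∏ i ∈ s, f i - g a * ∏ i ∈ s, g i =
        (f a - g a) * ∏ i ∈ s, f i + g a * (∏ i ∈ s, f i - ∏ i ∈ s, g i) by ring]
    refine (norm_add_le _ _).trans (add_le_add ?_ ?_)
    · rw [norm_mul]
      refine mul_le_of_le_one_right (norm_nonneg _) ?_
      rw [norm_prod]
      exact Finset.prod_le_one (fun _ _ => norm_nonneg _)
        fun i hi => hf i (Finset.mem_insert_of_mem hi)
    · rw [norm_mul]
      exact (mul_le_of_le_one_left (norm_nonneg _) (hg a (Finset.mem_insert_self a s))).trans ih'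

end TaylorBounds

/-! ### Lindeberg's theorem and the weak law for squares -/

variable {Ω : Type*} [MeasurableSpace Ω] {P : Measure Ω} [IsProbabilityMeasure P]

lemma norm_charFun_sub_le {η : Ω → ℝ} (hm : Measurable η) (hsq : MemLp η 2 P)
    (hmean : ∫ ω, η ω ∂P = 0) {v : ℝ} (hv : ∫ ω, η ω ^ 2 ∂P = v) {C ε : ℝ} (hC : 0 ≤ C)
    (htail : ∫ ω, {ω | C ≤ |η ω|}.indicator (fun ω => η ω ^ 2) ω ∂P ≤ ε) (c : ℝ) :
    ‖charFun (P.map η) c - (1 - c ^ 2 * v / 2 : ℝ)‖ ≤ 4 * c ^ 2 * (ε + |c| * C * v) := by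
  have i1 : Integrable η P := hsq.integrable (by norm_num)
  have i2 : Integrable (fun ω => η ω ^ 2) P := hsq.integrable_sq
  have i3 : Integrable ({ω | C ≤ |η ω|}.indicator fun ω => η ω ^ 2) P :=
    i2.indicator (measurableSet_le measurable_const hm.abs)
  have ie : Integrable (fun ω => Complex.exp ((c * η ω : ℝ) * Complex.I)) P :=
    Integrable.of_bound (by fun_prop) 1 (Eventually.of_forall fun ω =>
      (Complex.norm_exp_ofReal_mul_I _).le)
  have ip : Integrable (fun ω => (1 + (c * η ω : ℝ) * Complex.I -
      ((c * η ω : ℝ) : ℂ) ^ 2 / 2 : ℂ)) P := by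
    have a1 : Integrable (fun ω => ((c * η ω : ℝ) : ℂ)) P := (i1.const_mul c).ofReal
    have a2 : Integrable (fun ω => (((c * η ω) ^ 2 : ℝ) : ℂ)) P := by
      simp_rw [mul_pow]
      exact (i2.const_mul (c ^ 2)).ofReal
    simp only [Complex.ofReal_pow] at a2
    exact ((integrable_const _).add (a1.mul_const _)).sub (a2.div_const _)
  have hpoly : ∫ ω, (1 + (c * η ω : ℝ) * Complex.I -
      ((c * η ω : ℝ) : ℂ) ^ 2 / 2 : ℂ) ∂P = ((1 - c ^ 2 * v / 2 : ℝ) : ℂ) := by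
    have a1 : Integrable (fun ω => ((c * η ω : ℝ) : ℂ) * Complex.I) P :=
      (i1.const_mul c).ofReal.mul_const _
    have a2 : Integrable (fun ω => (((c * η ω) ^ 2 / 2 : ℝ) : ℂ)) P := by
      simp_rw [mul_pow]
      exact ((i2.const_mul (c ^ 2)).div_const 2).ofReal
    have hrw : ∀ ω, (1 + (c * η ω : ℝ) * Complex.I - ((c * η ω : ℝ) : ℂ) ^ 2 / 2 : ℂ) =
        1 + ((c * η ω : ℝ) : ℂ) * Complex.I - (((c * η ω) ^ 2 / 2 : ℝ) : ℂ) := fun ω => by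
      push_cast; ring
    simp_rw [hrw]
    rw [integral_sub (by exact (integrable_const _).add a1) a2, integral_add (integrable_const _) a1,
      integral_mul_const, integral_complex_ofReal, integral_complex_ofReal, integral_const_mul,
      hmean, integral_div]
    simp_rw [mul_pow]
    rw [integral_const_mul, hv]
    simp
  have hcf : charFun (P.map η) c = ∫ ω, Complex.exp ((c * η ω : ℝ) * Complex.I) ∂P := by
    rw [charFun_apply_real, integral_map hm.aemeasurable (by fun_prop)]
    push_cast
    rfl
  rw [hcf, ← hpoly, ← integral_sub ie ip]
  have hbound : ∀ ω, ‖Complex.exp ((c * η ω : ℝ) * Complex.I) - (1 + (c * η ω : ℝ) * Complex.I -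
      ((c * η ω : ℝ) : ℂ) ^ 2 / 2)‖ ≤ 4 * c ^ 2 * ({ω | C ≤ |η ω|}.indicator (fun ω => η ω ^ 2) ω +
        |c| * C * η ω ^ 2) := by
    intro ω
    refine (norm_exp_mul_I_sub_le _).trans ((four_mul_min_le hC).trans_eq ?_)
    by_cases h : C ≤ |η ω| <;> simp [h]
  refine (norm_integral_le_of_norm_le ((i3.add (i2.const_mul (|c| * C))).const_mul (4 * c ^ 2))
    (Eventually.of_forall hbound)).trans ?_
  rw [integral_const_mul]
  refine mul_le_mul_of_nonneg_left ?_ (by positivity)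
  simp only [Pi.add_apply]
  rw [integral_add i3 (i2.const_mul _), integral_const_mul, hv]
  linarith

lemma norm_exp_neg_sub_le {y : ℝ} (h0 : 0 ≤ y) (h1 : y ≤ 1) :
    |Real.exp (-y) - (1 - y)| ≤ y ^ 2 := by
  have := Real.abs_exp_sub_one_sub_id_le (x := -y) (by rwa [abs_neg, abs_of_nonneg h0])
  rw [neg_sq] at this
  convert this using 2
  ring

/-- The Lindeberg central limit theorem for normalized partial sums of a uniformly square
integrable independent sequence, in terms of characteristic functions. -/
lemma tendsto_prod_charFun {η : ℕ → Ω → ℝ} (hm : ∀ k, Measurable (η k))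
    (hui : UniformIntegrable η 2 P) (hmean : ∀ k, ∫ ω, η k ω ∂P = 0) {v : ℝ}
    (hv : ∀ k, ∫ ω, η k ω ^ 2 ∂P = v) {n : ℕ → ℕ} {c : ℕ → ℝ} {s : ℝ}
    (hc : Tendsto c atTop (𝓝 0)) (hcs : Tendsto (fun m => c m ^ 2 * n m) atTop (𝓝 s)) :
    Tendsto (fun m => ∏ k ∈ Finset.range (n m), charFun (P.map (η k)) (c m)) atTop
      (𝓝 (Real.exp (-(s * v / 2)) : ℝ)) := by
  have hv0 : 0 ≤ v := by rw [← hv 0]; exact integral_nonneg fun ω => sq_nonneg _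
  have hlim : Tendsto (fun m => ((Real.exp (-(c m ^ 2 * n m * v / 2)) : ℝ) : ℂ)) atTop
      (𝓝 (Real.exp (-(s * v / 2)) : ℝ)) :=
    (Complex.continuous_ofReal.tendsto _).comp ((Real.continuous_exp.tendsto _).comp
      ((hcs.mul_const v).div_const 2).neg)
  refine (tendsto_iff_of_dist ?_).2 hlim
  rw [Metric.tendsto_nhds]
  intro ε hε
  have hs0 : 0 ≤ s := ge_of_tendsto hcs (Eventually.of_forall fun m => by positivity)
  -- Eventually `c² n < s + 1`, so the `n` tail terms `4 c² · ε / (16 (s + 1))` add up to less than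
  -- `ε / 2`.
  obtain ⟨C, hC, htail⟩ := UniformIntegrable.exists_tail hui
    (show 0 < ε / (16 * (s + 1)) by positivity)
  -- The total of the cubic errors and of the errors `(c² v / 2)²` made in replacing `1 - c² v / 2`
  -- by an exponential.
  have hsmall : Tendsto (fun m => 4 * (c m ^ 2 * n m) * (|c m| * C * v) +
      (c m ^ 2 * n m) * (c m ^ 2 * v ^ 2 / 4)) atTop (𝓝 0) := by
    have h1 := (hcs.const_mul 4).mul ((hc.abs.mul_const C).mul_const v)
    have h2 := hcs.mul (((hc.pow 2).mul_const (v ^ 2)).div_const 4)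
    simpa using h1.add h2
  have hy : Tendsto (fun m => c m ^ 2 * v / 2) atTop (𝓝 0) := by
    simpa using ((hc.pow 2).mul_const v).div_const 2
  filter_upwards [Metric.tendsto_nhds.1 hsmall (ε / 2) (by positivity),
    hcs.eventually_lt_const (lt_add_one s), hy.eventually_le_const one_pos] with m h1 h2 h3
  rw [Real.dist_eq, sub_zero, abs_of_nonneg dist_nonneg, dist_eq_norm]
  rw [Real.dist_eq, sub_zero] at h1
  have hprod : ((Real.exp (-(c m ^ 2 * n m * v / 2)) : ℝ) : ℂ) =
      ∏ _k ∈ Finset.range (n m), ((Real.exp (-(c m ^ 2 * v / 2)) : ℝ) : ℂ) := by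
    rw [Finset.prod_const, Finset.card_range, ← Complex.ofReal_pow, ← Real.exp_nat_mul]
    congr 2
    ring
  have hy0 : 0 ≤ c m ^ 2 * v / 2 := by positivity
  have hterm : ∀ k, ‖charFun (P.map (η k)) (c m) -
      ((Real.exp (-(c m ^ 2 * v / 2)) : ℝ) : ℂ)‖ ≤
      4 * c m ^ 2 * (ε / (16 * (s + 1)) + |c m| * C * v) + (c m ^ 2 * v / 2) ^ 2 := by
    intro k
    have e1 := norm_charFun_sub_le (hm k) (hui.memLp k) (hmean k) (hv k) hC (htail k) (c m)
    have e2 := norm_exp_neg_sub_le hy0 h3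
    rw [show charFun (P.map (η k)) (c m) - ((Real.exp (-(c m ^ 2 * v / 2)) : ℝ) : ℂ) =
      (charFun (P.map (η k)) (c m) - (1 - c m ^ 2 * v / 2 : ℝ)) -
      ((Real.exp (-(c m ^ 2 * v / 2)) - (1 - c m ^ 2 * v / 2) : ℝ) : ℂ) by push_cast; ring]
    refine (norm_sub_le _ _).trans (add_le_add e1 ?_)
    rwa [Complex.norm_real, Real.norm_eq_abs]
  rw [hprod]
  refine (norm_prod_sub_prod_le _ _ _ (fun k _ => ?_) (fun k _ => ?_)).trans_lt ?_
  · have : IsProbabilityMeasure (P.map (η k)) :=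
      Measure.isProbabilityMeasure_map (hm k).aemeasurable
    exact norm_charFun_le_one _
  · rw [Complex.norm_real, Real.norm_eq_abs, abs_of_pos (Real.exp_pos _), Real.exp_le_one_iff]
    linarith
  · refine (Finset.sum_le_sum fun k _ => hterm k).trans_lt ?_
    rw [Finset.sum_const, Finset.card_range, nsmul_eq_mul]
    have e3 : 4 * (c m ^ 2 * n m) * (ε / (16 * (s + 1))) < ε / 2 := by
      rw [show 4 * (c m ^ 2 * n m) * (ε / (16 * (s + 1))) =
        (c m ^ 2 * n m) * ε / (4 * (s + 1)) by field_simp; ring, div_lt_iff₀ (by positivity)]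
      nlinarith
    have e4 := (abs_lt.1 h1).2
    nlinarith

/-- The weak law of large numbers for the squares of a uniformly square integrable independent
sequence. -/
lemma tendstoInMeasure_mean_sq {η : ℕ → Ω → ℝ} (hm : ∀ k, Measurable (η k))
    (hindep : iIndepFun η P) (hui : UniformIntegrable η 2 P) {v : ℝ}
    (hv : ∀ k, ∫ ω, η k ω ^ 2 ∂P = v) :
    TendstoInMeasure P (fun (n : ℕ) ω => (n : ℝ)⁻¹ * ∑ k ∈ Finset.range n, η k ω ^ 2) atTop
      fun _ => v := by
  have hi : ∀ k, Integrable (fun ω => η k ω ^ 2) P := fun k => (hui.memLp k).integrable_sq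
  have hint : ∀ n : ℕ, Integrable
      (fun ω => (n : ℝ)⁻¹ * ∑ k ∈ Finset.range n, η k ω ^ 2) P := fun n =>
    (integrable_finsetSum _ fun k _ => hi k).const_mul _
  refine tendstoInMeasure_of_integral_pow 1 one_ne_zero (fun n => by
    simpa using ((hint n).sub (integrable_const v)).abs) ?_
  simp only [pow_one]
  rw [Metric.tendsto_nhds]
  intro δ hδ
  obtain ⟨C, hC, htail⟩ := UniformIntegrable.exists_tail hui (show 0 < δ / 8 by positivity)
  -- Truncation: the tail part `g` has mean at most `δ / 8`, and the remaining part `f` is bounded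
  -- by `C²`, so its averages have variance of order `1 / n`.
  set g : ℝ → ℝ := fun y => {y : ℝ | C ≤ |y|}.indicator (fun y => y ^ 2) y
  have hg : Measurable g := (measurable_id.pow_const 2).indicator
    (measurableSet_le measurable_const measurable_id.abs)
  set f : ℝ → ℝ := fun y => y ^ 2 - g y
  have hf : Measurable f := (measurable_id.pow_const 2).sub hg
  have hfb : ∀ y, |f y| ≤ C ^ 2 := by
    intro y
    by_cases h : C ≤ |y|
    · simp [f, g, h]; positivity
    · simp only [f, g, Set.mem_ofPred_eq, h, not_false_eq_true, Set.indicator_of_notMem, sub_zero]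
      rw [abs_of_nonneg (sq_nonneg y), ← sq_abs y]
      exact pow_le_pow_left₀ (abs_nonneg y) (not_le.1 h).le 2
  have hg0 : ∀ y, 0 ≤ g y := fun y => Set.indicator_nonneg (fun _ _ => sq_nonneg _) _
  have hgi : ∀ k, Integrable (fun ω => g (η k ω)) P := fun k =>
    ((hi k).indicator (s := {ω | C ≤ |η k ω|}) (measurableSet_le measurable_const (hm k).abs)).congr
      (Eventually.of_forall fun ω => by by_cases h : C ≤ |η k ω| <;> simp [g, h])
  have hgt : ∀ k, ∫ ω, g (η k ω) ∂P ≤ δ / 8 := fun k => by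
    refine le_trans (le_of_eq ?_) (htail k)
    rfl
  have hfL : ∀ k, MemLp (fun ω => f (η k ω)) 2 P := fun k =>
    MemLp.of_bound (hf.comp (hm k)).aestronglyMeasurable (C ^ 2)
      (Eventually.of_forall fun ω => hfb _)
  have hvar : ∀ n : ℕ, ∫ ω, (∑ k ∈ Finset.range n, (f (η k ω) - ∫ ω, f (η k ω) ∂P)) ^ 2 ∂P ≤
      n * C ^ 4 := by
    intro n
    have h1 := IndepFun.variance_sum (s := Finset.range n) (X := fun k ω => f (η k ω))
      (fun k _ => hfL k) fun i _ j _ hij => (hindep.indepFun hij).comp hf hf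
    have h2 : ∀ k, variance (fun ω => f (η k ω)) P ≤ C ^ 4 := fun k => by
      have h3 := variance_le_expectation_sq (hfL k).aestronglyMeasurable
      refine h3.trans ?_
      have h4 := integral_mono (hfL k).integrable_sq (integrable_const (C ^ 4)) fun ω => by
        have := hfb (η k ω)
        rw [← sq_abs]
        calc |f (η k ω)| ^ 2 ≤ (C ^ 2) ^ 2 := pow_le_pow_left₀ (abs_nonneg _) this 2
          _ = C ^ 4 := by ring
      simpa using h4
    have h5 : variance (∑ k ∈ Finset.range n, fun ω => f (η k ω)) P =
        ∫ ω, (∑ k ∈ Finset.range n, (f (η k ω) - ∫ ω, f (η k ω) ∂P)) ^ 2 ∂P := by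
      rw [variance_eq_integral (memLp_finsetSum' _ fun k _ => hfL k).aemeasurable]
      congr with ω
      simp only [Finset.sum_apply]
      rw [integral_finsetSum _ fun k _ => (hfL k).integrable (by norm_num),
        ← Finset.sum_sub_distrib]
    rw [← h5, h1]
    refine (Finset.sum_le_sum fun k _ => h2 k).trans ?_
    simp
  have hdecay : Tendsto (fun n : ℕ => (n : ℝ)⁻¹ * (C ^ 4 / δ)) atTop (𝓝 0) := by
    simpa using tendsto_inv_atTop_nhds_zero_nat.mul_const (C ^ 4 / δ)
  filter_upwards [hdecay.eventually_lt_const (show 0 < δ / 4 by positivity),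
    eventually_gt_atTop 0] with n hn hn0
  have hn0' : (0 : ℝ) < n := by exact_mod_cast hn0
  have hEf : ∀ k, ∫ ω, f (η k ω) ∂P = v - ∫ ω, g (η k ω) ∂P := fun k => by
    rw [← hv k, ← integral_sub (hi k) (hgi k)]
  rw [Real.dist_eq, sub_zero, abs_of_nonneg (integral_nonneg fun ω => abs_nonneg _)]
  -- The inequality `|u| ≤ δ / 4 + u² / δ` brings in the variance of the bounded part. After
  -- integration the four terms are at most `δ/4`, less than `δ/4`, at most `δ/8` and `δ/8`.
  have hpt : ∀ ω, |(n : ℝ)⁻¹ * ∑ k ∈ Finset.range n, η k ω ^ 2 - v| ≤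
      (δ / 4 + (n : ℝ)⁻¹ ^ 2 * δ⁻¹ * (∑ k ∈ Finset.range n, (f (η k ω) - ∫ ω, f (η k ω) ∂P)) ^ 2) +
      ((n : ℝ)⁻¹ * ∑ k ∈ Finset.range n, g (η k ω) + δ / 8) := by
    intro ω
    set A := ∑ k ∈ Finset.range n, (f (η k ω) - ∫ ω, f (η k ω) ∂P)
    have hA : (n : ℝ)⁻¹ * ∑ k ∈ Finset.range n, η k ω ^ 2 - v = (n : ℝ)⁻¹ * A +
        ((n : ℝ)⁻¹ * ∑ k ∈ Finset.range n, g (η k ω) -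
          (n : ℝ)⁻¹ * ∑ k ∈ Finset.range n, ∫ ω, g (η k ω) ∂P) := by
      simp only [A, hEf, f, Finset.sum_sub_distrib, Finset.sum_const, Finset.card_range,
        nsmul_eq_mul]
      field_simp
      ring
    have hE : (n : ℝ)⁻¹ * ∑ k ∈ Finset.range n, ∫ ω, g (η k ω) ∂P ≤ δ / 8 := by
      rw [inv_mul_le_iff₀ hn0']
      refine (Finset.sum_le_sum fun k _ => hgt k).trans ?_
      simp
    have hE0 : 0 ≤ (n : ℝ)⁻¹ * ∑ k ∈ Finset.range n, ∫ ω, g (η k ω) ∂P :=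
      mul_nonneg (by positivity) (Finset.sum_nonneg fun k _ => integral_nonneg fun ω => hg0 _)
    have hG0 : 0 ≤ (n : ℝ)⁻¹ * ∑ k ∈ Finset.range n, g (η k ω) :=
      mul_nonneg (by positivity) (Finset.sum_nonneg fun k _ => hg0 _)
    have hy : |(n : ℝ)⁻¹ * A| ≤ δ / 4 + (n : ℝ)⁻¹ ^ 2 * δ⁻¹ * A ^ 2 := by
      have h2 : (n : ℝ)⁻¹ ^ 2 * δ⁻¹ * A ^ 2 = |(n : ℝ)⁻¹ * A| ^ 2 / δ := by
        rw [sq_abs]; field_simp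
      rw [h2]
      have h3 : 0 ≤ (|(n : ℝ)⁻¹ * A| - δ / 2) ^ 2 / δ := by positivity
      have h4 : (|(n : ℝ)⁻¹ * A| - δ / 2) ^ 2 / δ =
          δ / 4 + |(n : ℝ)⁻¹ * A| ^ 2 / δ - |(n : ℝ)⁻¹ * A| := by
        field_simp; ring
      linarith
    rw [hA]
    refine (abs_add_le _ _).trans (add_le_add hy ?_)
    rw [abs_le]
    constructor <;> linarith
  have iA : Integrable (fun ω => (∑ k ∈ Finset.range n, (f (η k ω) - ∫ ω, f (η k ω) ∂P)) ^ 2) P :=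
    (memLp_finsetSum _ fun k _ => (hfL k).sub (memLp_const _)).integrable_sq
  have iG : Integrable (fun ω => ∑ k ∈ Finset.range n, g (η k ω)) P :=
    integrable_finsetSum _ fun k _ => hgi k
  have hmono := integral_mono (by simpa using ((hint n).sub (integrable_const v)).abs)
    (((integrable_const _).add (iA.const_mul _)).add ((iG.const_mul _).add (integrable_const _)))
    hpt
  refine hmono.trans_lt ?_
  simp only [Pi.add_apply]
  rw [integral_add (by exact (integrable_const _).add (iA.const_mul _))
    (by exact (iG.const_mul _).add (integrable_const _)),
    integral_add (integrable_const _) (iA.const_mul _),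
    integral_add (iG.const_mul _) (integrable_const _), integral_const_mul, integral_const_mul,
    integral_finsetSum _ fun k _ => hgi k]
  have e1 : (n : ℝ)⁻¹ ^ 2 * δ⁻¹ *
      ∫ ω, (∑ k ∈ Finset.range n, (f (η k ω) - ∫ ω, f (η k ω) ∂P)) ^ 2 ∂P ≤
      (n : ℝ)⁻¹ * (C ^ 4 / δ) := by
    refine (mul_le_mul_of_nonneg_left (hvar n) (by positivity)).trans_eq ?_
    field_simp
  have e2 : (n : ℝ)⁻¹ * ∑ k ∈ Finset.range n, ∫ ω, g (η k ω) ∂P ≤ δ / 8 := by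
    rw [inv_mul_le_iff₀ hn0']
    refine (Finset.sum_le_sum fun k _ => hgt k).trans ?_
    simp
  simp only [integral_const, probReal_univ, smul_eq_mul, one_mul]
  linarith

/-! ### Independence of pairs and of disjoint blocks -/

section Independence

variable {Ω : Type*} [MeasurableSpace Ω] {P : Measure Ω}

/-- Preimages of rectangles form a π-system that generates the σ-algebra of a pair. On a finite
intersection of them, first separate the `X` from the `Y` by `h`, then factor each family, then
regroup index by index. -/
lemma iIndepFun_prodMk {ι E F : Type*} [MeasurableSpace E] [MeasurableSpace F]
    {X : ι → Ω → E} {Y : ι → Ω → F} (hmX : ∀ i, Measurable (X i)) (hmY : ∀ i, Measurable (Y i))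
    (hX : iIndepFun X P) (hY : iIndepFun Y P)
    (h : IndepFun (fun ω i => X i ω) (fun ω i => Y i ω) P) :
    iIndepFun (fun i ω => (X i ω, Y i ω)) P := by
  rw [iIndepFun_iff_iIndep]
  refine iIndepSets.iIndep (fun i => ((hmX i).prodMk (hmY i)).comap_le)
    (fun i => Set.preimage (fun ω => (X i ω, Y i ω)) '' Set.image2 (· ×ˢ ·)
      {s : Set E | MeasurableSet s} {t : Set F | MeasurableSet t})
    (fun i => ?_) (fun i => ?_) ?_
  · rintro _ ⟨_, ⟨s, hs, t, ht, rfl⟩, rfl⟩ _ ⟨_, ⟨s', hs', t', ht', rfl⟩, rfl⟩ _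
    exact ⟨_, ⟨s ∩ s', hs.inter hs', t ∩ t', ht.inter ht', rfl⟩, by
      simp only [← Set.prod_inter_prod, Set.preimage_inter]⟩
  · rw [← MeasurableSpace.comap_generateFrom, generateFrom_prod]
  · rw [iIndepSets_iff]
    intro S f hf
    have hf' : ∀ i : S, ∃ st : Set E × Set F, MeasurableSet st.1 ∧ MeasurableSet st.2 ∧
        f i = (X i ⁻¹' st.1) ∩ (Y i ⁻¹' st.2) := by
      intro i
      obtain ⟨_, ⟨s, hs, t, ht, rfl⟩, h⟩ := hf i i.2
      exact ⟨(s, t), hs, ht, h.symm.trans (by ext; simp)⟩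
    choose st hs ht hst using hf'
    classical
    -- The sets chosen on `S` are extended by the whole space, so that they are indexed by all of
    -- `ι`.
    set s : ι → Set E := fun i => if hi : i ∈ S then (st ⟨i, hi⟩).1 else Set.univ
    set t : ι → Set F := fun i => if hi : i ∈ S then (st ⟨i, hi⟩).2 else Set.univ
    have hs' : ∀ i, MeasurableSet (s i) := fun i => by
      by_cases hi : i ∈ S
      · simpa [s, hi] using hs ⟨i, hi⟩
      · simp [s, hi]
    have ht' : ∀ i, MeasurableSet (t i) := fun i => by
      by_cases hi : i ∈ S
      · simpa [t, hi] using ht ⟨i, hi⟩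
      · simp [t, hi]
    have hf'' : ∀ i ∈ S, f i = (X i ⁻¹' s i) ∩ (Y i ⁻¹' t i) := fun i hi => by
      simpa [s, t, hi] using hst ⟨i, hi⟩
    have hA : MeasurableSet {x : ι → E | ∀ i ∈ S, x i ∈ s i} := by
      simp only [Set.ofPred_forall]
      exact Finset.measurableSet_biInter _ fun i _ => measurable_pi_apply i (hs' i)
    have hB : MeasurableSet {y : ι → F | ∀ i ∈ S, y i ∈ t i} := by
      simp only [Set.ofPred_forall]
      exact Finset.measurableSet_biInter _ fun i _ => measurable_pi_apply i (ht' i)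
    have hind := h.measure_inter_preimage_eq_mul _ _ hA hB
    have eA : (fun ω i => X i ω) ⁻¹' {x : ι → E | ∀ i ∈ S, x i ∈ s i} =
        ⋂ i ∈ S, X i ⁻¹' s i := by ext; simp
    have eB : (fun ω i => Y i ω) ⁻¹' {y : ι → F | ∀ i ∈ S, y i ∈ t i} =
        ⋂ i ∈ S, Y i ⁻¹' t i := by ext; simp
    rw [eA, eB, (iIndepFun_iff_measure_inter_preimage_eq_mul.1 hX) S fun i _ => hs' i,
      (iIndepFun_iff_measure_inter_preimage_eq_mul.1 hY) S fun i _ => ht' i,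
      ← Finset.prod_mul_distrib] at hind
    have eAB : ⋂ i ∈ S, f i = (⋂ i ∈ S, X i ⁻¹' s i) ∩ ⋂ i ∈ S, Y i ⁻¹' t i := by
      rw [Set.iInter₂_congr hf'']
      ext ω
      simp only [Set.mem_iInter, Set.mem_inter_iff]
      exact ⟨fun h => ⟨fun i hi => (h i hi).1, fun i hi => (h i hi).2⟩,
        fun h i hi => ⟨h.1 i hi, h.2 i hi⟩⟩
    rw [eAB, hind]
    refine Finset.prod_congr rfl fun i hi => ?_
    rw [hf'' i hi]
    refine (IndepFun.measure_inter_preimage_eq_mul ?_ _ _ (hs' i) (ht' i)).symm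
    exact h.comp (measurable_pi_apply i) (measurable_pi_apply i)

lemma indepFun_pi_of_disjoint {ι E : Type*} [MeasurableSpace E] {Z : ι → Ω → E}
    (hm : ∀ i, Measurable (Z i)) (hZ : iIndepFun Z P) {κ κ' : Type*} {f : κ → ι} {g : κ' → ι}
    (hfg : ∀ a b, f a ≠ g b) :
    IndepFun (fun ω a => Z (f a) ω) (fun ω b => Z (g b) ω) P := by
  rw [IndepFun_iff_Indep]
  have hd : Disjoint (Set.range f) (Set.range g) := by
    rw [Set.disjoint_left]
    rintro _ ⟨a, rfl⟩ ⟨b, hb⟩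
    exact hfg a b hb.symm
  have hind := indep_iSup_of_disjoint (fun i => (hm i).comap_le)
    ((iIndepFun_iff_iIndep _ _ _).1 hZ) hd
  refine indep_of_indep_of_le hind ?_ ?_
  · rw [MeasurableSpace.pi, MeasurableSpace.comap_iSup]
    refine iSup_le fun a => ?_
    rw [MeasurableSpace.comap_comp]
    exact le_iSup₂_of_le (f a) (Set.mem_range_self a) le_rfl
  · rw [MeasurableSpace.pi, MeasurableSpace.comap_iSup]
    refine iSup_le fun a => ?_
    rw [MeasurableSpace.comap_comp]
    exact le_iSup₂_of_le (g a) (Set.mem_range_self a) le_rfl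

end Independence

/-! ### The weak law for products and the central limit theorem for several groups -/

variable {Ω : Type*} [MeasurableSpace Ω] {P : Measure Ω} [IsProbabilityMeasure P]

/-- The weak law of large numbers for products of two sequences with identically distributed
square integrable terms. -/
lemma tendstoInMeasure_mean_mul {ξ η : ℕ → Ω → ℝ} (hξ : ∀ k, Measurable (ξ k))
    (hη : ∀ k, Measurable (η k)) (hindep : iIndepFun (fun k ω => (ξ k ω, η k ω)) P)
    (hξ2 : MemLp (ξ 0) 2 P) (hη2 : MemLp (η 0) 2 P) (hξi : ∀ k, IdentDistrib (ξ k) (ξ 0) P P)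
    (hηi : ∀ k, IdentDistrib (η k) (η 0) P P) {ρ : ℝ} (hρ : ∀ k, ∫ ω, ξ k ω * η k ω ∂P = ρ) :
    TendstoInMeasure P (fun (n : ℕ) ω => (n : ℝ)⁻¹ * ∑ k ∈ Finset.range n, ξ k ω * η k ω) atTop
      fun _ => ρ := by
  have uξ := uniformIntegrable_of_ident hξ2 hξi
  have uη := uniformIntegrable_of_ident hη2 hηi
  have uη' : UniformIntegrable (fun k ω => -1 * η k ω) 2 P :=
    uniformIntegrable_of_ident (hη2.const_mul _) fun k => (hηi k).const_mul _
  have iξ : ∀ k, Integrable (fun ω => ξ k ω ^ 2) P := fun k => (uξ.memLp k).integrable_sq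
  have iη : ∀ k, Integrable (fun ω => η k ω ^ 2) P := fun k => (uη.memLp k).integrable_sq
  have iξη : ∀ k, Integrable (fun ω => ξ k ω * η k ω) P := fun k =>
    (uξ.memLp k).integrable_mul (uη.memLp k)
  have vξ : ∀ k, ∫ ω, ξ k ω ^ 2 ∂P = ∫ ω, ξ 0 ω ^ 2 ∂P := fun k => (hξi k).sq.integral_eq
  have vη : ∀ k, ∫ ω, η k ω ^ 2 ∂P = ∫ ω, η 0 ω ^ 2 ∂P := fun k => (hηi k).sq.integral_eq
  -- Polarization: the law of `ξ k * η k` may depend on `k`, but the second moments of `ξ k ± η k`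
  -- do not, so the weak law for squares applies to both signs.
  have hv : ∀ (c : ℝ), c ^ 2 = 1 → ∀ k, ∫ ω, (ξ k ω + c * η k ω) ^ 2 ∂P =
      ∫ ω, ξ 0 ω ^ 2 ∂P + ∫ ω, η 0 ω ^ 2 ∂P + 2 * c * ρ := by
    intro c hc k
    have he : ∀ ω, (ξ k ω + c * η k ω) ^ 2 = (ξ k ω ^ 2 + η k ω ^ 2) + 2 * c * (ξ k ω * η k ω) :=
      fun ω => by linear_combination (η k ω) ^ 2 * hc
    simp_rw [he]
    rw [integral_add (by exact (iξ k).add (iη k)) ((iξη k).const_mul _),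
      integral_add (iξ k) (iη k), integral_const_mul, vξ, vη, hρ]
  have hwl : ∀ c : ℝ, c ^ 2 = 1 → UniformIntegrable (fun k ω => c * η k ω) 2 P →
      TendstoInMeasure P (fun (n : ℕ) ω => (n : ℝ)⁻¹ * ∑ k ∈ Finset.range n,
        (ξ k ω + c * η k ω) ^ 2) atTop fun _ =>
          ∫ ω, ξ 0 ω ^ 2 ∂P + ∫ ω, η 0 ω ^ 2 ∂P + 2 * c * ρ := by
    intro c hc hu
    refine tendstoInMeasure_mean_sq (η := fun k ω => ξ k ω + c * η k ω)
      (fun k => (hξ k).add ((hη k).const_mul c)) ?_ (UniformIntegrable.add_two uξ hu) (hv c hc)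
    exact hindep.comp (fun _ p => p.1 + c * p.2) fun _ => by fun_prop
  have h := tendstoInMeasure_comp₂ (hwl 1 (by norm_num) (by simpa using uη))
    (hwl (-1) (by norm_num) uη') (f := fun x y => (x - y) / 4) (by fun_prop)
  convert h using 2 with n
  · ext ω
    rw [← mul_sub, ← Finset.sum_sub_distrib, mul_div_assoc, Finset.sum_div]
    congr 1
    refine Finset.sum_congr rfl fun k _ => ?_
    ring
  · ring

/-- The central limit theorem for the stacked normalized sums of `a` independent groups. -/
theorem tendstoInDistribution_groups {Ω' : Type*} [MeasurableSpace Ω'] {P' : Measure Ω'}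
    [IsProbabilityMeasure P'] {K : Type*} [Fintype K] {a : ℕ}
    {ξ : Fin a → ℕ → Ω → K → ℝ} (hm : ∀ i k, Measurable (ξ i k))
    (hindep : iIndepFun (fun p : Fin a × ℕ => ξ p.1 p.2) P)
    (hident : ∀ i k κ, IdentDistrib (fun ω => ξ i k ω κ) (fun ω => ξ i 0 ω κ) P P)
    (hsq : ∀ i κ, MemLp (fun ω => ξ i 0 ω κ) 2 P) (hmean : ∀ i k κ, ∫ ω, ξ i k ω κ ∂P = 0)
    {Γ : Fin a → Matrix K K ℝ} (hcov : ∀ i k κ κ', ∫ ω, ξ i k ω κ * ξ i k ω κ' ∂P = Γ i κ κ')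
    {n : ℕ → Fin a → ℕ} {c : ℕ → Fin a → ℝ} {s : Fin a → ℝ}
    (hc : ∀ i, Tendsto (fun m => c m i) atTop (𝓝 0))
    (hcs : ∀ i, Tendsto (fun m => c m i ^ 2 * n m i) atTop (𝓝 (s i)))
    {Z : Ω' → K × Fin a → ℝ} (hZm : Measurable Z)
    (hZ : ∀ t : K × Fin a → ℝ, charFun (P'.map fun ω => t ⬝ᵥ Z ω) 1 =
      (Real.exp (-(∑ i, s i * ((fun κ => t (κ, i)) ⬝ᵥ Γ i *ᵥ fun κ => t (κ, i)) / 2)) : ℝ)) :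
    TendstoInDistribution (fun m ω (p : K × Fin a) => c m p.2 *
      ∑ k ∈ Finset.range (n m p.2), ξ p.2 k ω p.1) atTop Z (fun _ => P) P' := by
  have hmκ : ∀ i k κ, Measurable fun ω => ξ i k ω κ := fun i k κ =>
    (measurable_pi_apply κ).comp (hm i k)
  refine tendstoInDistribution_of_charFun (fun m => ?_) hZm fun t => ?_
  · exact measurable_pi_iff.2 fun p =>
      (Finset.measurable_sum _ fun k _ => hmκ p.2 k p.1).const_mul _
  set η : Fin a → ℕ → Ω → ℝ := fun i k ω => ∑ κ, t (κ, i) * ξ i k ω κ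
  have hηm : ∀ i k, Measurable (η i k) := fun i k =>
    Finset.measurable_sum _ fun κ _ => (hmκ i k κ).const_mul _
  have hsqk : ∀ i k κ, MemLp (fun ω => ξ i k ω κ) 2 P := fun i k κ =>
    (hident i k κ).memLp_iff.2 (hsq i κ)
  have hηui : ∀ i, UniformIntegrable (η i) 2 P := fun i =>
    uniformIntegrable_lincomb (f := fun κ k ω => ξ i k ω κ) Finset.univ (hsq i)
      (fun κ k => hident i k κ) fun κ => t (κ, i)
  have hηmean : ∀ i k, ∫ ω, η i k ω ∂P = 0 := fun i k => by
    rw [integral_finsetSum _ fun κ _ => ((hsqk i k κ).integrable (by norm_num)).const_mul _]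
    simp [integral_const_mul, hmean]
  have hηv : ∀ i k, ∫ ω, η i k ω ^ 2 ∂P =
      (fun κ => t (κ, i)) ⬝ᵥ Γ i *ᵥ fun κ => t (κ, i) := fun i k => by
    have he : ∀ ω, η i k ω ^ 2 = ∑ κ, ∑ κ', t (κ, i) * t (κ', i) * (ξ i k ω κ * ξ i k ω κ') := by
      intro ω
      rw [sq, Finset.sum_mul_sum]
      refine Finset.sum_congr rfl fun κ _ => Finset.sum_congr rfl fun κ' _ => ?_
      ring
    have hi : ∀ κ κ', Integrable (fun ω => t (κ, i) * t (κ', i) * (ξ i k ω κ * ξ i k ω κ')) P :=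
      fun κ κ' => ((hsqk i k κ).integrable_mul (hsqk i k κ')).const_mul _
    simp_rw [he]
    rw [integral_finsetSum _ fun κ _ => integrable_finsetSum _ fun κ' _ => hi κ κ']
    simp_rw [integral_finsetSum _ fun κ' _ => hi _ κ', integral_const_mul, hcov, dotProduct,
      Matrix.mulVec, dotProduct, Finset.mul_sum]
    refine Finset.sum_congr rfl fun κ _ => Finset.sum_congr rfl fun κ' _ => ?_
    ring
  -- A sigma type as index set lets the observed range of `k` depend on the group through
  -- `Finset.sigma`.
  have hind : iIndepFun (fun p : Σ _ : Fin a, ℕ => η p.1 p.2) P := by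
    have h1 := hindep.precomp (g := fun p : Σ _ : Fin a, ℕ => (p.1, p.2))
      (Equiv.sigmaEquivProd _ _).injective
    exact h1.comp (fun p x => ∑ κ, t (κ, p.1) * x κ) fun p =>
      Finset.measurable_sum _ fun κ _ => (measurable_pi_apply κ).const_mul _
  have hprod : ∀ m, charFun (P.map fun ω => t ⬝ᵥ fun p : K × Fin a => c m p.2 *
      ∑ k ∈ Finset.range (n m p.2), ξ p.2 k ω p.1) 1 =
      ∏ i, ∏ k ∈ Finset.range (n m i), charFun (P.map (η i k)) (c m i) := by
    intro m
    set σ : Finset (Σ _ : Fin a, ℕ) := Finset.univ.sigma fun i => Finset.range (n m i)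
    have hsum : (fun ω => t ⬝ᵥ fun p : K × Fin a => c m p.2 *
        ∑ k ∈ Finset.range (n m p.2), ξ p.2 k ω p.1) =
        fun ω => ∑ p ∈ σ, c m p.1 * η p.1 p.2 ω := by
      ext ω
      simp only [σ, η, Finset.sum_sigma, dotProduct, Fintype.sum_prod_type, Finset.mul_sum]
      rw [Finset.sum_comm]
      refine Finset.sum_congr rfl fun i _ => ?_
      rw [Finset.sum_comm]
      refine Finset.sum_congr rfl fun k _ => Finset.sum_congr rfl fun κ _ => ?_
      ring
    have hind' : iIndepFun (fun (p : Σ _ : Fin a, ℕ) ω => c m p.1 * η p.1 p.2 ω) P :=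
      hind.comp (fun p x => c m p.1 * x) fun p => measurable_const_mul _
    rw [hsum, (hind'.restrict σ).charFun_map_fun_finsetSum_eq_prod fun p _ =>
      ((hηm p.1 p.2).const_mul _).aemeasurable, Finset.prod_apply, Finset.prod_sigma]
    refine Finset.prod_congr rfl fun i _ => Finset.prod_congr rfl fun k _ => ?_
    rw [charFun_map_mul_comp (hηm i k).aemeasurable, mul_one]
  simp_rw [hprod, hZ]
  have hlim := tendsto_finsetProd Finset.univ fun i _ =>
    tendsto_prod_charFun (hηm i) (hηui i) (hηmean i) (hηv i) (hc i) (hcs i)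
  refine hlim.trans_eq ?_
  rw [← Complex.ofReal_prod, ← Real.exp_sum, Finset.sum_neg_distrib]

/-! ### Standard Gaussian vectors -/

section Gaussian

variable {I : Type*} [Fintype I]

/-- The standard Gaussian measure on `I → ℝ`. -/
abbrev stdNormal (I : Type*) [Fintype I] : Measure (I → ℝ) :=
  Measure.pi fun _ : I => gaussianReal 0 1

/-- The density is at most one because `2π ≥ 1`. Domination with constant one passes directly to
finite products, so Lebesgue null sets of vectors are Gaussian null sets. -/
lemma gaussianReal_le_volume : gaussianReal 0 1 ≤ (volume : Measure ℝ) := by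
  rw [gaussianReal_of_var_ne_zero 0 one_ne_zero]
  calc volume.withDensity (gaussianPDF 0 1) ≤ volume.withDensity 1 := by
        refine withDensity_mono (Eventually.of_forall fun x => ?_)
        simp only [gaussianPDF, gaussianPDFReal, Pi.one_apply, ENNReal.ofReal_le_one]
        have h1 : (√(2 * Real.pi * ((1 : NNReal) : ℝ)))⁻¹ ≤ 1 := by
          refine inv_le_one_of_one_le₀ (Real.one_le_sqrt.2 ?_)
          have := Real.pi_gt_three
          simp only [NNReal.coe_one]
          linarith
        have h2 : Real.exp (-(x - 0) ^ 2 / (2 * ((1 : NNReal) : ℝ))) ≤ 1 := by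
          rw [Real.exp_le_one_iff]
          simp only [NNReal.coe_one]
          nlinarith [sq_nonneg (x - 0)]
        exact mul_le_one₀ h1 (Real.exp_pos _).le h2
    _ = volume := withDensity_one

lemma stdNormal_le_volume : stdNormal I ≤ (volume : Measure (I → ℝ)) := by
  refine Measure.le_intro fun s hs _ => ?_
  have h : (stdNormal I).toOuterMeasure ≤
      OuterMeasure.pi fun _ : I => (volume : Measure ℝ).toOuterMeasure := by
    rw [OuterMeasure.le_pi]
    intro t _
    change stdNormal I (Set.univ.pi t) ≤ _
    rw [Measure.pi_pi]
    exact Finset.prod_le_prod' fun i _ => gaussianReal_le_volume (t i)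
  refine (h s).trans_eq ?_
  rw [volume_pi, Measure.pi, toMeasure_apply _ _ hs]

instance : (stdNormal I).IsOpenPosMeasure := by
  have : (gaussianReal 0 1).IsOpenPosMeasure :=
    (gaussianReal_absolutelyContinuous' 0 one_ne_zero).isOpenPosMeasure
  infer_instance

lemma charFun_stdNormal (u : I → ℝ) :
    charFun ((stdNormal I).map fun g => u ⬝ᵥ g) 1 = (Real.exp (-(u ⬝ᵥ u) / 2) : ℝ) := by
  have h := charFun_map_toLp (P := stdNormal I) (X := id) measurable_id (WithLp.toLp 2 u)
  simp only [id_eq] at h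
  rw [← h, map_pi_eq_stdGaussian, charFun_stdGaussian, ← Complex.ofReal_pow,
    EuclideanSpace.real_norm_sq_eq]
  push_cast
  simp [dotProduct, sq]

open scoped MatrixOrder Matrix.Norms.L2Operator in
lemma exists_mul_transpose_eq [DecidableEq I] {S : Matrix I I ℝ} (hS : S.PosSemidef) :
    ∃ R : Matrix I I ℝ, R * Rᵀ = S := by
  refine ⟨CFC.sqrt S, ?_⟩
  have h : (CFC.sqrt S)ᵀ = CFC.sqrt S := by
    have := (CFC.sqrt_nonneg S).isSelfAdjoint.star_eq
    rwa [Matrix.star_eq_conjTranspose, Matrix.conjTranspose_eq_transpose_of_trivial] at this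
  rw [h, CFC.sqrt_mul_sqrt_self _ hS.nonneg]

lemma charFun_stdNormal_mulVec {J : Type*} [Fintype J] {R : Matrix J I ℝ} {S : Matrix J J ℝ}
    (hR : R * Rᵀ = S) (t : J → ℝ) :
    charFun ((stdNormal I).map fun g => t ⬝ᵥ R *ᵥ g) 1 =
      (Real.exp (-(t ⬝ᵥ S *ᵥ t) / 2) : ℝ) := by
  simp_rw [Matrix.dotProduct_mulVec]
  rw [charFun_stdNormal, ← hR, ← Matrix.vecMul_vecMul, Matrix.vecMul_transpose,
    ← Matrix.dotProduct_mulVec, dotProduct_comm t]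

lemma charFun_stdNormal_prod_mulVec {J : Type*} [Fintype J] {R : Matrix J I ℝ} {S : Matrix J J ℝ}
    (hR : R * Rᵀ = S) (t u : J → ℝ) :
    charFun (((stdNormal I).prod (stdNormal I)).map
      fun g => t ⬝ᵥ R *ᵥ g.1 + u ⬝ᵥ R *ᵥ g.2) 1 =
      (Real.exp (-(t ⬝ᵥ S *ᵥ t + u ⬝ᵥ S *ᵥ u) / 2) : ℝ) := by
  have hm : ∀ v : J → ℝ, Measurable fun g : I → ℝ => v ⬝ᵥ R *ᵥ g := fun v =>
    (Continuous.dotProduct continuous_const (by fun_prop)).measurable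
  have hind := indepFun_prod (μ := stdNormal I) (ν := stdNormal I) (hm t) (hm u)
  have h1 : ((stdNormal I).prod (stdNormal I)).map (fun g => t ⬝ᵥ R *ᵥ g.1) =
      (stdNormal I).map fun g => t ⬝ᵥ R *ᵥ g := by
    exact (Measure.map_map (hm t) measurable_fst).symm.trans
      (by rw [measurePreserving_fst.map_eq])
  have h2 : ((stdNormal I).prod (stdNormal I)).map (fun g => u ⬝ᵥ R *ᵥ g.2) =
      (stdNormal I).map fun g => u ⬝ᵥ R *ᵥ g := by
    exact (Measure.map_map (hm u) measurable_snd).symm.trans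
      (by rw [measurePreserving_snd.map_eq])
  have h := congrFun (hind.charFun_map_fun_add_eq_mul ((hm t).comp measurable_fst).aemeasurable
    ((hm u).comp measurable_snd).aemeasurable) 1
  refine h.trans ?_
  rw [Pi.mul_apply]
  refine (congrArg₂ (· * ·) (congrArg (charFun · 1) h1) (congrArg (charFun · 1) h2)).trans ?_
  rw [charFun_stdNormal_mulVec hR, charFun_stdNormal_mulVec hR, ← Complex.ofReal_mul,
    ← Real.exp_add]
  congr 3
  ring

end Gaussian

/-! ### Laws of Gaussian quadratic forms -/

section QuadraticForms

variable {I : Type*} [Fintype I] {H : Matrix I I ℝ}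

lemma quadratic_nonneg (hH : H.PosSemidef) (g : I → ℝ) : 0 ≤ g ⬝ᵥ H *ᵥ g := by
  simpa using hH.dotProduct_mulVec_nonneg g

lemma quadratic_smul (H : Matrix I I ℝ) (s : ℝ) (g : I → ℝ) :
    (s • g) ⬝ᵥ H *ᵥ (s • g) = s ^ 2 * (g ⬝ᵥ H *ᵥ g) := by
  rw [Matrix.mulVec_smul, smul_dotProduct, dotProduct_smul, smul_eq_mul, smul_eq_mul]
  ring

lemma continuous_quadratic (H : Matrix I I ℝ) : Continuous fun g : I → ℝ => g ⬝ᵥ H *ᵥ g :=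
  Continuous.dotProduct continuous_id (by fun_prop)

lemma convex_quadratic_le (hH : H.PosSemidef) (c : ℝ) :
    Convex ℝ {g : I → ℝ | g ⬝ᵥ H *ᵥ g ≤ c} := by
  intro x (hx : x ⬝ᵥ H *ᵥ x ≤ c) y (hy : y ⬝ᵥ H *ᵥ y ≤ c) p q hp hq hpq
  change (p • x + q • y) ⬝ᵥ H *ᵥ (p • x + q • y) ≤ c
  have hxy := quadratic_nonneg hH (x - y)
  have e1 : (p • x + q • y) ⬝ᵥ H *ᵥ (p • x + q • y) = p ^ 2 * (x ⬝ᵥ H *ᵥ x) +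
      q ^ 2 * (y ⬝ᵥ H *ᵥ y) + p * q * (x ⬝ᵥ H *ᵥ y + y ⬝ᵥ H *ᵥ x) := by
    simp only [Matrix.mulVec_add, Matrix.mulVec_smul, add_dotProduct, dotProduct_add,
      smul_dotProduct, dotProduct_smul, smul_eq_mul]
    ring
  have e2 : (x - y) ⬝ᵥ H *ᵥ (x - y) = x ⬝ᵥ H *ᵥ x + y ⬝ᵥ H *ᵥ y -
      (x ⬝ᵥ H *ᵥ y + y ⬝ᵥ H *ᵥ x) := by
    simp only [Matrix.mulVec_sub, sub_dotProduct, dotProduct_sub]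
    ring
  rw [e2] at hxy
  have hq' : q = 1 - p := by linarith
  subst hq'
  rw [e1]
  -- The convexity defect of the form is `p q (x - y)ᵀ H (x - y) ≥ 0`.
  nlinarith [mul_nonneg hp hq, mul_le_mul_of_nonneg_left hx hp, mul_le_mul_of_nonneg_left hy hq,
    mul_nonneg (mul_nonneg hp hq) hxy]

lemma exists_quadratic_pos [DecidableEq I] (hH : H.PosSemidef) (h0 : H ≠ 0) :
    ∃ g : I → ℝ, 0 < g ⬝ᵥ H *ᵥ g := by
  by_contra! hle
  refine h0 (Matrix.ext_of_mulVec_single fun i => ?_)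
  have h := le_antisymm (hle (Pi.single i 1)) (quadratic_nonneg hH _)
  have := (hH.dotProduct_mulVec_zero_iff (Pi.single i 1)).1 (by simpa using h)
  rw [this, Matrix.zero_mulVec]

/-- The level set is empty for `c < 0`, the kernel of `H` and so a proper subspace for `c = 0`, and
part of the frontier of a convex sublevel set for `c > 0`. Each of these is Lebesgue null. -/
lemma stdNormal_quadratic_eq [DecidableEq I] (hH : H.PosSemidef) (h0 : H ≠ 0) (c : ℝ) :
    stdNormal I {g | g ⬝ᵥ H *ᵥ g = c} = 0 := by
  refine le_antisymm ((stdNormal_le_volume _).trans (le_of_eq ?_)) zero_le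
  rcases lt_trichotomy c 0 with hc | rfl | hc
  · convert measure_empty (μ := (volume : Measure (I → ℝ)))
    ext g
    simpa using fun h => absurd (quadratic_nonneg hH g) (by rw [h]; exact not_le.2 hc)
  · refine measure_mono_null (t := (LinearMap.ker H.mulVecLin : Set (I → ℝ))) ?_
      (Measure.addHaar_submodule _ _ fun htop => ?_)
    · intro g (hg : g ⬝ᵥ H *ᵥ g = 0)
      exact (hH.dotProduct_mulVec_zero_iff g).1 (by simpa using hg)
    · obtain ⟨g, hg⟩ := exists_quadratic_pos hH h0
      have : H *ᵥ g = 0 := by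
        have hmem : g ∈ LinearMap.ker H.mulVecLin := htop ▸ Submodule.mem_top
        simpa using hmem
      rw [this] at hg
      simp at hg
  · refine measure_mono_null ?_ ((convex_quadratic_le hH c).addHaar_frontier volume)
    intro g (hg : g ⬝ᵥ H *ᵥ g = c)
    refine ⟨subset_closure hg.le, fun hint => ?_⟩
    -- Scaling a point of the level set by `s > 1` leaves the sublevel set, so the point is not
    -- interior.
    have hcont : ContinuousAt (fun s : ℝ => s • g) 1 := by fun_prop
    have hev : ∀ᶠ s : ℝ in 𝓝 1, s • g ∈ {g : I → ℝ | g ⬝ᵥ H *ᵥ g ≤ c} := by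
      refine hcont.eventually_mem ?_
      rw [one_smul]
      exact mem_interior_iff_mem_nhds.1 hint
    obtain ⟨s, hs, hs1⟩ := ((hev.filter_mono nhdsWithin_le_nhds).and
      (self_mem_nhdsWithin : Set.Ioi (1 : ℝ) ∈ 𝓝[>] 1)).exists
    have hs' : (s • g) ⬝ᵥ H *ᵥ (s • g) ≤ c := hs
    rw [quadratic_smul, hg] at hs'
    have hs1' : (1 : ℝ) < s := hs1
    have hs2 : 1 < s ^ 2 := by nlinarith
    nlinarith

/-- The joint law of finitely many nonzero positive semidefinite Gaussian quadratic forms. -/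
lemma regularLaw_quadratic [DecidableEq I] {L : ℕ} (hL : 1 ≤ L) {H : Fin L → Matrix I I ℝ}
    (hH : ∀ ℓ, (H ℓ).PosSemidef) (h0 : ∀ ℓ, H ℓ ≠ 0) :
    RegularLaw ((stdNormal I).map fun g ℓ => g ⬝ᵥ H ℓ *ᵥ g) := by
  have hc : Continuous fun (g : I → ℝ) ℓ => g ⬝ᵥ H ℓ *ᵥ g :=
    continuous_pi fun ℓ => continuous_quadratic (H ℓ)
  refine ⟨fun ℓ c => ?_, fun ℓ => ?_, fun x y hx hxy => ?_⟩
  · rw [Measure.map_apply hc.measurable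
      (measurableSet_eq_fun (measurable_pi_apply ℓ) measurable_const)]
    exact stdNormal_quadratic_eq (hH ℓ) (h0 ℓ) c
  · rw [Measure.map_apply hc.measurable
      (measurableSet_lt (measurable_pi_apply ℓ) measurable_const)]
    convert measure_empty (μ := stdNormal I)
    ext g
    simpa using quadratic_nonneg (hH ℓ) g
  · have hopen : IsOpen {z : Fin L → ℝ | (∃ ℓ, x ℓ < z ℓ) ∧ ∀ ℓ, z ℓ < y ℓ} := by
      simp only [Set.ofPred_and, Set.ofPred_exists, Set.ofPred_forall]
      exact (isOpen_iUnion fun ℓ => isOpen_lt continuous_const (continuous_apply ℓ)).inter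
        (isOpen_iInter_of_finite fun ℓ => isOpen_lt (continuous_apply ℓ) continuous_const)
    rw [Measure.map_apply hc.measurable hopen.measurableSet]
    refine (hopen.preimage hc).measure_pos _ ?_
    obtain ⟨g, hg⟩ := exists_quadratic_pos (hH ⟨0, hL⟩) (h0 ⟨0, hL⟩)
    -- Move along the ray of a direction on which some form is positive. The index `ℓ` is the first
    -- whose form reaches the midpoint of `x ℓ` and `y ℓ`; there it exceeds `x ℓ`, while every form
    -- is still below its upper threshold.
    obtain ⟨ℓ, hℓ, hmin⟩ := Finset.exists_min_image
      (Finset.univ.filter fun ℓ => 0 < g ⬝ᵥ H ℓ *ᵥ g)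
      (fun ℓ => (x ℓ + y ℓ) / 2 / (g ⬝ᵥ H ℓ *ᵥ g)) ⟨⟨0, hL⟩, by simpa using hg⟩
    simp only [Finset.mem_filter, Finset.mem_univ, true_and] at hℓ hmin
    set w := (x ℓ + y ℓ) / 2 / (g ⬝ᵥ H ℓ *ᵥ g)
    have hy : ∀ ℓ, 0 < y ℓ := fun ℓ => (hx ℓ).trans (hxy ℓ)
    have hw : 0 ≤ w := div_nonneg (by linarith [hx ℓ, hy ℓ]) hℓ.le
    refine ⟨√w • g, ⟨ℓ, ?_⟩, fun ℓ' => ?_⟩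
    · change x ℓ < (√w • g) ⬝ᵥ H ℓ *ᵥ (√w • g)
      rw [quadratic_smul, Real.sq_sqrt hw, div_mul_cancel₀ _ hℓ.ne']
      linarith [hxy ℓ]
    · change (√w • g) ⬝ᵥ H ℓ' *ᵥ (√w • g) < y ℓ'
      rw [quadratic_smul, Real.sq_sqrt hw]
      rcases (quadratic_nonneg (hH ℓ') g).eq_or_lt with h | h
      · rw [← h, mul_zero]
        exact hy ℓ'
      · have := hmin ℓ' h
        rw [le_div_iff₀ h] at this
        linarith [hxy ℓ']

end QuadraticForms

/-! ### Algebra and measurability of sample means and covariances -/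

section Samples

variable {a d : ℕ}

lemma blockDiagonal_quadratic (D : Fin a → Matrix (Fin d) (Fin d) ℝ) (t : Fin d × Fin a → ℝ) :
    t ⬝ᵥ Matrix.blockDiagonal D *ᵥ t =
      ∑ i, (fun j => t (j, i)) ⬝ᵥ D i *ᵥ fun j => t (j, i) := by
  simp only [dotProduct, Matrix.mulVec, Matrix.blockDiagonal_apply, Fintype.sum_prod_type,
    ite_mul, zero_mul, Finset.sum_ite_eq, Finset.mem_univ, if_true]
  rw [Finset.sum_comm]

lemma posSemidef_blockDiagonal {D : Fin a → Matrix (Fin d) (Fin d) ℝ}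
    (hD : ∀ i, (D i).PosSemidef) : (Matrix.blockDiagonal D).PosSemidef := by
  refine Matrix.PosSemidef.of_dotProduct_mulVec_nonneg ?_ fun t => ?_
  · rw [Matrix.IsHermitian, Matrix.blockDiagonal_conjTranspose]
    exact congrArg _ (funext fun i => (hD i).isHermitian)
  · rw [star_trivial, blockDiagonal_quadratic]
    exact Finset.sum_nonneg fun i _ => quadratic_nonneg (hD i) _

lemma posSemidef_sampleCov (n : ℕ) (x : ℕ → Fin d → ℝ) : (sampleCov n x).PosSemidef := by
  rw [sampleCov]
  -- For `n = 0` the factor `(n - 1)⁻¹` is negative, but the sum is empty; for `n = 1` the factor is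
  -- `0⁻¹ = 0`.
  rcases Nat.eq_zero_or_pos n with rfl | hn
  · simpa using Matrix.PosSemidef.zero
  · refine Matrix.PosSemidef.smul (Matrix.posSemidef_sum _ fun k _ => ?_) ?_
    · simpa using Matrix.posSemidef_vecMulVec_self_star (x k - sampleMean n x)
    · rw [inv_nonneg, sub_nonneg]
      exact_mod_cast hn

lemma posSemidef_pooledCov (n : Fin a → ℕ) (x : Fin a → ℕ → Fin d → ℝ) :
    (pooledCov n x).PosSemidef :=
  (posSemidef_blockDiagonal fun i => (posSemidef_sampleCov (n i) (x i)).smul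
    (by positivity : (0 : ℝ) ≤ (n i : ℝ)⁻¹)).smul (by positivity)

lemma measurable_sampleMean (n : ℕ) : Measurable (sampleMean n : (ℕ → Fin d → ℝ) → _) := by
  unfold sampleMean
  fun_prop

lemma measurable_pooledMean (n : Fin a → ℕ) :
    Measurable (pooledMean n : (Fin a → ℕ → Fin d → ℝ) → _) :=
  measurable_pi_iff.2 fun p => (measurable_pi_apply p.1).comp
    ((measurable_sampleMean (n p.2)).comp (measurable_pi_apply p.2))

lemma measurable_sampleCov (n : ℕ) (j j' : Fin d) :
    Measurable fun x : ℕ → Fin d → ℝ => sampleCov n x j j' := by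
  have h : ∀ k j, Measurable fun x : ℕ → Fin d → ℝ => x k j - sampleMean n x j := fun k j =>
    (by fun_prop : Measurable fun x : ℕ → Fin d → ℝ => x k j).sub
      ((measurable_pi_apply j).comp (measurable_sampleMean n))
  simp only [sampleCov, Matrix.smul_apply, Matrix.sum_apply, Matrix.vecMulVec_apply,
    Pi.sub_apply, smul_eq_mul]
  exact (Finset.measurable_sum _ fun k _ => (h k j).mul (h k j')).const_mul _

lemma measurable_pooledCov (n : Fin a → ℕ) (p q : Fin d × Fin a) :
    Measurable fun x : Fin a → ℕ → Fin d → ℝ => pooledCov n x p q := by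
  simp only [pooledCov, Matrix.smul_apply, Matrix.blockDiagonal_apply, smul_eq_mul]
  split_ifs with h
  · exact (((measurable_sampleCov _ _ _).comp (measurable_pi_apply p.2)).const_mul _).const_mul _
  · exact measurable_const

lemma measurable_wildSample (n : Fin a → ℕ) :
    Measurable fun q : (Fin a → ℕ → ℝ) × (Fin a → ℕ → Fin d → ℝ) => wildSample n q.1 q.2 := by
  refine measurable_pi_iff.2 fun i => measurable_pi_iff.2 fun k => ?_
  have h1 : Measurable fun q : (Fin a → ℕ → ℝ) × (Fin a → ℕ → Fin d → ℝ) => q.1 i k := by fun_prop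
  have h2 : Measurable fun q : (Fin a → ℕ → ℝ) × (Fin a → ℕ → Fin d → ℝ) => q.2 i k := by fun_prop
  have h3 : Measurable fun q : (Fin a → ℕ → ℝ) × (Fin a → ℕ → Fin d → ℝ) =>
      sampleMean (n i) (q.2 i) := (measurable_sampleMean (n i)).comp (by fun_prop)
  exact h1.smul (h2.sub h3)

lemma sampleMean_apply (n : ℕ) (x : ℕ → Fin d → ℝ) (j : Fin d) :
    sampleMean n x j = (n : ℝ)⁻¹ * ∑ k ∈ Finset.range n, x k j := by
  simp [sampleMean]

lemma sampleMean_add_const {n : ℕ} (hn : n ≠ 0) (c : Fin d → ℝ) (x : ℕ → Fin d → ℝ) :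
    sampleMean n (fun k => c + x k) = c + sampleMean n x := by
  have hn' : (n : ℝ) ≠ 0 := Nat.cast_ne_zero.2 hn
  ext j
  simp only [sampleMean_apply, Pi.add_apply, Finset.sum_add_distrib, Finset.sum_const,
    Finset.card_range, nsmul_eq_mul]
  field_simp

/-- The average `n⁻¹ ∑_{k < n} u_k v_k`. -/
def meanMul (n : ℕ) (u v : ℕ → ℝ) : ℝ := (n : ℝ)⁻¹ * ∑ k ∈ Finset.range n, u k * v k

/-- The expectation `c` cancels. What centring leaves behind is a product of two averages that both
tend to zero. -/
lemma sampleMean_wild (n : ℕ) (c : Fin d → ℝ) (w : ℕ → ℝ) (e : ℕ → Fin d → ℝ) (j : Fin d) :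
    sampleMean n (fun k => w k • (c + e k - sampleMean n fun l => c + e l)) j =
      meanMul n w (e · j) - meanMul n 1 (e · j) * meanMul n 1 w := by
  rcases eq_or_ne n 0 with rfl | hn
  · simp [sampleMean_apply, meanMul]
  · rw [sampleMean_add_const hn]
    simp only [sampleMean_apply, meanMul, add_sub_add_left_eq_sub, Pi.smul_apply, Pi.sub_apply,
      smul_eq_mul, mul_sub, Finset.sum_sub_distrib, Pi.one_apply, one_mul, ← Finset.sum_mul]
    ring

lemma sampleCov_apply {n : ℕ} (hn : n ≠ 0) (x : ℕ → Fin d → ℝ) (j j' : Fin d) :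
    sampleCov n x j j' = n / (n - 1) *
      (meanMul n (x · j) (x · j') - sampleMean n x j * sampleMean n x j') := by
  have hn' : (n : ℝ) ≠ 0 := Nat.cast_ne_zero.2 hn
  simp only [sampleCov, Matrix.smul_apply, Matrix.sum_apply, Matrix.vecMulVec_apply,
    Pi.sub_apply, smul_eq_mul, meanMul]
  have h : ∀ j, ∑ k ∈ Finset.range n, x k j = n * sampleMean n x j := fun j => by
    rw [sampleMean_apply]
    field_simp
  have he : ∑ k ∈ Finset.range n, (x k j - sampleMean n x j) * (x k j' - sampleMean n x j') =
      ∑ k ∈ Finset.range n, x k j * x k j' - n * (sampleMean n x j * sampleMean n x j') := by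
    simp only [sub_mul, mul_sub, Finset.sum_sub_distrib, ← Finset.sum_mul, ← Finset.mul_sum, h,
      Finset.sum_const, Finset.card_range, nsmul_eq_mul]
    ring
  rw [he]
  field_simp

/-- Every average on the right is a mean of products of two square integrable sequences (`1`, `w`,
`e` or `w e`), to which the weak law for products applies. -/
lemma meanMul_wild {n : ℕ} (hn : n ≠ 0) (c : Fin d → ℝ) (w : ℕ → ℝ) (e : ℕ → Fin d → ℝ)
    (j j' : Fin d) :
    meanMul n (fun k => (w k • (c + e k - sampleMean n fun l => c + e l)) j)
      (fun k => (w k • (c + e k - sampleMean n fun l => c + e l)) j') =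
      meanMul n (fun k => w k * e k j) (fun k => w k * e k j') -
        meanMul n 1 (e · j) * meanMul n w (fun k => w k * e k j') -
        meanMul n 1 (e · j') * meanMul n w (fun k => w k * e k j) +
        meanMul n 1 (e · j) * meanMul n 1 (e · j') * meanMul n w w := by
  rw [sampleMean_add_const hn]
  have hm : ∀ j, sampleMean n e j = meanMul n 1 (e · j) := fun j => by
    simp [sampleMean_apply, meanMul]
  simp only [add_sub_add_left_eq_sub, Pi.smul_apply, Pi.sub_apply, smul_eq_mul, hm]
  set p := meanMul n 1 (e · j)
  set q := meanMul n 1 (e · j')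
  have he : ∀ k, w k * (e k j - p) * (w k * (e k j' - q)) = w k * e k j * (w k * e k j') -
      p * (w k * (w k * e k j')) - q * (w k * (w k * e k j)) + p * q * (w k * w k) :=
    fun k => by ring
  simp only [meanMul, he, Finset.sum_add_distrib, Finset.sum_sub_distrib, ← Finset.mul_sum]
  ring

end Samples

/-! ### Growth of the group sizes -/

section SampleSizes

variable {a : ℕ}

/-- The group sizes `n m i` grow proportionally to the total size, with limiting fractions `κ`. -/
structure GroupSizes (n : ℕ → Fin a → ℕ) (κ : Fin a → ℝ) : Prop where
  total : Tendsto (fun m => totalSize (n m)) atTop atTop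
  pos : ∀ i, 0 < κ i
  ratio : ∀ i, Tendsto (fun m => (n m i : ℝ) / (totalSize (n m) : ℝ)) atTop (𝓝 (κ i))

/-- The factor `√N / n_i` that normalizes the sum over group `i`. -/
def groupScale (n : Fin a → ℕ) (i : Fin a) : ℝ := √(totalSize n : ℝ) * (n i : ℝ)⁻¹

lemma groupScale_sq_mul (n : Fin a → ℕ) (i : Fin a) :
    groupScale n i ^ 2 * n i = totalSize n * (n i : ℝ)⁻¹ := by
  rw [groupScale, mul_pow, Real.sq_sqrt (by positivity)]
  rcases eq_or_ne (n i : ℝ) 0 with h | h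
  · simp [h]
  · field_simp

variable {n : ℕ → Fin a → ℕ} {κ : Fin a → ℝ}

lemma GroupSizes.tendsto_size (h : GroupSizes n κ) (i : Fin a) :
    Tendsto (fun m => n m i) atTop atTop := by
  rw [← tendsto_natCast_atTop_iff (R := ℝ)]
  have hN : Tendsto (fun m => (totalSize (n m) : ℝ)) atTop atTop :=
    tendsto_natCast_atTop_iff.2 h.total
  refine ((h.ratio i).pos_mul_atTop (h.pos i) hN).congr' ?_
  filter_upwards [hN.eventually_gt_atTop 0] with m hm
  rw [div_mul_cancel₀ _ hm.ne']

lemma GroupSizes.tendsto_inv_ratio (h : GroupSizes n κ) (i : Fin a) :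
    Tendsto (fun m => (totalSize (n m) : ℝ) * (n m i : ℝ)⁻¹) atTop (𝓝 (κ i)⁻¹) :=
  ((h.ratio i).inv₀ (h.pos i).ne').congr fun m => by rw [inv_div, div_eq_mul_inv]

lemma GroupSizes.tendsto_groupScale_sq (h : GroupSizes n κ) (i : Fin a) :
    Tendsto (fun m => groupScale (n m) i ^ 2 * n m i) atTop (𝓝 (κ i)⁻¹) :=
  (h.tendsto_inv_ratio i).congr fun m => (groupScale_sq_mul (n m) i).symm

lemma GroupSizes.tendsto_inv_size (h : GroupSizes n κ) (i : Fin a) :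
    Tendsto (fun m => (n m i : ℝ)⁻¹) atTop (𝓝 0) :=
  tendsto_inv_atTop_zero.comp (tendsto_natCast_atTop_iff.2 (h.tendsto_size i))

lemma GroupSizes.tendsto_groupScale (h : GroupSizes n κ) (i : Fin a) :
    Tendsto (fun m => groupScale (n m) i) atTop (𝓝 0) := by
  have h2 : Tendsto (fun m => groupScale (n m) i ^ 2) atTop (𝓝 0) := by
    have := (h.tendsto_inv_ratio i).mul (h.tendsto_inv_size i)
    rw [mul_zero] at this
    refine this.congr fun m => ?_
    rw [groupScale, mul_pow, Real.sq_sqrt (by positivity)]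
    ring
  have h3 := (Real.continuous_sqrt.tendsto 0).comp h2
  rw [Real.sqrt_zero] at h3
  refine h3.congr fun m => ?_
  exact Real.sqrt_sq (by rw [groupScale]; positivity)

end SampleSizes

/-! ### Errors and multipliers -/

variable {Ω : Type*} [MeasurableSpace Ω] {P : Measure Ω} {a d : ℕ}

/-- Independent centred errors with covariance matrices `S i` and, in each group and each
component, identical distributions. -/
structure ErrorModel (P : Measure Ω) (ε : Fin a → ℕ → Ω → Fin d → ℝ)
    (S : Fin a → Matrix (Fin d) (Fin d) ℝ) : Prop where
  meas : ∀ i k, Measurable (ε i k)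
  indep : iIndepFun (fun p : Fin a × ℕ => ε p.1 p.2) P
  ident : ∀ i k j, IdentDistrib (fun ω => ε i k ω j) (fun ω => ε i 0 ω j) P P
  sq : ∀ i k j, MemLp (fun ω => ε i k ω j) 2 P
  mean : ∀ i k j, ∫ ω, ε i k ω j ∂P = 0
  cov : ∀ i k j j', ∫ ω, ε i k ω j * ε i k ω j' ∂P = S i j j'

/-- Independent identically distributed multipliers with mean `0` and variance `1`, independent of
the errors. -/
structure Multipliers (P : Measure Ω) (ε : Fin a → ℕ → Ω → Fin d → ℝ)
    (W : ℕ → Fin a → ℕ → Ω → ℝ) : Prop where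
  meas : ∀ b i k, Measurable (W b i k)
  indep : iIndepFun (fun p : ℕ × Fin a × ℕ => W p.1 p.2.1 p.2.2) P
  ident : ∀ b i k b' i' k', IdentDistrib (W b i k) (W b' i' k') P P
  sq : ∀ b i k, MemLp (W b i k) 2 P
  mean : ∀ b i k, ∫ ω, W b i k ω ∂P = 0
  var : ∀ b i k, ∫ ω, W b i k ω * W b i k ω ∂P = 1
  data : IndepFun (fun ω i k => ε i k ω) (fun ω b i k => W b i k ω) P

variable {ε : Fin a → ℕ → Ω → Fin d → ℝ} {S : Fin a → Matrix (Fin d) (Fin d) ℝ}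
  {W : ℕ → Fin a → ℕ → Ω → ℝ}

lemma ErrorModel.meas_apply (hε : ErrorModel P ε S) (i : Fin a) (k : ℕ) (j : Fin d) :
    Measurable fun ω => ε i k ω j := (measurable_pi_apply j).comp (hε.meas i k)

lemma ErrorModel.posSemidef (hε : ErrorModel P ε S) (i : Fin a) : (S i).PosSemidef := by
  refine Matrix.PosSemidef.of_dotProduct_mulVec_nonneg ?_ fun t => ?_
  · ext j j'
    rw [Matrix.conjTranspose_apply, star_trivial, ← hε.cov i 0, ← hε.cov i 0]
    simp_rw [mul_comm]
  · have hi : ∀ j j', Integrable (fun ω => t j * t j' * (ε i 0 ω j * ε i 0 ω j')) P :=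
      fun j j' => ((hε.sq i 0 j).integrable_mul (hε.sq i 0 j')).const_mul _
    have h : star t ⬝ᵥ S i *ᵥ t = ∫ ω, (∑ j, t j * ε i 0 ω j) ^ 2 ∂P := by
      have he : ∀ ω, (∑ j, t j * ε i 0 ω j) ^ 2 =
          ∑ j, ∑ j', t j * t j' * (ε i 0 ω j * ε i 0 ω j') := fun ω => by
        rw [pow_two, Finset.sum_mul_sum]
        refine Finset.sum_congr rfl fun j _ => Finset.sum_congr rfl fun j' _ => ?_
        ring
      simp_rw [he]
      rw [integral_finsetSum _ fun j _ => integrable_finsetSum _ fun j' _ => hi j j']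
      simp_rw [integral_finsetSum _ fun j' _ => hi _ j', integral_const_mul, hε.cov, dotProduct,
        Matrix.mulVec, dotProduct, Finset.mul_sum, star_trivial]
      refine Finset.sum_congr rfl fun j _ => Finset.sum_congr rfl fun j' _ => ?_
      ring
    rw [h]
    exact integral_nonneg fun ω => sq_nonneg _

lemma ErrorModel.posSemidef_limitCov (hε : ErrorModel P ε S) {κ : Fin a → ℝ}
    (hκ : ∀ i, 0 < κ i) : (limitCov κ S).PosSemidef :=
  posSemidef_blockDiagonal fun i => (hε.posSemidef i).smul (inv_nonneg.2 (hκ i).le)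

lemma limitCov_quadratic (κ : Fin a → ℝ) (S : Fin a → Matrix (Fin d) (Fin d) ℝ)
    (t : Fin d × Fin a → ℝ) : t ⬝ᵥ limitCov κ S *ᵥ t =
      ∑ i, (κ i)⁻¹ * ((fun j => t (j, i)) ⬝ᵥ S i *ᵥ fun j => t (j, i)) := by
  simp only [limitCov, blockDiagonal_quadratic, Matrix.smul_mulVec, dotProduct_smul, smul_eq_mul]

lemma integral_sum_sq [IsProbabilityMeasure P] {η : ℕ → Ω → ℝ} (hind : iIndepFun η P) (hsq : ∀ k, MemLp (η k) 2 P)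
    (hmean : ∀ k, ∫ ω, η k ω ∂P = 0) {v : ℝ} (hv : ∀ k, ∫ ω, η k ω * η k ω ∂P = v) (n : ℕ) :
    ∫ ω, (∑ k ∈ Finset.range n, η k ω) ^ 2 ∂P = n * v := by
  have h := IndepFun.variance_sum (s := Finset.range n) (fun k _ => hsq k)
    fun k _ l _ hkl => hind.indepFun hkl
  have h1 : ∀ k, Var[η k; P] = v := fun k => by
    rw [variance_of_integral_eq_zero (hsq k).aemeasurable (hmean k), ← hv k]
    simp_rw [sq]
  simp_rw [h1, Finset.sum_const, Finset.card_range, nsmul_eq_mul] at h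
  rw [← h, variance_of_integral_eq_zero]
  · simp
  · exact Finset.aemeasurable_sum _ fun k _ => (hsq k).aemeasurable
  · simp only [Finset.sum_apply]
    rw [integral_finsetSum _ fun k _ => (hsq k).integrable (by norm_num)]
    simp [hmean]

lemma ErrorModel.indep_group (hε : ErrorModel P ε S) (i : Fin a) (j : Fin d) :
    iIndepFun (fun k ω => ε i k ω j) P :=
  (hε.indep.precomp (g := fun k : ℕ => (i, k)) (fun _ _ h => (Prod.mk.inj h).2)).comp
    (fun _ x => x j) fun _ => measurable_pi_apply j

namespace Multipliers

lemma indep_group (hW : Multipliers P ε W) (b : ℕ) (i : Fin a) : iIndepFun (fun k ω => W b i k ω) P :=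
  hW.indep.precomp (g := fun k : ℕ => (b, i, k)) fun _ _ h => by simpa using h

lemma indep_error (hW : Multipliers P ε W) (b : ℕ) (i : Fin a) (k : ℕ) (j : Fin d) :
    IndepFun (W b i k) (fun ω => ε i k ω j) P :=
  hW.data.symm.comp (φ := fun w : ℕ → Fin a → ℕ → ℝ => w b i k)
    (ψ := fun e : Fin a → ℕ → Fin d → ℝ => e i k j) (by fun_prop) (by fun_prop)

/-- Independence over the observations of the triples of the error and two of its multipliers. -/
lemma indep_triple (hW : Multipliers P ε W) (hε : ErrorModel P ε S) {b c : ℕ} (hbc : b ≠ c) :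
    iIndepFun (fun (p : Fin a × ℕ) ω => (ε p.1 p.2 ω, (W b p.1 p.2 ω, W c p.1 p.2 ω))) P := by
  have hinj : ∀ b : ℕ, Function.Injective fun p : Fin a × ℕ => (b, p.1, p.2) :=
    fun b p q h => (Prod.mk.inj h).2
  have hpair : iIndepFun (fun (p : Fin a × ℕ) ω => (W b p.1 p.2 ω, W c p.1 p.2 ω)) P :=
    iIndepFun_prodMk (fun p => hW.meas b p.1 p.2) (fun p => hW.meas c p.1 p.2)
      (hW.indep.precomp (hinj b)) (hW.indep.precomp (hinj c))
      (indepFun_pi_of_disjoint (f := fun p : Fin a × ℕ => (b, p.1, p.2))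
        (g := fun p : Fin a × ℕ => (c, p.1, p.2)) (fun p => hW.meas p.1 p.2.1 p.2.2) hW.indep
        fun p q h => hbc (Prod.mk.inj h).1)
  refine iIndepFun_prodMk (fun p => hε.meas p.1 p.2)
    (fun p => (hW.meas b p.1 p.2).prodMk (hW.meas c p.1 p.2)) hε.indep hpair ?_
  exact hW.data.comp (φ := fun (e : Fin a → ℕ → Fin d → ℝ) (p : Fin a × ℕ) => e p.1 p.2)
    (ψ := fun (w : ℕ → Fin a → ℕ → ℝ) (p : Fin a × ℕ) => (w b p.1 p.2, w c p.1 p.2))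
    (by fun_prop) (by fun_prop)

lemma ident_mul [IsProbabilityMeasure P] (hW : Multipliers P ε W) (hε : ErrorModel P ε S)
    (b : ℕ) (i : Fin a) (k : ℕ) (j : Fin d) :
    IdentDistrib (fun ω => W b i k ω * ε i k ω j) (fun ω => W b i 0 ω * ε i 0 ω j) P P :=
  ((hW.ident b i k b i 0).prodMk (hε.ident i k j) (hW.indep_error b i k j)
    (hW.indep_error b i 0 j)).comp (u := fun x : ℝ × ℝ => x.1 * x.2) (by fun_prop)

/-- Independence makes `W² ε²` integrable from second moments alone; no fourth moments are needed.
-/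
lemma memLp_mul (hW : Multipliers P ε W) (hε : ErrorModel P ε S)
    (b : ℕ) (i : Fin a) (k : ℕ) (j : Fin d) :
    MemLp (fun ω => W b i k ω * ε i k ω j) 2 P := by
  have hm : Measurable fun ω => W b i k ω * ε i k ω j :=
    (hW.meas b i k).mul (hε.meas_apply i k j)
  rw [memLp_two_iff_integrable_sq hm.aestronglyMeasurable]
  have h := ((hW.indep_error b i k j).comp (φ := (· ^ 2)) (ψ := (· ^ 2)) (by fun_prop)
    (by fun_prop)).integrable_mul (hW.sq b i k).integrable_sq (hε.sq i k j).integrable_sq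
  refine h.congr (Eventually.of_forall fun ω => ?_)
  simp [mul_pow]

lemma integral_mul (hW : Multipliers P ε W) (hε : ErrorModel P ε S)
    (b : ℕ) (i : Fin a) (k : ℕ) (j : Fin d) :
    ∫ ω, W b i k ω * ε i k ω j ∂P = 0 := by
  rw [(hW.indep_error b i k j).integral_fun_mul_eq_mul_integral
    (hW.meas b i k).aestronglyMeasurable (hε.meas_apply i k j).aestronglyMeasurable, hε.mean,
    mul_zero]

/-- The zero for `b ≠ c` is the reason why two replicates built from the same data become
independent in the limit. -/
lemma integral_mul_mul (hW : Multipliers P ε W) (hε : ErrorModel P ε S)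
    (b c : ℕ) (i : Fin a) (k : ℕ) (f : (Fin d → ℝ) → ℝ) (hf : Measurable f) :
    ∫ ω, W b i k ω * W c i k ω * f (ε i k ω) ∂P =
      if b = c then ∫ ω, f (ε i k ω) ∂P else 0 := by
  have hind : IndepFun (fun ω => W b i k ω * W c i k ω) (fun ω => f (ε i k ω)) P :=
    hW.data.symm.comp (φ := fun w : ℕ → Fin a → ℕ → ℝ => w b i k * w c i k)
      (ψ := fun e : Fin a → ℕ → Fin d → ℝ => f (e i k)) (by fun_prop) (by fun_prop)
  rw [hind.integral_fun_mul_eq_mul_integral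
    ((hW.meas b i k).mul (hW.meas c i k)).aestronglyMeasurable
    (hf.comp (hε.meas i k)).aestronglyMeasurable]
  split_ifs with hbc
  · rw [← hbc, hW.var, one_mul]
  · have h : IndepFun (W b i k) (W c i k) P :=
      hW.indep.indepFun (i := (b, i, k)) (j := (c, i, k)) fun h => hbc (Prod.mk.inj h).1
    rw [h.integral_fun_mul_eq_mul_integral (hW.meas b i k).aestronglyMeasurable
      (hW.meas c i k).aestronglyMeasurable, hW.mean, zero_mul, zero_mul]

end Multipliers

variable {Ω : Type*} [MeasurableSpace Ω] {P : Measure Ω} [IsProbabilityMeasure P] {a d : ℕ}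
  {ε : Fin a → ℕ → Ω → Fin d → ℝ} {S : Fin a → Matrix (Fin d) (Fin d) ℝ}
  {W : ℕ → Fin a → ℕ → Ω → ℝ} {n : ℕ → Fin a → ℕ} {κ : Fin a → ℝ}

/-! ### Consistency of the bootstrap covariance estimator -/

section Consistency

lemma tendstoInMeasure_add {X Y : ℕ → Ω → ℝ} {x y : ℝ}
    (hX : TendstoInMeasure P X atTop fun _ => x) (hY : TendstoInMeasure P Y atTop fun _ => y) :
    TendstoInMeasure P (fun m ω => X m ω + Y m ω) atTop fun _ => x + y :=
  tendstoInMeasure_comp₂ hX hY (f := fun x y => x + y) (by fun_prop)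

lemma tendstoInMeasure_sub {X Y : ℕ → Ω → ℝ} {x y : ℝ}
    (hX : TendstoInMeasure P X atTop fun _ => x) (hY : TendstoInMeasure P Y atTop fun _ => y) :
    TendstoInMeasure P (fun m ω => X m ω - Y m ω) atTop fun _ => x - y :=
  tendstoInMeasure_comp₂ hX hY (f := fun x y => x - y) (by fun_prop)

lemma tendstoInMeasure_mul {X Y : ℕ → Ω → ℝ} {x y : ℝ}
    (hX : TendstoInMeasure P X atTop fun _ => x) (hY : TendstoInMeasure P Y atTop fun _ => y) :
    TendstoInMeasure P (fun m ω => X m ω * Y m ω) atTop fun _ => x * y :=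
  tendstoInMeasure_comp₂ hX hY (f := fun x y => x * y) (by fun_prop)

/-- `φ (X k)`, `k ≥ 0`, are identically distributed square integrable random variables. -/
structure SqIdent {E : Type*} [MeasurableSpace E] (P : Measure Ω) (X : ℕ → Ω → E)
    (φ : E → ℝ) : Prop where
  meas : Measurable φ
  sq : MemLp (fun ω => φ (X 0 ω)) 2 P
  ident : ∀ k, IdentDistrib (fun ω => φ (X k ω)) (fun ω => φ (X 0 ω)) P P

lemma SqIdent.tendsto_meanMul {E : Type*} [MeasurableSpace E] {X : ℕ → Ω → E} {φ ψ : E → ℝ}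
    (hφ : SqIdent P X φ) (hψ : SqIdent P X ψ) (hX : ∀ k, Measurable (X k)) (hind : iIndepFun X P)
    {ρ : ℝ} (hρ : ∀ k, ∫ ω, φ (X k ω) * ψ (X k ω) ∂P = ρ) {ν : ℕ → ℕ}
    (hν : Tendsto ν atTop atTop) :
    TendstoInMeasure P (fun m ω => meanMul (ν m) (fun k => φ (X k ω)) fun k => ψ (X k ω)) atTop
      fun _ => ρ := by
  have h := tendstoInMeasure_mean_mul (fun k => hφ.meas.comp (hX k))
    (fun k => hψ.meas.comp (hX k))
    (hind.comp (fun _ x => (φ x, ψ x)) fun _ => hφ.meas.prodMk hψ.meas) hφ.sq hψ.sq hφ.ident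
    hψ.ident hρ
  exact fun e he => (h e he).comp hν

lemma ErrorModel.convInProb_mean (hε : ErrorModel P ε S) (hn : GroupSizes n κ) (i : Fin a)
    (j : Fin d) :
    TendstoInMeasure P (fun m ω => meanMul (n m i) 1 (ε i · ω j)) atTop fun _ => 0 := by
  have h1 : SqIdent P (ε i) fun _ => 1 :=
    ⟨measurable_const, memLp_const 1, fun k => IdentDistrib.refl aemeasurable_const⟩
  have h2 : SqIdent P (ε i) fun x => x j := ⟨by fun_prop, hε.sq i 0 j, fun k => hε.ident i k j⟩
  exact h1.tendsto_meanMul h2 (hε.meas i)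
    (hε.indep.precomp (g := fun k : ℕ => (i, k)) fun _ _ h => (Prod.mk.inj h).2)
    (fun k => by simpa using hε.mean i k j) (hn.tendsto_size i)

lemma tendsto_div_sub_one {ν : ℕ → ℕ} (hν : Tendsto ν atTop atTop) :
    Tendsto (fun m => (ν m : ℝ) / ((ν m : ℝ) - 1)) atTop (𝓝 1) :=
  (tendsto_natCast_div_add_atTop (-1 : ℝ)).comp hν

/-- The pooled empirical covariance matrix of the wild bootstrap sample is consistent. -/
theorem Multipliers.convInProb_pooledCov (hW : Multipliers P ε W) (hε : ErrorModel P ε S)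
    (hn : GroupSizes n κ) (mu : Fin a → Fin d → ℝ) (b : ℕ) :
    ConvInProb P (fun m ω => pooledCov (n m)
      (wildSample (n m) (fun i k => W b i k ω) (obs mu ε ω))) (limitCov κ S) := by
  rintro ⟨j, i⟩ ⟨j', i'⟩
  simp only [pooledCov, limitCov, Matrix.smul_apply, Matrix.blockDiagonal_apply, smul_eq_mul]
  split_ifs with hi
  swap
  · simpa using tendstoInMeasure_const_of_tendsto (P := P) (x := fun _ => 0) tendsto_const_nhds
  subst hi
  set X : ℕ → Ω → (Fin d → ℝ) × ℝ := fun k ω => (ε i k ω, W b i k ω)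
  have hX : ∀ k, Measurable (X k) := fun k => (hε.meas i k).prodMk (hW.meas b i k)
  -- The pairs come from the independent triples by dropping the second multiplier, for which `b +
  -- 1` serves as a dummy replicate.
  have hind : iIndepFun X P :=
    ((hW.indep_triple hε (Nat.succ_ne_self b).symm).precomp (g := fun k : ℕ => (i, k))
      fun _ _ h => (Prod.mk.inj h).2).comp (fun _ x => (x.1, x.2.1)) fun _ => by fun_prop
  have s1 : SqIdent P X fun _ => 1 :=
    ⟨measurable_const, memLp_const 1, fun k => IdentDistrib.refl aemeasurable_const⟩
  have sw : SqIdent P X fun x => x.2 :=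
    ⟨by fun_prop, hW.sq b i 0, fun k => hW.ident b i k b i 0⟩
  have swe : ∀ j, SqIdent P X fun x => x.2 * x.1 j := fun j =>
    ⟨by fun_prop, hW.memLp_mul hε b i 0 j, fun k => hW.ident_mul hε b i k j⟩
  have hν := hn.tendsto_size i
  have t1 : TendstoInMeasure P (fun m ω => meanMul (n m i) 1 (W b i · ω)) atTop fun _ => 0 :=
    s1.tendsto_meanMul sw hX hind (fun k => by simpa using hW.mean b i k) hν
  have t2 : ∀ j, TendstoInMeasure P (fun m ω => meanMul (n m i) (W b i · ω) (ε i · ω j)) atTop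
      fun _ => 0 := fun j => by
    have := s1.tendsto_meanMul (swe j) hX hind
      (fun k => by simpa using hW.integral_mul hε b i k j) hν
    simpa [meanMul] using this
  have t3 : TendstoInMeasure P (fun m ω => meanMul (n m i) (W b i · ω) (W b i · ω)) atTop
      fun _ => 1 := sw.tendsto_meanMul sw hX hind (fun k => hW.var b i k) hν
  have t4 : ∀ j, TendstoInMeasure P (fun m ω => meanMul (n m i) (W b i · ω)
      fun k => W b i k ω * ε i k ω j) atTop fun _ => 0 := fun j =>
    sw.tendsto_meanMul (swe j) hX hind (fun k => by
      have := hW.integral_mul_mul hε b b i k (fun x => x j) (by fun_prop)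
      simp only [if_true, hε.mean] at this
      simpa [X, mul_assoc] using this) hν
  have t5 : TendstoInMeasure P (fun m ω => meanMul (n m i) (fun k => W b i k ω * ε i k ω j)
      fun k => W b i k ω * ε i k ω j') atTop fun _ => S i j j' :=
    (swe j).tendsto_meanMul (swe j') hX hind (fun k => by
      have := hW.integral_mul_mul hε b b i k (fun x => x j * x j') (by fun_prop)
      simp only [if_true, hε.cov] at this
      rw [← this]
      refine integral_congr_ae (Eventually.of_forall fun ω => ?_)
      simp only [X]
      ring) hν
  have te := hε.convInProb_mean hn i
  have tm : ∀ j, TendstoInMeasure P (fun m ω => meanMul (n m i) (W b i · ω) (ε i · ω j) -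
      meanMul (n m i) 1 (ε i · ω j) * meanMul (n m i) 1 (W b i · ω)) atTop fun _ => 0 - 0 * 0 :=
    fun j => tendstoInMeasure_sub (t2 j) (tendstoInMeasure_mul (te j) t1)
  have tc := tendstoInMeasure_sub (tendstoInMeasure_add (tendstoInMeasure_sub
    (tendstoInMeasure_sub t5 (tendstoInMeasure_mul (te j) (t4 j')))
    (tendstoInMeasure_mul (te j') (t4 j))) (tendstoInMeasure_mul (tendstoInMeasure_mul
      (te j) (te j')) t3)) (tendstoInMeasure_mul (tm j) (tm j'))
  have hlim := tendstoInMeasure_mul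
    (tendstoInMeasure_const_of_tendsto (P := P) (hn.tendsto_inv_ratio i))
    (tendstoInMeasure_mul (tendstoInMeasure_const_of_tendsto (P := P) (tendsto_div_sub_one hν)) tc)
  -- All centring terms vanish in the limit; only the average of `(W ε_j)(W ε_j')` survives.
  have hval : (κ i)⁻¹ * (1 * (S i j j' - 0 * 0 - 0 * 0 + 0 * 0 * 1 - (0 - 0 * 0) * (0 - 0 * 0))) =
      (κ i)⁻¹ * S i j j' := by ring
  rw [hval] at hlim
  refine TendstoInMeasure.congr' ?_ EventuallyEq.rfl hlim
  filter_upwards [hν.eventually_ne_atTop 0] with m hm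
  refine Eventually.of_forall fun ω => ?_
  simp only
  have hx : wildSample (n m) (fun i k => W b i k ω) (obs mu ε ω) i = fun k => W b i k ω •
      (mu i + ε i k ω - sampleMean (n m i) fun l => mu i + ε i l ω) := rfl
  rw [hx, sampleCov_apply hm, meanMul_wild hm, sampleMean_wild, sampleMean_wild, mul_assoc]

end Consistency

variable {Ω : Type*} [MeasurableSpace Ω] {P : Measure Ω} [IsProbabilityMeasure P] {a d : ℕ}
  {ε : Fin a → ℕ → Ω → Fin d → ℝ} {S : Fin a → Matrix (Fin d) (Fin d) ℝ}
  {W : ℕ → Fin a → ℕ → Ω → ℝ} {n : ℕ → Fin a → ℕ} {κ : Fin a → ℝ}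
  {R : Matrix (Fin d × Fin a) (Fin d × Fin a) ℝ}

/-! ### Central limit theorems for the data and for two bootstrap replicates -/

section CentralLimit

lemma TendstoInDistribution.congr_eventually {E Ω' : Type*} [TopologicalSpace E]
    [MeasurableSpace E] [OpensMeasurableSpace E] [MeasurableSpace Ω'] {P' : Measure Ω'}
    [IsProbabilityMeasure P'] {X Y : ℕ → Ω → E} {Z : Ω' → E}
    (h : TendstoInDistribution X atTop Z (fun _ => P) P') (hY : ∀ m, AEMeasurable (Y m) P)
    (hXY : ∀ᶠ m in atTop, X m = Y m) : TendstoInDistribution Y atTop Z (fun _ => P) P' where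
  forall_aemeasurable := hY
  aemeasurable_limit := h.aemeasurable_limit
  tendsto := h.tendsto.congr' (hXY.mono fun m hm => Subtype.ext (by simp [hm]))

lemma measurable_obs (hε : ∀ i k, Measurable (ε i k)) (mu : Fin a → Fin d → ℝ) :
    Measurable fun ω => obs mu ε ω :=
  measurable_pi_iff.2 fun i => measurable_pi_iff.2 fun k => (hε i k).const_add _

/-- The central limit theorem for the stacked vector of group means. -/
theorem ErrorModel.tendsto_pooledMean (hε : ErrorModel P ε S) (hn : GroupSizes n κ)
    (hR : R * Rᵀ = limitCov κ S) (mu : Fin a → Fin d → ℝ) :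
    TendstoInDistribution (fun m ω => √(totalSize (n m) : ℝ) •
      (pooledMean (n m) (obs mu ε ω) - fun p : Fin d × Fin a => mu p.2 p.1)) atTop
      (fun g => R *ᵥ g) (fun _ => P) (stdNormal (Fin d × Fin a)) := by
  have h := tendstoInDistribution_groups (P' := stdNormal (Fin d × Fin a)) hε.meas hε.indep
    hε.ident (fun i j => hε.sq i 0 j) hε.mean hε.cov hn.tendsto_groupScale
    hn.tendsto_groupScale_sq (Z := fun g => R *ᵥ g)
    (Continuous.measurable (by fun_prop)) fun t => by
      rw [charFun_stdNormal_mulVec hR, limitCov_quadratic, neg_div, Finset.sum_div]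
  refine TendstoInDistribution.congr_eventually h (fun m => ?_) ?_
  · exact ((((measurable_pooledMean (n m)).comp (measurable_obs hε.meas mu)).sub_const _).const_smul
      (√(totalSize (n m) : ℝ))).aemeasurable
  -- An empty group has sample mean `0`, so the expectation cancels only once all groups are
  -- nonempty.
  · filter_upwards [eventually_all.2 fun i => (hn.tendsto_size i).eventually_ne_atTop 0] with m hm
    ext ω p
    have hx : obs mu ε ω p.2 = fun k => mu p.2 + ε p.2 k ω := rfl
    simp only [Pi.smul_apply, Pi.sub_apply, pooledMean, hx, smul_eq_mul]
    rw [sampleMean_add_const (hm p.2), Pi.add_apply, add_sub_cancel_left, sampleMean_apply,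
      groupScale, mul_assoc]

/-- This is the contribution of centring to the scaled bootstrap mean. Multipliers and errors are
independent, so its second moment factors; for a nonempty group it equals `groupScale² · S i j j`,
which tends to zero. -/
lemma Multipliers.convInProb_remainder (hW : Multipliers P ε W) (hε : ErrorModel P ε S)
    (hn : GroupSizes n κ) (b : ℕ) (i : Fin a) (j : Fin d) :
    TendstoInMeasure P (fun m ω => -meanMul (n m i) 1 (ε i · ω j) *
      (groupScale (n m) i * ∑ k ∈ Finset.range (n m i), W b i k ω)) atTop fun _ => 0 := by
  have he : ∀ m ω, |(-meanMul (n m i) 1 (ε i · ω j) *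
      (groupScale (n m) i * ∑ k ∈ Finset.range (n m i), W b i k ω)) - 0| ^ 2 =
      ((n m i : ℝ)⁻¹ ^ 2 * groupScale (n m) i ^ 2) *
        ((∑ k ∈ Finset.range (n m i), W b i k ω) ^ 2 *
          (∑ k ∈ Finset.range (n m i), ε i k ω j) ^ 2) := fun m ω => by
    rw [sq_abs, sub_zero, meanMul]
    simp only [Pi.one_apply, one_mul]
    ring
  have hind : ∀ m, IndepFun (fun ω => (∑ k ∈ Finset.range (n m i), W b i k ω) ^ 2)
      (fun ω => (∑ k ∈ Finset.range (n m i), ε i k ω j) ^ 2) P := fun m =>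
    hW.data.symm.comp
      (φ := fun w : ℕ → Fin a → ℕ → ℝ => (∑ k ∈ Finset.range (n m i), w b i k) ^ 2)
      (ψ := fun e : Fin a → ℕ → Fin d → ℝ => (∑ k ∈ Finset.range (n m i), e i k j) ^ 2)
      (by fun_prop) (by fun_prop)
  have iW : ∀ m, Integrable (fun ω => (∑ k ∈ Finset.range (n m i), W b i k ω) ^ 2) P := fun m =>
    (memLp_finsetSum _ fun k _ => hW.sq b i k).integrable_sq
  have iε : ∀ m, Integrable (fun ω => (∑ k ∈ Finset.range (n m i), ε i k ω j) ^ 2) P := fun m =>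
    (memLp_finsetSum _ fun k _ => hε.sq i k j).integrable_sq
  refine tendstoInMeasure_of_integral_pow 2 two_ne_zero (fun m => ?_) ?_
  · simp_rw [he]
    exact ((hind m).integrable_mul (iW m) (iε m)).const_mul _
  · simp_rw [he, integral_const_mul]
    have hv : ∀ m, ∫ ω, (∑ k ∈ Finset.range (n m i), W b i k ω) ^ 2 *
        (∑ k ∈ Finset.range (n m i), ε i k ω j) ^ 2 ∂P =
        (n m i * 1) * (n m i * S i j j) := fun m => by
      rw [(hind m).integral_fun_mul_eq_mul_integral (iW m).aestronglyMeasurable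
        (iε m).aestronglyMeasurable, integral_sum_sq (hW.indep_group b i) (hW.sq b i)
        (hW.mean b i) (hW.var b i), integral_sum_sq (hε.indep_group i j) (fun k => hε.sq i k j)
        (fun k => hε.mean i k j) fun k => hε.cov i k j j]
    simp_rw [hv]
    have hlim := ((hn.tendsto_inv_size i).mul (hn.tendsto_groupScale_sq i)).mul_const (S i j j)
    rw [zero_mul, zero_mul] at hlim
    refine hlim.congr fun m => ?_
    rcases eq_or_ne (n m i : ℝ) 0 with h | h
    · simp [h]
    · field_simp

/-- The joint central limit theorem for the means of two wild bootstrap samples. -/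
theorem Multipliers.tendsto_pooledMean (hW : Multipliers P ε W) (hε : ErrorModel P ε S)
    (hn : GroupSizes n κ) (hR : R * Rᵀ = limitCov κ S) (mu : Fin a → Fin d → ℝ) {b c : ℕ}
    (hbc : b ≠ c) :
    TendstoInDistribution (fun m ω =>
      (√(totalSize (n m) : ℝ) • pooledMean (n m)
        (wildSample (n m) (fun i k => W b i k ω) (obs mu ε ω)),
       √(totalSize (n m) : ℝ) • pooledMean (n m)
        (wildSample (n m) (fun i k => W c i k ω) (obs mu ε ω)))) atTop
      (fun g => (R *ᵥ g.1, R *ᵥ g.2)) (fun _ => P)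
      ((stdNormal (Fin d × Fin a)).prod (stdNormal (Fin d × Fin a))) := by
  set bs : Fin 2 → ℕ := ![b, c]
  have hbs : ∀ s s', bs s = bs s' ↔ s = s' := by
    intro s s'
    fin_cases s <;> fin_cases s' <;> simp [bs, hbc, hbc.symm]
  -- Both replicates are stacked into one vector of dimension `2d`. Its covariance is block
  -- diagonal, so a single central limit theorem yields the product limit.
  set ξ : Fin a → ℕ → Ω → Fin 2 × Fin d → ℝ := fun i k ω s => W (bs s.1) i k ω * ε i k ω s.2
  have hind : iIndepFun (fun p : Fin a × ℕ => ξ p.1 p.2) P := by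
    have h := (hW.indep_triple hε hbc).comp
      (fun _ (x : (Fin d → ℝ) × ℝ × ℝ) (s : Fin 2 × Fin d) => ![x.2.1, x.2.2] s.1 * x.1 s.2)
      fun _ => measurable_pi_iff.2 fun ⟨s, j⟩ => by
        fin_cases s
        · exact (measurable_fst.comp measurable_snd).mul
            ((measurable_pi_apply j).comp measurable_fst)
        · exact (measurable_snd.comp measurable_snd).mul
            ((measurable_pi_apply j).comp measurable_fst)
    convert h using 1
    ext p ω ⟨s, j⟩
    fin_cases s <;> rfl
  have hcov : ∀ i k s s', ∫ ω, ξ i k ω s * ξ i k ω s' ∂P =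
      (Matrix.of fun s s' : Fin 2 × Fin d => if s.1 = s'.1 then S i s.2 s'.2 else 0) s s' := by
    intro i k s s'
    have h := hW.integral_mul_mul hε (bs s.1) (bs s'.1) i k (fun x => x s.2 * x s'.2)
      (by fun_prop)
    simp only [hbs, hε.cov] at h
    rw [Matrix.of_apply, ← h]
    refine integral_congr_ae (Eventually.of_forall fun ω => ?_)
    simp only [ξ]
    ring
  have hZ : Continuous fun (g : (Fin d × Fin a → ℝ) × (Fin d × Fin a → ℝ))
      (p : (Fin 2 × Fin d) × Fin a) => ![R *ᵥ g.1, R *ᵥ g.2] p.1.1 (p.1.2, p.2) := by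
    refine continuous_pi fun ⟨⟨s, j⟩, i⟩ => ?_
    fin_cases s
    · exact (continuous_apply (j, i)).comp (by fun_prop : Continuous fun g :
        (Fin d × Fin a → ℝ) × (Fin d × Fin a → ℝ) => R *ᵥ g.1)
    · exact (continuous_apply (j, i)).comp (by fun_prop : Continuous fun g :
        (Fin d × Fin a → ℝ) × (Fin d × Fin a → ℝ) => R *ᵥ g.2)
  have hclt := tendstoInDistribution_groups (ξ := ξ)
    (P' := (stdNormal (Fin d × Fin a)).prod (stdNormal (Fin d × Fin a)))
    (fun i k => measurable_pi_iff.2 fun s => (hW.meas _ i k).mul (hε.meas_apply i k s.2)) hind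
    (fun i k s => hW.ident_mul hε _ i k s.2) (fun i s => hW.memLp_mul hε _ i 0 s.2)
    (fun i k s => hW.integral_mul hε _ i k s.2) hcov hn.tendsto_groupScale
    hn.tendsto_groupScale_sq hZ.measurable fun t => by
      have e : ∀ g : (Fin d × Fin a → ℝ) × (Fin d × Fin a → ℝ),
          (t ⬝ᵥ fun p : (Fin 2 × Fin d) × Fin a => ![R *ᵥ g.1, R *ᵥ g.2] p.1.1 (p.1.2, p.2)) =
          (fun p : Fin d × Fin a => t ((0, p.1), p.2)) ⬝ᵥ R *ᵥ g.1 +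
          (fun p : Fin d × Fin a => t ((1, p.1), p.2)) ⬝ᵥ R *ᵥ g.2 := fun g => by
        simp [dotProduct, Fintype.sum_prod_type]
      simp_rw [e]
      rw [charFun_stdNormal_prod_mulVec hR, limitCov_quadratic, limitCov_quadratic,
        ← Finset.sum_add_distrib, neg_div, Finset.sum_div]
      congr 4
      ext i
      rw [← mul_add]
      congr 2
      simp [dotProduct, Matrix.mulVec, Fintype.sum_prod_type, ite_mul]
  have hrem : TendstoInMeasure P (fun m ω (p : (Fin 2 × Fin d) × Fin a) =>
      -meanMul (n m p.2) 1 (ε p.2 · ω p.1.2) * (groupScale (n m) p.2 *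
        ∑ k ∈ Finset.range (n m p.2), W (bs p.1.1) p.2 k ω)) atTop fun _ => 0 :=
    tendstoInMeasure_pi fun p => hW.convInProb_remainder hε hn (bs p.1.1) p.2 p.1.2
  have hsum := hclt.add_of_tendstoInMeasure_const hrem fun m =>
    (measurable_pi_iff.2 fun p => by
      refine Measurable.mul (Measurable.neg ?_) (Measurable.const_mul
        (Finset.measurable_sum _ fun k _ => hW.meas _ _ k) _)
      exact (Finset.measurable_sum _ fun k _ =>
        (hε.meas_apply p.2 k p.1.2).const_mul _).const_mul _).aemeasurable
  have hpair := hsum.continuous_comp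
    (g := fun x : (Fin 2 × Fin d) × Fin a → ℝ =>
      ((fun p : Fin d × Fin a => x ((0, p.1), p.2)), fun p : Fin d × Fin a => x ((1, p.1), p.2)))
    (by fun_prop)
  have hmean : ∀ m ω b (p : Fin d × Fin a), groupScale (n m) p.2 *
      ∑ k ∈ Finset.range (n m p.2), W b p.2 k ω * ε p.2 k ω p.1 +
      -meanMul (n m p.2) 1 (ε p.2 · ω p.1) * (groupScale (n m) p.2 *
        ∑ k ∈ Finset.range (n m p.2), W b p.2 k ω) = √(totalSize (n m) : ℝ) *
      pooledMean (n m) (wildSample (n m) (fun i k => W b i k ω) (obs mu ε ω)) p := by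
    intro m ω b p
    have hx : wildSample (n m) (fun i k => W b i k ω) (obs mu ε ω) p.2 = fun k => W b p.2 k ω •
      (mu p.2 + ε p.2 k ω - sampleMean (n m p.2) fun l => mu p.2 + ε p.2 l ω) := rfl
    rw [pooledMean, hx, sampleMean_wild]
    simp only [meanMul, groupScale, Pi.one_apply, one_mul]
    ring
  refine hpair.congr (fun m => Eventually.of_forall fun ω => ?_)
    (Eventually.of_forall fun g => ?_)
  · refine Prod.ext (funext fun p => ?_) (funext fun p => ?_)
    · exact hmean m ω b p
    · exact hmean m ω c p
  · refine Prod.ext (funext fun p => ?_) (funext fun p => ?_) <;> simp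

end CentralLimit

/-! ### The coefficient matrices of the standardized forms -/

section Coefficients

variable {ρ ι : Type*} [Fintype ρ] [Fintype ι] [DecidableEq ι]

/-- The matrix of the standardized quadratic form. -/
@[irreducible] def coefMatrix (C : Matrix ρ ι ℝ) (M : Matrix ρ ρ ℝ) (S : Matrix ι ι ℝ) : Matrix ρ ρ ℝ :=
  if 0 < ((Cᵀ * M * C * S) ^ 2).trace then (√(2 * ((Cᵀ * M * C * S) ^ 2).trace))⁻¹ • M else 0

/-- Moving `N`, the denominator and the indicator into vector and matrix leaves a plain quadratic
form, to which Slutsky's theorem applies. -/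
lemma quadForm_eq (N : ℕ) (C : Matrix ρ ι ℝ) (M : Matrix ρ ρ ℝ) (S : Matrix ι ι ℝ) (y : ρ → ℝ) :
    quadForm N C M S y = (√(N : ℝ) • y) ⬝ᵥ coefMatrix C M S *ᵥ (√(N : ℝ) • y) := by
  rw [quadratic_smul, Real.sq_sqrt (by positivity), quadForm, coefMatrix]
  split_ifs with h
  · rw [Matrix.smul_mulVec, dotProduct_smul, smul_eq_mul]
    ring
  · simp

lemma posSemidef_coefMatrix {C : Matrix ρ ι ℝ} {M : Matrix ρ ρ ℝ} (hM : M.PosSemidef)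
    (S : Matrix ι ι ℝ) : (coefMatrix C M S).PosSemidef := by
  rw [coefMatrix]
  split_ifs
  · exact hM.smul (by positivity)
  · exact Matrix.PosSemidef.zero

lemma quadForm_nonneg (N : ℕ) {C : Matrix ρ ι ℝ} {M : Matrix ρ ρ ℝ} (hM : M.PosSemidef)
    (S : Matrix ι ι ℝ) (y : ρ → ℝ) : 0 ≤ quadForm N C M S y := by
  rw [quadForm_eq]
  exact quadratic_nonneg (posSemidef_coefMatrix hM S) _

lemma continuous_trace_sq (C : Matrix ρ ι ℝ) :
    Continuous fun v : (ρ × ρ) ⊕ (ι × ι) → ℝ =>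
      ((Cᵀ * Matrix.of (fun p q => v (.inl (p, q))) * C *
        Matrix.of fun p q => v (.inr (p, q))) ^ 2).trace := by
  simp only [pow_two, Matrix.trace, Matrix.diag_apply, Matrix.mul_apply, Matrix.of_apply]
  fun_prop

lemma measurable_coefMatrix (C : Matrix ρ ι ℝ) (p q : ρ) :
    Measurable fun v : (ρ × ρ) ⊕ (ι × ι) → ℝ =>
      coefMatrix C (Matrix.of fun p q => v (.inl (p, q)))
        (Matrix.of fun p q => v (.inr (p, q))) p q := by
  have ht := (continuous_trace_sq C).measurable
  have h : ∀ v : (ρ × ρ) ⊕ (ι × ι) → ℝ, coefMatrix C (Matrix.of fun p q => v (.inl (p, q)))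
      (Matrix.of fun p q => v (.inr (p, q))) p q =
      if 0 < ((Cᵀ * Matrix.of (fun p q => v (.inl (p, q))) * C *
        Matrix.of fun p q => v (.inr (p, q))) ^ 2).trace then
      (√(2 * ((Cᵀ * Matrix.of (fun p q => v (.inl (p, q))) * C *
        Matrix.of fun p q => v (.inr (p, q))) ^ 2).trace))⁻¹ * v (.inl (p, q)) else 0 := by
    intro v
    rw [coefMatrix]
    split_ifs <;> simp
  simp_rw [h]
  exact Measurable.ite (measurableSet_lt measurable_const ht)
    ((ht.const_mul 2).sqrt.inv.mul (measurable_pi_apply _)) measurable_const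

/-- Positivity of the trace is an open condition, so near `v₀` the indicator equals one and the
denominator stays away from zero. -/
lemma continuousAt_coefMatrix (C : Matrix ρ ι ℝ) (p q : ρ) {v₀ : (ρ × ρ) ⊕ (ι × ι) → ℝ}
    (h0 : 0 < ((Cᵀ * Matrix.of (fun p q => v₀ (.inl (p, q))) * C *
      Matrix.of fun p q => v₀ (.inr (p, q))) ^ 2).trace) :
    ContinuousAt (fun v : (ρ × ρ) ⊕ (ι × ι) → ℝ =>
      coefMatrix C (Matrix.of fun p q => v (.inl (p, q)))
        (Matrix.of fun p q => v (.inr (p, q))) p q) v₀ := by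
  have ht := (continuous_trace_sq C).continuousAt (x := v₀)
  have hc : ContinuousAt (fun v : (ρ × ρ) ⊕ (ι × ι) → ℝ =>
      (√(2 * ((Cᵀ * Matrix.of (fun p q => v (.inl (p, q))) * C *
        Matrix.of fun p q => v (.inr (p, q))) ^ 2).trace))⁻¹ * v (.inl (p, q))) v₀ :=
    ((ht.const_mul 2).sqrt.inv₀ (Real.sqrt_ne_zero'.2 (by linarith))).mul
      (continuous_apply _).continuousAt
  refine hc.congr ?_
  filter_upwards [ht.eventually (lt_mem_nhds h0)] with v hv
  rw [coefMatrix, if_pos hv, Matrix.smul_apply, Matrix.of_apply, smul_eq_mul]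

variable {Ω : Type*} [MeasurableSpace Ω] {P : Measure Ω}

lemma ConvInProb.coefMatrix [IsProbabilityMeasure P] {C : Matrix ρ ι ℝ}
    {M : ℕ → Ω → Matrix ρ ρ ℝ} {M₀ : Matrix ρ ρ ℝ} {S : ℕ → Ω → Matrix ι ι ℝ} {S₀ : Matrix ι ι ℝ}
    (hM : ConvInProb P M M₀) (hS : ConvInProb P S S₀)
    (h0 : 0 < ((Cᵀ * M₀ * C * S₀) ^ 2).trace) :
    ConvInProb P (fun m ω => coefMatrix C (M m ω) (S m ω)) (QFMCT.coefMatrix C M₀ S₀) := by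
  intro p q
  have h : TendstoInMeasure P (fun m ω (x : (ρ × ρ) ⊕ (ι × ι)) =>
      Sum.elim (fun y => M m ω y.1 y.2) (fun y => S m ω y.1 y.2) x) atTop
      fun _ => Sum.elim (fun y => M₀ y.1 y.2) (fun y => S₀ y.1 y.2) :=
    tendstoInMeasure_pi fun x => by
      rcases x with x | x
      · exact hM x.1 x.2
      · exact hS x.1 x.2
  exact tendstoInMeasure_comp h (continuousAt_coefMatrix C p q h0)

lemma measurable_coefMatrix_comp (C : Matrix ρ ι ℝ) {M : Ω → Matrix ρ ρ ℝ} {S : Ω → Matrix ι ι ℝ}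
    (hM : ∀ p q, Measurable fun ω => M ω p q) (hS : ∀ p q, Measurable fun ω => S ω p q) (p q : ρ) :
    Measurable fun ω => coefMatrix C (M ω) (S ω) p q := by
  have h : Measurable fun ω => (Sum.elim (fun y => M ω y.1 y.2) (fun y => S ω y.1 y.2) :
      (ρ × ρ) ⊕ (ι × ι) → ℝ) := by
    refine measurable_pi_iff.2 fun x => ?_
    rcases x with x | x
    · simpa only [Sum.elim_inl] using hM x.1 x.2
    · simpa only [Sum.elim_inr] using hS x.1 x.2
  have h2 := (measurable_coefMatrix C p q).comp h
  simp only [Function.comp_def, Sum.elim_inl, Sum.elim_inr] at h2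
  exact h2

end Coefficients

/-! ### Nondegeneracy of the limiting forms -/

section Nondegeneracy

variable {ρ ι : Type*} [Fintype ρ] [Fintype ι]
  {C : Matrix ρ ι ℝ} {M : Matrix ρ ρ ℝ} {S R : Matrix ι ι ℝ}

/-- With `K = (C R)ᵀ M (C R)` one has `(Cᵀ M C S)² = Cᵀ M (C R) K Rᵀ`. If `K` vanished, the matrix
would be nilpotent and have no nonzero eigenvalue. -/
lemma transpose_mul_mul_ne_zero [DecidableEq ι] (hR : R * Rᵀ = S)
    (h : ∃ c : ℝ, c ≠ 0 ∧ Module.End.HasEigenvalue (Matrix.toLin' (Cᵀ * M * C * S)) c) :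
    (C * R)ᵀ * M * (C * R) ≠ 0 := by
  obtain ⟨c, hc, hev⟩ := h
  intro h0
  have hsq : (Cᵀ * M * C * S) * (Cᵀ * M * C * S) = 0 := by
    have : (Cᵀ * M * C * S) * (Cᵀ * M * C * S) =
        Cᵀ * M * (C * R) * ((C * R)ᵀ * M * (C * R)) * Rᵀ := by
      simp only [← hR, Matrix.transpose_mul, Matrix.mul_assoc]
    rw [this, h0, Matrix.mul_zero, Matrix.zero_mul]
  obtain ⟨v, hv⟩ := hev.exists_hasEigenvector
  have h1 : (Cᵀ * M * C * S) *ᵥ v = c • v := by simpa using hv.apply_eq_smul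
  have h2 : (c * c) • v = 0 := by
    rw [← smul_smul, ← h1, ← Matrix.mulVec_smul, ← h1, Matrix.mulVec_mulVec, hsq,
      Matrix.zero_mulVec]
  exact (smul_ne_zero (mul_ne_zero hc hc) hv.2) h2

/-- Cyclicity turns the trace into `tr (Kᵀ K)` for the symmetric matrix `K = (C R)ᵀ M (C R)`, its
squared Frobenius norm. -/
lemma trace_sq_pos [DecidableEq ι] (hM : M.PosSemidef) (hR : R * Rᵀ = S)
    (h0 : (C * R)ᵀ * M * (C * R) ≠ 0) : 0 < ((Cᵀ * M * C * S) ^ 2).trace := by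
  set K := (C * R)ᵀ * M * (C * R)
  have hK : Kᵀ = K := by
    have hMt : Mᵀ = M := by
      rw [← Matrix.conjTranspose_eq_transpose_of_trivial]
      exact hM.isHermitian
    simp only [K, Matrix.transpose_mul, Matrix.transpose_transpose, hMt, Matrix.mul_assoc]
  have htr : ((Cᵀ * M * C * S) ^ 2).trace = (Kᵀ * K).trace := by
    have e1 : (Cᵀ * M * C * S) ^ 2 = Cᵀ * M * (C * R) * K * Rᵀ := by
      simp only [K, pow_two, ← hR, Matrix.transpose_mul, Matrix.mul_assoc]
    have e2 : Kᵀ * K = Rᵀ * (Cᵀ * M * (C * R) * K) := by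
      rw [hK]
      simp only [K, Matrix.transpose_mul, Matrix.mul_assoc]
    rw [e1, e2, Matrix.trace_mul_comm]
  rw [htr, ← Matrix.conjTranspose_eq_transpose_of_trivial]
  refine lt_of_le_of_ne (Matrix.posSemidef_conjTranspose_mul_self K).trace_nonneg fun h => h0 ?_
  exact Matrix.trace_conjTranspose_mul_self_eq_zero_iff.1 h.symm

lemma posSemidef_limitForm [DecidableEq ι] (hM : M.PosSemidef) :
    ((C * R)ᵀ * coefMatrix C M S * (C * R)).PosSemidef := by
  have := (posSemidef_coefMatrix (C := C) hM S).conjTranspose_mul_mul_same (C * R)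
  rwa [Matrix.conjTranspose_eq_transpose_of_trivial] at this

lemma limitForm_ne_zero [DecidableEq ι] (hM : M.PosSemidef) (hR : R * Rᵀ = S)
    (h : (C * R)ᵀ * M * (C * R) ≠ 0) : (C * R)ᵀ * coefMatrix C M S * (C * R) ≠ 0 := by
  have htr := trace_sq_pos hM hR h
  rw [coefMatrix, if_pos htr, Matrix.mul_smul, Matrix.smul_mul]
  exact smul_ne_zero (inv_ne_zero (Real.sqrt_ne_zero'.2 (by linarith))) h

lemma limitForm_quadratic (A : Matrix ρ ρ ℝ) (g : ι → ℝ) :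
    (C *ᵥ R *ᵥ g) ⬝ᵥ A *ᵥ (C *ᵥ R *ᵥ g) = g ⬝ᵥ ((C * R)ᵀ * A * (C * R)) *ᵥ g := by
  rw [Matrix.mulVec_mulVec, Matrix.mul_assoc, ← Matrix.mulVec_mulVec (M := (C * R)ᵀ),
    ← Matrix.mulVec_mulVec (M := A), Matrix.dotProduct_mulVec g, Matrix.vecMul_transpose]

end Nondegeneracy

/-! ### Vectors of quadratic forms -/

section QuadraticVectors

variable {ι : Type*} [Fintype ι] {L : ℕ} {r : Fin L → ℕ}

/-- The vector of the quadratic forms `(C_ℓ v)ᵀ A_ℓ (C_ℓ v)`. -/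
def quadVec (C : ∀ ℓ, Matrix (Fin (r ℓ)) ι ℝ) (v : ι → ℝ)
    (A : ∀ ℓ, Fin (r ℓ) → Fin (r ℓ) → ℝ) : Fin L → ℝ :=
  fun ℓ => (C ℓ *ᵥ v) ⬝ᵥ Matrix.of (A ℓ) *ᵥ (C ℓ *ᵥ v)

lemma continuous_quadVec (C : ∀ ℓ, Matrix (Fin (r ℓ)) ι ℝ) :
    Continuous fun q : (ι → ℝ) × (∀ ℓ, Fin (r ℓ) → Fin (r ℓ) → ℝ) => quadVec C q.1 q.2 := by
  refine continuous_pi fun ℓ => ?_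
  simp only [quadVec, dotProduct, Matrix.mulVec, Matrix.of_apply]
  fun_prop

lemma continuous_quadVec_mulVec (C : ∀ ℓ, Matrix (Fin (r ℓ)) ι ℝ) (R : Matrix ι ι ℝ)
    (A : ∀ ℓ, Fin (r ℓ) → Fin (r ℓ) → ℝ) : Continuous fun g => quadVec C (R *ᵥ g) A :=
  (continuous_quadVec C).comp (f := fun g => (R *ᵥ g, A)) (by fun_prop)

lemma quadForm_eq_quadVec [DecidableEq ι] (N : ℕ) (C : ∀ ℓ, Matrix (Fin (r ℓ)) ι ℝ)
    (M : ∀ ℓ, Matrix (Fin (r ℓ)) (Fin (r ℓ)) ℝ) (S : Matrix ι ι ℝ) (v : ι → ℝ) (ℓ : Fin L) :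
    quadForm N (C ℓ) (M ℓ) S (C ℓ *ᵥ v) =
      quadVec C (√(N : ℝ) • v) (fun ℓ => coefMatrix (C ℓ) (M ℓ) S) ℓ := by
  rw [quadForm_eq, ← Matrix.mulVec_smul]
  rfl

lemma tendstoInMeasure_prodMk {Ω E F : Type*} [MeasurableSpace Ω] {P : Measure Ω}
    [IsProbabilityMeasure P] [PseudoMetricSpace E] [PseudoMetricSpace F] {X : ℕ → Ω → E} {x : E}
    {Y : ℕ → Ω → F} {y : F} (hX : TendstoInMeasure P X atTop fun _ => x)
    (hY : TendstoInMeasure P Y atTop fun _ => y) :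
    TendstoInMeasure P (fun m ω => (X m ω, Y m ω)) atTop fun _ => (x, y) := by
  rw [tendstoInMeasure_iff_measureReal_dist] at hX hY ⊢
  intro e he
  have h := (hX e he).add (hY e he)
  rw [add_zero] at h
  refine squeeze_zero (fun m => measureReal_nonneg) (fun m => ?_) h
  refine (measureReal_mono ?_).trans (measureReal_union_le _ _)
  intro ω (hω : e ≤ max (dist (X m ω) x) (dist (Y m ω) y))
  exact le_max_iff.1 hω

end QuadraticVectors

/-! ### The joint limit law of the statistics -/

section LimitLaw

variable {a d L : ℕ} {r : Fin L → ℕ}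

/-- The conditions on the weight function at the limiting covariance matrix `T`. -/
structure RegularWeight (M : WeightFunction a d) (C : Matrix (Σ ℓ, Fin (r ℓ)) (Fin d × Fin a) ℝ)
    (T : Matrix (Fin d × Fin a) (Fin d × Fin a) ℝ) : Prop where
  meas : ∀ ℓ s t, Measurable
    (fun A : Fin d × Fin a → Fin d × Fin a → ℝ => M (r ℓ) (block C ℓ) (Matrix.of A) s t)
  psd : ∀ ℓ A, A.PosSemidef → (M (r ℓ) (block C ℓ) A).PosSemidef
  eigenvalue : ∀ ℓ, ∃ c : ℝ, c ≠ 0 ∧ Module.End.HasEigenvalue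
    (Matrix.toLin' ((block C ℓ)ᵀ * M (r ℓ) (block C ℓ) T * block C ℓ * T)) c

/-- The matrices of the standardized quadratic forms at the covariance estimate `S`. -/
def coefs (M : WeightFunction a d) (C : Matrix (Σ ℓ, Fin (r ℓ)) (Fin d × Fin a) ℝ)
    (S : Matrix (Fin d × Fin a) (Fin d × Fin a) ℝ) : ∀ ℓ, Fin (r ℓ) → Fin (r ℓ) → ℝ :=
  fun ℓ => coefMatrix (block C ℓ) (M (r ℓ) (block C ℓ) S) S

/-- The joint limiting law of the test statistics under the hypotheses, where `R Rᵀ = T`. -/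
def limitLaw (M : WeightFunction a d) (C : Matrix (Σ ℓ, Fin (r ℓ)) (Fin d × Fin a) ℝ)
    (T R : Matrix (Fin d × Fin a) (Fin d × Fin a) ℝ) : Measure (Fin L → ℝ) :=
  (stdNormal (Fin d × Fin a)).map fun g => quadVec (block C) (R *ᵥ g) (coefs M C T)

variable {M : WeightFunction a d} {C : Matrix (Σ ℓ, Fin (r ℓ)) (Fin d × Fin a) ℝ}
  {T R : Matrix (Fin d × Fin a) (Fin d × Fin a) ℝ}

instance : IsProbabilityMeasure (limitLaw M C T R) :=
  Measure.isProbabilityMeasure_map (continuous_quadVec_mulVec _ _ _).aemeasurable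

lemma RegularWeight.regularLaw (hM : RegularWeight M C T) (hT : T.PosSemidef) (hR : R * Rᵀ = T)
    (hL : 1 ≤ L) : RegularLaw (limitLaw M C T R) := by
  have h := regularLaw_quadratic hL
    (fun ℓ => posSemidef_limitForm (C := block C ℓ) (R := R) (S := T) (hM.psd ℓ T hT))
    fun ℓ => limitForm_ne_zero (hM.psd ℓ T hT) hR
      (transpose_mul_mul_ne_zero hR (hM.eigenvalue ℓ))
  convert h using 1
  exact congrArg (fun f => (stdNormal (Fin d × Fin a)).map f) <| funext fun g => funext fun ℓ => 
    limitForm_quadratic (C := block C ℓ) (R := R)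
      (coefMatrix (block C ℓ) (M (r ℓ) (block C ℓ) T) T) g

variable {Ω : Type*} [MeasurableSpace Ω] {P : Measure Ω}

lemma RegularWeight.measurable_coefs (hM : RegularWeight M C T)
    {S : Ω → Matrix (Fin d × Fin a) (Fin d × Fin a) ℝ} (hS : ∀ p q, Measurable fun ω => S ω p q) :
    Measurable fun ω => coefs M C (S ω) := by
  refine measurable_pi_iff.2 fun ℓ => measurable_pi_iff.2 fun s => measurable_pi_iff.2 fun t =>
    measurable_coefMatrix_comp _ (fun s t => ?_) hS s t
  have hS' : Measurable fun ω (p q : Fin d × Fin a) => S ω p q :=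
    measurable_pi_iff.2 fun p => measurable_pi_iff.2 fun q => hS p q
  exact (hM.meas ℓ s t).comp hS'

lemma RegularWeight.tendsto_coefs [IsProbabilityMeasure P] (hM : RegularWeight M C T)
    (hT : T.PosSemidef) (hR : R * Rᵀ = T)
    {S : ℕ → Ω → Matrix (Fin d × Fin a) (Fin d × Fin a) ℝ} (hS : ConvInProb P S T)
    (hMS : ∀ ℓ, PlugInConsistent P (M (r ℓ) (block C ℓ)) S T) :
    TendstoInMeasure P (fun m ω => coefs M C (S m ω)) atTop fun _ => coefs M C T :=
  tendstoInMeasure_pi fun ℓ => tendstoInMeasure_pi fun s => tendstoInMeasure_pi fun t =>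
    (hMS ℓ hS).coefMatrix hS (trace_sq_pos (hM.psd ℓ T hT) hR
      (transpose_mul_mul_ne_zero hR (hM.eigenvalue ℓ))) s t

lemma wildStat_eq (n : Fin a → ℕ) (x : Fin a → ℕ → Fin d → ℝ) (w : Fin a → ℕ → ℝ) :
    wildStat M C n x w = quadVec (block C)
      (√(totalSize n : ℝ) • pooledMean n (wildSample n w x))
      (coefs M C (pooledCov n (wildSample n w x))) :=
  funext fun ℓ => quadForm_eq_quadVec (totalSize n) (block C)
    (fun ℓ => M (r ℓ) (block C ℓ) (pooledCov n (wildSample n w x))) _ _ ℓ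

/-- A true local hypothesis allows centring at the expectation instead of `β`. Only the hypothesis
with index `ℓ` is used, which is what makes strong control possible. -/
lemma testStat_eq {β : (Σ ℓ, Fin (r ℓ)) → ℝ} (n : Fin a → ℕ) (x : Fin a → ℕ → Fin d → ℝ)
    (S : Matrix (Fin d × Fin a) (Fin d × Fin a) ℝ) {v : Fin d × Fin a → ℝ} {ℓ : Fin L}
    (hv : block C ℓ *ᵥ v = blockVec β ℓ) :
    testStat M C β n x S ℓ = quadVec (block C)
      (√(totalSize n : ℝ) • (pooledMean n x - v)) (coefs M C S) ℓ := by
  rw [testStat, ← hv, ← Matrix.mulVec_sub]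
  exact quadForm_eq_quadVec (totalSize n) (block C) (fun ℓ => M (r ℓ) (block C ℓ) S) S _ ℓ

lemma RegularWeight.wildStat_nonneg (hM : RegularWeight M C T) (n : Fin a → ℕ)
    (x : Fin a → ℕ → Fin d → ℝ) (w : Fin a → ℕ → ℝ) (ℓ : Fin L) : 0 ≤ wildStat M C n x w ℓ :=
  quadForm_nonneg _ (hM.psd ℓ _ (posSemidef_pooledCov _ _)) _ _

lemma measurable_quadVec {ι : Type*} [Fintype ι] (C : ∀ ℓ, Matrix (Fin (r ℓ)) ι ℝ)
    {v : Ω → ι → ℝ} {A : Ω → ∀ ℓ, Fin (r ℓ) → Fin (r ℓ) → ℝ} (hv : Measurable v)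
    (hA : Measurable A) : Measurable fun ω => quadVec C (v ω) (A ω) :=
  Measurable.comp
    (g := fun q : (ι → ℝ) × (∀ ℓ, Fin (r ℓ) → Fin (r ℓ) → ℝ) => quadVec C q.1 q.2)
    (f := fun ω => (v ω, A ω)) (continuous_quadVec C).measurable (hv.prodMk hA)

lemma RegularWeight.measurable_wildStat (hM : RegularWeight M C T) (n : Fin a → ℕ)
    {w : Ω → Fin a → ℕ → ℝ} {x : Ω → Fin a → ℕ → Fin d → ℝ} (hw : Measurable w)
    (hx : Measurable x) : Measurable fun ω => wildStat M C n (x ω) (w ω) := by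
  have h : Measurable fun ω => wildSample n (w ω) (x ω) :=
    (measurable_wildSample n).comp (hw.prodMk hx)
  have h1 : Measurable fun ω => √(totalSize n : ℝ) • pooledMean n (wildSample n (w ω) (x ω)) :=
    ((measurable_pooledMean n).comp h).const_smul (√(totalSize n : ℝ))
  have h2 : Measurable fun ω => coefs M C (pooledCov n (wildSample n (w ω) (x ω))) :=
    hM.measurable_coefs fun p p' => (measurable_pooledCov n p p').comp h
  simp_rw [wildStat_eq]
  exact measurable_quadVec _ h1 h2

end LimitLaw

/-! ### Asymptotics of the test statistics and of the bootstrap distribution -/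

section Asymptotics

variable {Ω : Type*} [MeasurableSpace Ω] {P : Measure Ω} [IsProbabilityMeasure P] {a d L : ℕ}
  {r : Fin L → ℕ} {ε : Fin a → ℕ → Ω → Fin d → ℝ} {S : Fin a → Matrix (Fin d) (Fin d) ℝ}
  {W : ℕ → Fin a → ℕ → Ω → ℝ} {n : ℕ → Fin a → ℕ} {κ : Fin a → ℝ}
  {R : Matrix (Fin d × Fin a) (Fin d × Fin a) ℝ}
  {M : WeightFunction a d} {C : Matrix (Σ ℓ, Fin (r ℓ)) (Fin d × Fin a) ℝ}

/-- Convergence of the exceedance probabilities of the test statistics under the hypotheses. -/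
lemma ErrorModel.tendsto_exceedSet (hε : ErrorModel P ε S) (hn : GroupSizes n κ)
    (hM : RegularWeight M C (limitCov κ S)) (hR : R * Rᵀ = limitCov κ S) (hL : 1 ≤ L)
    (mu : Fin a → Fin d → ℝ) {Sest : ℕ → Ω → Matrix (Fin d × Fin a) (Fin d × Fin a) ℝ}
    (hSm : ∀ m p q, Measurable fun ω => Sest m ω p q) (hS : ConvInProb P Sest (limitCov κ S))
    (hMS : ∀ ℓ, PlugInConsistent P (M (r ℓ) (block C ℓ)) Sest (limitCov κ S))
    (T : Finset (Fin L)) (y : Fin L → ℝ) :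
    Tendsto (fun m => P.real {ω | quadVec (block C) (√(totalSize (n m) : ℝ) •
        (pooledMean (n m) (obs mu ε ω) - fun p : Fin d × Fin a => mu p.2 p.1))
        (coefs M C (Sest m ω)) ∈ exceedSet T y}) atTop
      (𝓝 ((limitLaw M C (limitCov κ S) R).real (exceedSet T y))) := by
  have hT := hε.posSemidef_limitCov hn.pos
  -- Slutsky's theorem. All `L` coordinates are centred at the true expectations, so the limit holds
  -- whichever hypotheses are true.
  have h := (hε.tendsto_pooledMean hn hR mu).continuous_comp_prodMk_of_tendstoInMeasure_const
    (continuous_quadVec (block C)) (hM.tendsto_coefs hT hR hS hMS)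
    fun m => (hM.measurable_coefs (hSm m)).aemeasurable
  exact tendsto_real_of_null_frontier h (isOpen_exceedSet T y).measurableSet
    ((hM.regularLaw hT hR hL).frontier_exceedSet T y)

/-- The joint limiting law of two vectors of wild bootstrap statistics. -/
lemma Multipliers.tendsto_wildStat (hW : Multipliers P ε W) (hε : ErrorModel P ε S)
    (hn : GroupSizes n κ) (hM : RegularWeight M C (limitCov κ S)) (hR : R * Rᵀ = limitCov κ S)
    (mu : Fin a → Fin d → ℝ)
    (hMW : ∀ ℓ b, PlugInConsistent P (M (r ℓ) (block C ℓ))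
      (fun m ω => pooledCov (n m) (wildSample (n m) (fun i k => W b i k ω) (obs mu ε ω)))
      (limitCov κ S)) {b c : ℕ} (hbc : b ≠ c) :
    TendstoInDistribution (fun m ω =>
      (wildStat M C (n m) (obs mu ε ω) (fun i k => W b i k ω),
       wildStat M C (n m) (obs mu ε ω) (fun i k => W c i k ω))) atTop
      (fun g => (quadVec (block C) (R *ᵥ g.1) (coefs M C (limitCov κ S)),
        quadVec (block C) (R *ᵥ g.2) (coefs M C (limitCov κ S)))) (fun _ => P)
      ((stdNormal (Fin d × Fin a)).prod (stdNormal (Fin d × Fin a))) := by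
  have hT := hε.posSemidef_limitCov hn.pos
  have hc : ∀ b, TendstoInMeasure P (fun m ω => coefs M C (pooledCov (n m)
      (wildSample (n m) (fun i k => W b i k ω) (obs mu ε ω)))) atTop
      fun _ => coefs M C (limitCov κ S) := fun b =>
    hM.tendsto_coefs hT hR (hW.convInProb_pooledCov hε hn mu b) fun ℓ => hMW ℓ b
  have hm : ∀ b m, Measurable fun ω => coefs M C (pooledCov (n m)
      (wildSample (n m) (fun i k => W b i k ω) (obs mu ε ω))) := fun b m =>
    hM.measurable_coefs fun p q => (measurable_pooledCov (n m) p q).comp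
      ((measurable_wildSample (n m)).comp ((measurable_pi_iff.2 fun i => measurable_pi_iff.2
        fun k => hW.meas b i k).prodMk (measurable_obs hε.meas mu)))
  have hg : Continuous fun q : ((Fin d × Fin a → ℝ) × (Fin d × Fin a → ℝ)) ×
      ((∀ ℓ, Fin (r ℓ) → Fin (r ℓ) → ℝ) × (∀ ℓ, Fin (r ℓ) → Fin (r ℓ) → ℝ)) =>
      (quadVec (block C) q.1.1 q.2.1, quadVec (block C) q.1.2 q.2.2) :=
    ((continuous_quadVec (block C)).comp (by fun_prop :
      Continuous fun q : ((Fin d × Fin a → ℝ) × (Fin d × Fin a → ℝ)) ×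
        ((∀ ℓ, Fin (r ℓ) → Fin (r ℓ) → ℝ) × (∀ ℓ, Fin (r ℓ) → Fin (r ℓ) → ℝ)) =>
        (q.1.1, q.2.1))).prodMk
    ((continuous_quadVec (block C)).comp (by fun_prop :
      Continuous fun q : ((Fin d × Fin a → ℝ) × (Fin d × Fin a → ℝ)) ×
        ((∀ ℓ, Fin (r ℓ) → Fin (r ℓ) → ℝ) × (∀ ℓ, Fin (r ℓ) → Fin (r ℓ) → ℝ)) =>
        (q.1.2, q.2.2)))
  simp_rw [wildStat_eq]
  exact (hW.tendsto_pooledMean hε hn hR mu hbc).continuous_comp_prodMk_of_tendstoInMeasure_const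
    hg (tendstoInMeasure_prodMk (hc b) (hc c)) fun m => ((hm b m).prodMk (hm c m)).aemeasurable

/-- The bootstrap replicates are exchangeable given the data. -/
lemma Multipliers.identDistrib_pair (hW : Multipliers P ε W) {b c b' c' : ℕ} (hbc : b ≠ c)
    (hbc' : b' ≠ c') (hε : ∀ i k, Measurable (ε i k)) :
    IdentDistrib (fun ω => ((fun i k => ε i k ω), ((fun i k => W b i k ω), fun i k => W c i k ω)))
      (fun ω => ((fun i k => ε i k ω), ((fun i k => W b' i k ω), fun i k => W c' i k ω))) P P := by
  have hinj : ∀ {b c : ℕ}, b ≠ c →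
      Function.Injective fun p : Fin 2 × Fin a × ℕ => ((![b, c] p.1 : ℕ), p.2) := by
    intro b c hbc ⟨s, p⟩ ⟨s', p'⟩ h
    obtain ⟨h1, h2⟩ := Prod.mk.inj h
    fin_cases s <;> fin_cases s' <;> simp_all
  have hpi := IdentDistrib.pi (fun p : Fin 2 × Fin a × ℕ => hW.ident (![b, c] p.1) p.2.1 p.2.2
    (![b', c'] p.1) p.2.1 p.2.2) (hW.indep.precomp (hinj hbc)) (hW.indep.precomp (hinj hbc'))
  have hpair := hpi.comp (u := fun w : Fin 2 × Fin a × ℕ → ℝ =>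
    ((fun (i : Fin a) (k : ℕ) => w (0, i, k)), fun (i : Fin a) (k : ℕ) => w (1, i, k)))
    (by fun_prop)
  have hind : ∀ b c : ℕ, IndepFun (fun ω i k => ε i k ω)
      (fun ω => ((fun i k => W b i k ω), fun i k => W c i k ω)) P := fun b c =>
    hW.data.comp (φ := id) (ψ := fun w : ℕ → Fin a → ℕ → ℝ => (w b, w c)) measurable_id
      (by fun_prop)
  exact (IdentDistrib.refl (measurable_pi_iff.2 fun i => measurable_pi_iff.2 fun k =>
    hε i k).aemeasurable).prodMk hpair (hind b c) (hind b' c')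

/-- The empirical distributions of the wild bootstrap statistics converge to the limiting law of
the test statistics. -/
lemma Multipliers.empiricallyConsistent (hW : Multipliers P ε W) (hε : ErrorModel P ε S)
    (hn : GroupSizes n κ) (hM : RegularWeight M C (limitCov κ S)) (hR : R * Rᵀ = limitCov κ S)
    (hL : 1 ≤ L) (mu : Fin a → Fin d → ℝ)
    (hMW : ∀ ℓ b, PlugInConsistent P (M (r ℓ) (block C ℓ))
      (fun m ω => pooledCov (n m) (wildSample (n m) (fun i k => W b i k ω) (obs mu ε ω)))
      (limitCov κ S)) {B : ℕ → ℕ} (hB : Tendsto B atTop atTop) :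
    EmpiricallyConsistent P
      (fun m b ω => wildStat M C (n m) (obs mu ε ω) fun i k => W b i k ω) B
      (limitLaw M C (limitCov κ S) R) := by
  intro T x
  set E := exceedSet T x
  have hE : MeasurableSet E := (isOpen_exceedSet T x).measurableSet
  set μ := limitLaw M C (limitCov κ S) R
  have hmap : ((stdNormal (Fin d × Fin a)).prod (stdNormal (Fin d × Fin a))).map
      (fun g => (quadVec (block C) (R *ᵥ g.1) (coefs M C (limitCov κ S)),
        quadVec (block C) (R *ᵥ g.2) (coefs M C (limitCov κ S)))) = μ.prod μ :=
    (Measure.map_prod_map _ _ (continuous_quadVec_mulVec _ _ _).measurable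
      (continuous_quadVec_mulVec _ _ _).measurable).symm
  have hfr : μ (frontier E) = 0 :=
    (hM.regularLaw (hε.posSemidef_limitCov hn.pos) hR hL).frontier_exceedSet T x
  have hlim := hW.tendsto_wildStat hε hn hM hR mu hMW (b := 0) (c := 1) zero_ne_one
  have hnull : ∀ F : Set (Fin L → ℝ), μ (frontier F) = 0 →
      (μ.prod μ) (frontier (E ×ˢ F)) = 0 := fun F hF => by
    rw [frontier_prod_eq]
    refine measure_union_null ?_ ?_
    · rw [Measure.prod_prod, hF, mul_zero]
    · rw [Measure.prod_prod, hfr, zero_mul]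
  -- A general second set `F` covers both moments of the empirical frequency: `F = univ` gives the
  -- probability of one event, `F = E` that of two events jointly.
  have ht : ∀ F : Set (Fin L → ℝ), MeasurableSet F → μ (frontier F) = 0 →
      Tendsto (fun m => P.real
        ({ω | wildStat M C (n m) (obs mu ε ω) (fun i k => W 0 i k ω) ∈ E} ∩
          {ω | wildStat M C (n m) (obs mu ε ω) (fun i k => W 1 i k ω) ∈ F})) atTop
        (𝓝 (μ.real E * μ.real F)) := fun F hFm hF => by
    have h := tendsto_real_of_null_frontier hlim (hE.prod hFm) (by rw [hmap]; exact hnull F hF)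
    rwa [hmap, measureReal_prod_prod] at h
  have hex : ∀ m b c (F : Set (Fin L → ℝ)), MeasurableSet F → b ≠ c → P.real
      ({ω | wildStat M C (n m) (obs mu ε ω) (fun i k => W b i k ω) ∈ E} ∩
        {ω | wildStat M C (n m) (obs mu ε ω) (fun i k => W c i k ω) ∈ F}) = P.real
      ({ω | wildStat M C (n m) (obs mu ε ω) (fun i k => W 0 i k ω) ∈ E} ∩
        {ω | wildStat M C (n m) (obs mu ε ω) (fun i k => W 1 i k ω) ∈ F}) := by
    intro m b c F hF hbc
    have hq : ∀ {w : (Fin a → ℕ → Fin d → ℝ) × (Fin a → ℕ → ℝ) × (Fin a → ℕ → ℝ) →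
        Fin a → ℕ → ℝ}, Measurable w → Measurable fun q => wildStat M C (n m)
          (fun i k => mu i + q.1 i k) (w q) := fun hw =>
      hM.measurable_wildStat (n m) hw (by fun_prop)
    have h := (hW.identDistrib_pair hbc zero_ne_one hε.meas).measure_mem_eq
      ((hq (measurable_fst.comp measurable_snd) hE).inter
        (hq (measurable_snd.comp measurable_snd) hF))
    exact congrArg ENNReal.toReal h
  refine tendstoInMeasure_empFreq
    (A := fun m b => {ω | wildStat M C (n m) (obs mu ε ω) (fun i k => W b i k ω) ∈ E})
    (fun m b => ?_) hB (fun m b => ?_) (fun m b c hbc => hex m b c E hE hbc) ?_ ?_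
  · exact hM.measurable_wildStat (n m) (measurable_pi_iff.2 fun i => measurable_pi_iff.2
      fun k => hW.meas b i k) (measurable_obs hε.meas mu) hE
  · simpa using hex m b (b + 1) Set.univ MeasurableSet.univ (Nat.succ_ne_self b).symm
  · simpa using ht Set.univ MeasurableSet.univ (by simp)
  · simpa [pow_two] using ht E hE hfr

end Asymptotics

end

end QFMCT

/-! ### Assembly of the main theorem -/

theorem mainTheorem6
    {Ω : Type*} [MeasurableSpace Ω] (P : Measure Ω) [IsProbabilityMeasure P]
    {a d L : ℕ} (ha : 2 ≤ a) (hL : 1 ≤ L) (r : Fin L → ℕ)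
    -- the model: expectation vectors, errors and their covariance matrices
    (mu : Fin a → Fin d → ℝ) (ε : Fin a → ℕ → Ω → Fin d → ℝ)
    (S : Fin a → Matrix (Fin d) (Fin d) ℝ)
    (hε_meas : ∀ i k, Measurable (ε i k))
    (hε_indep : iIndepFun (fun (p : Fin a × ℕ) => ε p.1 p.2) P)
    (hε_ident : ∀ i k j, IdentDistrib (fun ω => ε i k ω j) (fun ω => ε i 0 ω j) P P)
    (hε_sq : ∀ i k j, MemLp (fun ω => ε i k ω j) 2 P)
    (hε_mean : ∀ i k j, ∫ ω, ε i k ω j ∂P = 0)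
    (hε_cov : ∀ i k j j', cov[fun ω => ε i k ω j, fun ω => ε i k ω j'; P] = S i j j')
    -- the group sizes
    (n : ℕ → Fin a → ℕ) (κ : Fin a → ℝ)
    (hN : Tendsto (fun m => QFMCT.totalSize (n m)) atTop atTop)
    (hκ : ∀ i, 0 < κ i ∧ κ i ≤ 1)
    (hn : ∀ i, Tendsto (fun m => (n m i : ℝ) / (QFMCT.totalSize (n m) : ℝ)) atTop (𝓝 (κ i)))
    -- the hypothesis matrix in `L` blocks, and the right-hand side
    (C : Matrix (Σ ℓ, Fin (r ℓ)) (Fin d × Fin a) ℝ) (β : (Σ ℓ, Fin (r ℓ)) → ℝ)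
    -- the covariance estimator of the test statistics
    (Sest : ℕ → Ω → Matrix (Fin d × Fin a) (Fin d × Fin a) ℝ)
    (hSest_meas : ∀ m p q, Measurable (fun ω => Sest m ω p q))
    (hSest : QFMCT.ConvInProb P Sest (QFMCT.limitCov κ S))
    -- the wild bootstrap multipliers of the replicates `b = 0, 1, …`
    (W : ℕ → Fin a → ℕ → Ω → ℝ)
    (hW_meas : ∀ b i k, Measurable (W b i k))
    (hW_indep : iIndepFun (fun (p : ℕ × Fin a × ℕ) => W p.1 p.2.1 p.2.2) P)
    (hW_ident : ∀ b i k b' i' k', IdentDistrib (W b i k) (W b' i' k') P P)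
    (hW_sq : ∀ b i k, MemLp (W b i k) 2 P)
    (hW_mean : ∀ b i k, ∫ ω, W b i k ω ∂P = 0)
    (hW_var : ∀ b i k, Var[W b i k; P] = 1)
    (hW_data : IndepFun (fun ω i k => ε i k ω) (fun ω b i k => W b i k ω) P)
    -- the matrix-valued function that defines the quadratic forms
    (M : QFMCT.WeightFunction a d)
    (hM_meas : ∀ ℓ s t, Measurable
      (fun A : Fin d × Fin a → Fin d × Fin a → ℝ => M (r ℓ) (QFMCT.block C ℓ) (Matrix.of A) s t))
    (hM_psd : ∀ ℓ A, A.PosSemidef → (M (r ℓ) (QFMCT.block C ℓ) A).PosSemidef)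
    (hM_est_psd : ∀ ℓ m ω, (M (r ℓ) (QFMCT.block C ℓ) (Sest m ω)).PosSemidef)
    (hM_est : ∀ ℓ, QFMCT.PlugInConsistent P (M (r ℓ) (QFMCT.block C ℓ)) Sest
      (QFMCT.limitCov κ S))
    (hM_wild : ∀ ℓ b, QFMCT.PlugInConsistent P (M (r ℓ) (QFMCT.block C ℓ))
      (fun m ω => QFMCT.pooledCov (n m)
        (QFMCT.wildSample (n m) (fun i k => W b i k ω) (QFMCT.obs mu ε ω)))
      (QFMCT.limitCov κ S))
    -- nondegeneracy
    (hA3 : ∀ ℓ, ∃ c : ℝ, c ≠ 0 ∧ Module.End.HasEigenvalue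
      (Matrix.toLin' ((QFMCT.block C ℓ)ᵀ * M (r ℓ) (QFMCT.block C ℓ) (QFMCT.limitCov κ S) *
        QFMCT.block C ℓ * QFMCT.limitCov κ S)) c)
    -- level and numbers of bootstrap replicates
    (α : ℝ) (hα : 0 < α ∧ α < 1) (B : ℕ → ℕ) (hB : Tendsto B atTop atTop) :
    -- asymptotically exact level under the global null hypothesis
    (C *ᵥ (fun p : Fin d × Fin a => mu p.2 p.1) = β →
      Tendsto (fun m => P.real {ω | 1 < ⨆ ℓ, QFMCT.testRatio α M C β (n m) (B m)
          (QFMCT.obs mu ε ω) (Sest m ω) (fun b i k => W b i k ω) ℓ})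
        atTop (𝓝 α)) ∧
    -- asymptotic strong control of the family-wise error rate
    (∀ T : Finset (Fin L),
      (∀ ℓ ∈ T, QFMCT.block C ℓ *ᵥ (fun p : Fin d × Fin a => mu p.2 p.1) =
        QFMCT.blockVec β ℓ) →
      ∃ c ≤ α,
        Tendsto (fun m => P.real {ω | ∃ ℓ ∈ T, 1 < QFMCT.testRatio α M C β (n m) (B m)
            (QFMCT.obs mu ε ω) (Sest m ω) (fun b i k => W b i k ω) ℓ})
          atTop (𝓝 c)) := by
  have hε : QFMCT.ErrorModel P ε S := ⟨hε_meas, hε_indep, hε_ident, hε_sq, hε_mean, fun i k j j' => by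
    rw [← hε_cov i k j j', covariance_eq_sub (hε_sq i k j) (hε_sq i k j'), hε_mean, zero_mul,
      sub_zero]
    rfl⟩
  have hW : QFMCT.Multipliers P ε W := ⟨hW_meas, hW_indep, hW_ident, hW_sq, hW_mean,
    fun b i k => by
      rw [← hW_var b i k, variance_of_integral_eq_zero (hW_meas b i k).aemeasurable
        (hW_mean b i k)]
      simp_rw [pow_two], hW_data⟩
  have hsize : QFMCT.GroupSizes n κ := ⟨hN, fun i => (hκ i).1, hn⟩
  have hM : QFMCT.RegularWeight M C (QFMCT.limitCov κ S) := ⟨hM_meas, hM_psd, hA3⟩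
  have hT := hε.posSemidef_limitCov hsize.pos
  obtain ⟨R, hR⟩ := QFMCT.exists_mul_transpose_eq hT
  have hreg := hM.regularLaw hT hR hL
  obtain ⟨x, hx⟩ := hreg.exists_isUpperQuantile
  obtain ⟨γ, hγ, hγα⟩ := hx.exists_level hL hα
  have hcons := hW.empiricallyConsistent hε hsize hM hR hL mu hM_wild hB
  have hlim : ∀ T : Finset (Fin L), (∀ ℓ ∈ T, QFMCT.block C ℓ *ᵥ
      (fun p : Fin d × Fin a => mu p.2 p.1) = QFMCT.blockVec β ℓ) →
      Tendsto (fun m => P.real {ω | ∃ ℓ ∈ T, 1 < QFMCT.testRatio α M C β (n m) (B m)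
        (QFMCT.obs mu ε ω) (Sest m ω) (fun b i k => W b i k ω) ℓ}) atTop
        (𝓝 ((QFMCT.limitLaw M C (QFMCT.limitCov κ S) R).real (QFMCT.exceedSet T (x γ)))) := by
    intro T hT
    refine (hcons.tendsto_exceed hB hreg hx hγ hγα (hε.tendsto_exceedSet hsize hM hR hL mu
      hSest_meas hSest hM_est T)).congr fun m => ?_
    congr 1
    ext ω
    refine exists_congr fun ℓ => and_congr_right fun hℓ => ?_
    rw [← QFMCT.testStat_eq _ _ _ (hT ℓ hℓ)]
    exact (QFMCT.one_lt_ratio (QFMCT.quadForm_nonneg _ (hM_est_psd ℓ m ω) _ _)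
      (QFMCT.critValue_nonneg (fun b ℓ => hM.wildStat_nonneg _ _ _ ℓ) ℓ)).symm
  refine ⟨fun h0 => ?_, fun T hT => ⟨_, ?_, hlim T hT⟩⟩
  · have h := hlim Finset.univ fun ℓ _ => by
      rw [← h0]
      rfl
    rw [hγα] at h
    refine h.congr fun m => ?_
    simp only [lt_iSup_iff, Finset.mem_univ, true_and]
  -- Exceeding a threshold within `T` is a special case of exceeding one anywhere, so the limit is
  -- at most the calibrated value `α`.
  · rw [← hγα]
    exact measureReal_mono fun z ⟨ℓ, _, hℓ⟩ => ⟨ℓ, Finset.mem_univ ℓ, hℓ⟩
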